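/- All fields have characteristic $0$. A $\sigma\delta$-ring is a commutative ring with an automorphism $\sigma$ and a derivation $\delta$ that commute. For a $\sigma\delta$-field $K$ let $C_K=\{x\in K:\sigma(x)=x\}$ and let $D_K$ be the relative algebraic closure of $C_K$ in $K$; $qr$ denotes the total ring of fractions, which carries the unique extensions of $\sigma$ and $\delta$. If $F$ is a $\sigma\delta$-field and $B\in GL_m(F)$, a Picard-Vessiot extension of $F$ for $\sigma Z=BZ$ is a non-zero $\sigma\delta$-ring $S\supseteq F$ that has no ideals stable under $\sigma$ and $\delta$ except $0$ and $S$, and that is generated over $F$, as a $\delta$-ring, by the entries of some $Z\in GL_m(S)$ with $\sigma(Z)=BZ$ and by $\det(Z)^{-1}$. Let $k$ be a $\sigma\delta$-field with $C_k=D_k$, let $A\in GL_m(k)$, and let $L=k\langle X\rangle$ be the $\sigma\delta$-field generated over $k$, as a differential field, by an $m\times m$ matrix $X$ of differential indeterminates, with $\sigma(X)=AX$. Let $kC_L\subseteq L$ be the compositum and let $R=kC_L\{X,\det(X)^{-1}\}\subseteq L$ be the $\delta$-ring generated over $kC_L$ by the entries of $X$ and $\det(X)^{-1}$. Let $C$ be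 an algebraic closure of $C_L$ with the unique derivation extending that of $C_L$ and with $\sigma$ acting as the identity. Equip $R\otimes_{C_L}C$ and $L\otimes_{C_L}C$ with $\sigma(x\otimes c)=\sigma(x)\otimes c$ and $\delta(x\otimes c)=\delta(x)\otimes c+x\otimes\delta(c)$, and let $kC\subseteq R\otimes_{C_L}C$ be the subring generated by $kC_L\otimes 1$ and $1\otimes C$. Then: (i) $kC$ is a field, $R\otimes_{C_L}C$ is a Picard-Vessiot extension of $kC$ for $\sigma Z=AZ$, and the natural map $R\otimes_{C_L}C\to L\otimes_{C_L}C$ is a homomorphism of $\sigma\delta$-rings that makes $L\otimes_{C_L}C$ the total ring of fractions of $R\otimes_{C_L}C$. (ii) $l=[D_L:C_L]$ is finite, and $R\otimes_{C_L}C$ has a decomposition $\bigoplus_{i=0}^{l-1}R_i$ as a direct sum of domains with $\sigma(R_i)=R_{i+1}$ (indices modulo $l$). For every such decomposition, $R_0$ (and likewise every $R_i$), with the automorphism $\sigma^l$ and the derivation $\delta$, is a Picard-Vessiot extension of (the isomorphic image of) $kC$ for $\sigma^lZ=A_lZ$, where $A_l=\sigma^{l-1}(A)\sigma^{l-2}(A)\cdots\sigma(A)A$.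 Moreover, for every embedding $D_L\to C$ over $C_L$, the formulas $\sigma^l(x\otimes c)=\sigma^l(x)\otimes c$ and $\delta(x\otimes c)=\delta(x)\otimes c+x\otimes\delta(c)$ define a $\sigma^l\delta$-ring structure on $L\otimes_{D_L}C$, and $qr(R_0)\cong L\otimes_{D_L}C$ as $\sigma^l\delta$-rings (and likewise for every $R_i$). -/

import Mathlib

open scoped TensorProduct

noncomputable section

/-- A `σδ`-structure on a commutative ring: an automorphism `σ` and a derivation `δ` that
commute with each other. -/
structure SDStruct (R : Type*) [CommRing R] where
  sigma : R ≃+* R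
  delta : Derivation ℤ R R
  comm : ∀ x, sigma (delta x) = delta (sigma x)

/-- `f` is a homomorphism of `σδ`-rings. -/
structure IsSDHom {R S : Type*} [CommRing R] [CommRing S] (s : SDStruct R) (t : SDStruct S)
    (f : R →+* S) : Prop where
  sigma : ∀ x, f (s.sigma x) = t.sigma (f x)
  delta : ∀ x, f (s.delta x) = t.delta (f x)

namespace SDStruct

section Ring

variable {R : Type*} [CommRing R]

theorem symm_comm (s : SDStruct R) (x : R) :
    s.sigma.symm (s.delta x) = s.delta (s.sigma.symm x) := by
  apply s.sigma.injective
  rw [s.comm]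
  simp

/-- The derivation `d`, together with the identity automorphism. -/
def ofDerivation (d : Derivation ℤ R R) : SDStruct R where
  sigma := RingEquiv.refl R
  delta := d
  comm _ := rfl

theorem pow_sigma_apply (s : SDStruct R) (n : ℕ) (x : R) :
    ((s.sigma : RingAut R) ^ n) x = s.sigma^[n] x := by
  induction n generalizing x with
  | zero => rfl
  | succ n ih => rw [pow_succ, RingAut.mul_apply, ih, Function.iterate_succ_apply]

/-- The `σⁿδ`-structure: replace `σ` by its `n`-th iterate, keep `δ`. -/
def pow (s : SDStruct R) (n : ℕ) : SDStruct R where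
  sigma := (s.sigma : RingAut R) ^ n
  delta := s.delta
  comm x := by
    rw [pow_sigma_apply, pow_sigma_apply]
    induction n generalizing x with
    | zero => rfl
    | succ n ih => rw [Function.iterate_succ_apply, s.comm, ih, ← Function.iterate_succ_apply]

/-- The restriction of a `σδ`-structure to a subring stable under `σ`, `σ⁻¹` and `δ`. -/
def restrict {S : Type*} [SetLike S R] [SubringClass S R] (s : SDStruct R) (T : S)
    (h₁ : ∀ x ∈ T, s.sigma x ∈ T) (h₂ : ∀ x ∈ T, s.sigma.symm x ∈ T)
    (h₃ : ∀ x ∈ T, s.delta x ∈ T) : SDStruct T where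
  sigma :=
    { toFun := fun x => ⟨s.sigma x, h₁ x x.2⟩
      invFun := fun x => ⟨s.sigma.symm x, h₂ x x.2⟩
      left_inv := fun x => by simp
      right_inv := fun x => by simp
      map_mul' := fun x y => by ext; simp
      map_add' := fun x y => by ext; simp }
  delta := Derivation.mk'
    (AddMonoidHom.toIntLinearMap
      { toFun := fun x => ⟨s.delta x, h₃ x x.2⟩
        map_zero' := by ext; simp
        map_add' := fun x y => by ext; simp })
    (fun x y => by ext; simp)
  comm x := by
    ext
    exact s.comm x

/-- The smallest subring containing `T` and stable under `δ`. -/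
def deltaAdjoin (s : SDStruct R) (T : Set R) : Subring R :=
  sInf {U : Subring R | T ⊆ U ∧ ∀ x ∈ U, s.delta x ∈ U}

theorem subset_deltaAdjoin (s : SDStruct R) (T : Set R) : T ⊆ s.deltaAdjoin T := by
  intro x hx
  simp only [deltaAdjoin, SetLike.mem_coe, Subring.mem_sInf]
  exact fun U hU => hU.1 hx

theorem delta_mem_deltaAdjoin (s : SDStruct R) (T : Set R) :
    ∀ x ∈ s.deltaAdjoin T, s.delta x ∈ s.deltaAdjoin T := by
  intro x hx
  simp only [deltaAdjoin, Subring.mem_sInf] at hx ⊢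
  exact fun U hU => hU.2 x (hx U hU)

theorem map_mem_deltaAdjoin (s : SDStruct R) (T : Set R) (f : R →+* R)
    (hf : ∀ x, f (s.delta x) = s.delta (f x)) (hT : ∀ x ∈ T, f x ∈ s.deltaAdjoin T) :
    ∀ x ∈ s.deltaAdjoin T, f x ∈ s.deltaAdjoin T := by
  intro x hx
  have hx' := hx
  simp only [deltaAdjoin, Subring.mem_sInf] at hx'
  refine hx' ((s.deltaAdjoin T).comap f) ⟨fun y hy => hT y hy, fun y hy => ?_⟩
  rw [Subring.mem_comap] at hy ⊢
  rw [hf]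
  exact s.delta_mem_deltaAdjoin T _ hy

theorem delta_idempotent (s : SDStruct R) {e : R} (he : IsIdempotentElem e) :
    s.delta e = 0 := by
  have h : s.delta (e * e) = s.delta e := by rw [he.eq]
  rw [Derivation.leibniz, smul_eq_mul] at h
  have h2 : e * s.delta e = 0 := by
    have h3 := congrArg (fun z => e * z) h
    simp only [mul_add, ← mul_assoc, he.eq] at h3
    simpa using h3
  rw [← h, h2, add_zero]

/-- The `σδ`-structure induced on the direct factor `eR`, for an idempotent `e` fixed
by `σ`. -/
def corner (s : SDStruct R) {e : R} (he : IsIdempotentElem e) (hσ : s.sigma e = e) :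
    SDStruct he.Corner where
  sigma :=
    { toFun := fun x => ⟨s.sigma x.1, by
        obtain ⟨y, hy⟩ := x.2
        exact ⟨s.sigma y, by rw [← hy]; simp [hσ]⟩⟩
      invFun := fun x => ⟨s.sigma.symm x.1, by
        obtain ⟨y, hy⟩ := x.2
        have hσ' : s.sigma.symm e = e := by rw [RingEquiv.symm_apply_eq, hσ]
        exact ⟨s.sigma.symm y, by rw [← hy]; simp [hσ']⟩⟩
      left_inv := fun x => Subtype.ext (s.sigma.symm_apply_apply x.1)
      right_inv := fun x => Subtype.ext (s.sigma.apply_symm_apply x.1)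
      map_mul' := fun x y => Subtype.ext (map_mul s.sigma x.1 y.1)
      map_add' := fun x y => Subtype.ext (map_add s.sigma x.1 y.1) }
  delta := Derivation.mk'
    (AddMonoidHom.toIntLinearMap
      { toFun := fun x => ⟨s.delta x.1, by
          obtain ⟨y, hy⟩ := x.2
          exact ⟨s.delta y, by
            rw [← hy]
            simp only [Derivation.leibniz, s.delta_idempotent he, smul_eq_mul]
            ring⟩⟩
        map_zero' := Subtype.ext (map_zero s.delta)
        map_add' := fun x y => Subtype.ext (map_add s.delta x.1 y.1) })
    (fun x y => Subtype.ext (s.delta.leibniz x.1 y.1))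
  comm x := Subtype.ext (s.comm x.1)

end Ring

section Tensor

variable {F B C : Type*} [CommRing F] [CommRing B] [CommRing C] [Algebra F B] [Algebra F C]

/-- The additive map `σ ⊗ σ'` on `B ⊗ C`, for `σ`, `σ'` extending the same map of the base. -/
def tensorSigmaAux (f : F ≃+* F) (g : B ≃+* B) (h : C ≃+* C)
    (hg : ∀ a, g (algebraMap F B a) = algebraMap F B (f a))
    (hh : ∀ a, h (algebraMap F C a) = algebraMap F C (f a)) : B ⊗[F] C →+ B ⊗[F] C :=
  TensorProduct.liftAddHom
    (AddMonoidHom.mk' (fun b => AddMonoidHom.mk' (fun c => g b ⊗ₜ[F] h c)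
      (fun c c' => by rw [map_add, TensorProduct.tmul_add]))
      (fun b b' => by ext c; simp [TensorProduct.add_tmul]))
    (fun a b c => by
      simp only [AddMonoidHom.mk'_apply, Algebra.smul_def, map_mul, hg, hh]
      rw [← Algebra.smul_def, ← Algebra.smul_def, TensorProduct.smul_tmul])

@[simp] theorem tensorSigmaAux_tmul (f : F ≃+* F) (g : B ≃+* B) (h : C ≃+* C)
    (hg : ∀ a, g (algebraMap F B a) = algebraMap F B (f a))
    (hh : ∀ a, h (algebraMap F C a) = algebraMap F C (f a)) (b : B) (c : C) :
    tensorSigmaAux f g h hg hh (b ⊗ₜ[F] c) = g b ⊗ₜ[F] h c := rfl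

/-- The additive map `δ ⊗ 1 + 1 ⊗ δ'` on `B ⊗ C`, for `δ`, `δ'` extending the same derivation
of the base. -/
def tensorDeltaAux (d : Derivation ℤ F F) (g : Derivation ℤ B B) (h : Derivation ℤ C C)
    (hg : ∀ a, g (algebraMap F B a) = algebraMap F B (d a))
    (hh : ∀ a, h (algebraMap F C a) = algebraMap F C (d a)) : B ⊗[F] C →+ B ⊗[F] C :=
  TensorProduct.liftAddHom
    (AddMonoidHom.mk' (fun b => AddMonoidHom.mk' (fun c => g b ⊗ₜ[F] c + b ⊗ₜ[F] h c)
      (fun c c' => by simp only [map_add, TensorProduct.tmul_add]; abel))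
      (fun b b' => by
        ext c
        simp only [AddMonoidHom.mk'_apply, AddMonoidHom.add_apply, map_add,
          TensorProduct.add_tmul]
        abel))
    (fun a b c => by
      have h1 : g (a • b) = a • g b + d a • b := by
        rw [Algebra.smul_def, Derivation.leibniz, hg, smul_eq_mul, smul_eq_mul, Algebra.smul_def,
          Algebra.smul_def, mul_comm b]
      have h2 : h (a • c) = a • h c + d a • c := by
        rw [Algebra.smul_def, Derivation.leibniz, hh, smul_eq_mul, smul_eq_mul, Algebra.smul_def,
          Algebra.smul_def, mul_comm c]
      simp only [AddMonoidHom.mk'_apply, h1, h2, TensorProduct.add_tmul, TensorProduct.tmul_add,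
        TensorProduct.smul_tmul]
      abel)

@[simp] theorem tensorDeltaAux_tmul (d : Derivation ℤ F F) (g : Derivation ℤ B B)
    (h : Derivation ℤ C C) (hg : ∀ a, g (algebraMap F B a) = algebraMap F B (d a))
    (hh : ∀ a, h (algebraMap F C a) = algebraMap F C (d a)) (b : B) (c : C) :
    tensorDeltaAux d g h hg hh (b ⊗ₜ[F] c) = g b ⊗ₜ[F] c + b ⊗ₜ[F] h c := rfl

/-- The tensor product of two `σδ`-rings over a `σδ`-ring:
`σ (b ⊗ c) = σ b ⊗ σ c` and `δ (b ⊗ c) = δ b ⊗ c + b ⊗ δ c`. -/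
def tensor (sF : SDStruct F) (sB : SDStruct B) (sC : SDStruct C)
    (hB : IsSDHom sF sB (algebraMap F B)) (hC : IsSDHom sF sC (algebraMap F C)) :
    SDStruct (B ⊗[F] C) where
  sigma :=
    { toFun := tensorSigmaAux sF.sigma sB.sigma sC.sigma (fun a => (hB.sigma a).symm) (fun a => (hC.sigma a).symm)
      invFun := tensorSigmaAux sF.sigma.symm sB.sigma.symm sC.sigma.symm
        (fun a => by
          rw [RingEquiv.symm_apply_eq, ← hB.sigma, RingEquiv.apply_symm_apply])
        (fun a => by
          rw [RingEquiv.symm_apply_eq, ← hC.sigma, RingEquiv.apply_symm_apply])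
      left_inv := fun x => by
        induction x with
        | zero => simp
        | add x y hx hy => rw [map_add, map_add, hx, hy]
        | tmul b c => simp
      right_inv := fun x => by
        induction x with
        | zero => simp
        | add x y hx hy => rw [map_add, map_add, hx, hy]
        | tmul b c => simp
      map_mul' := fun x y => by
        induction x with
        | zero => simp
        | add x x' hx hx' => rw [add_mul, map_add, hx, hx', map_add, add_mul]
        | tmul b c =>
          induction y with
          | zero => simp
          | add y y' hy hy' => rw [mul_add, map_add, hy, hy', map_add, mul_add]
          | tmul b' c' => simp
      map_add' := map_add _ }
  delta := Derivation.mk'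
    (tensorDeltaAux sF.delta sB.delta sC.delta (fun a => (hB.delta a).symm)
      (fun a => (hC.delta a).symm)).toIntLinearMap
    (fun x y => by
      simp only [AddMonoidHom.coe_toIntLinearMap, smul_eq_mul]
      induction x with
      | zero => simp
      | add x x' hx hx' => rw [add_mul, map_add, hx, hx', map_add]; ring
      | tmul b c =>
        induction y with
        | zero => simp
        | add y y' hy hy' => rw [mul_add, map_add, hy, hy', map_add]; ring
        | tmul b' c' =>
          simp only [Algebra.TensorProduct.tmul_mul_tmul, tensorDeltaAux_tmul,
            Derivation.leibniz, smul_eq_mul, TensorProduct.add_tmul, TensorProduct.tmul_add,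
            mul_add]
          rw [mul_comm b' b, mul_comm c' c, mul_comm b' (sB.delta b), mul_comm c' (sC.delta c)]
          abel)
  comm x := by
    have h1 := fun a => (hB.sigma a).symm
    have h2 := fun a => (hC.sigma a).symm
    have h3 := fun a => (hB.delta a).symm
    have h4 := fun a => (hC.delta a).symm
    change tensorSigmaAux sF.sigma sB.sigma sC.sigma h1 h2
        (tensorDeltaAux sF.delta sB.delta sC.delta h3 h4 x) =
      tensorDeltaAux sF.delta sB.delta sC.delta h3 h4
        (tensorSigmaAux sF.sigma sB.sigma sC.sigma h1 h2 x)
    induction x with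
    | zero => simp
    | add x y hx hy => rw [map_add, map_add, hx, hy, map_add, map_add]
    | tmul b c => simp [sB.comm, sC.comm]

end Tensor

section Field

variable {K : Type*} [Field K]

/-- The field `C_K` of constants: the elements fixed by `σ`. -/
def const (s : SDStruct K) : Subfield K where
  carrier := {x | s.sigma x = x}
  zero_mem' := map_zero _
  one_mem' := map_one _
  add_mem' {x y} hx hy := by
    change s.sigma (x + y) = x + y
    rw [map_add, hx, hy]
  mul_mem' {x y} hx hy := by
    change s.sigma (x * y) = x * y
    rw [map_mul, hx, hy]
  neg_mem' {x} hx := by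
    change s.sigma (-x) = -x
    rw [map_neg, hx]
  inv_mem' x hx := by
    change s.sigma x⁻¹ = x⁻¹
    rw [map_inv₀, hx]

theorem mem_const (s : SDStruct K) {x : K} : x ∈ s.const ↔ s.sigma x = x := Iff.rfl

/-- `C_K` as a `σδ`-field. -/
def constSD (s : SDStruct K) : SDStruct s.const :=
  s.restrict s.const (fun x hx => by rw [hx]; exact hx)
    (fun x hx => by
      have : s.sigma.symm x = x := by rw [RingEquiv.symm_apply_eq, hx]
      rw [this]; exact hx)
    (fun x hx => by
      rw [mem_const, s.comm, hx])

theorem constSD_isSDHom (s : SDStruct K) :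
    IsSDHom s.constSD s (algebraMap s.const K) :=
  ⟨fun _ => rfl, fun _ => rfl⟩

/-- The field `D_K`: the relative algebraic closure of `C_K` in `K`. -/
abbrev algConst (s : SDStruct K) : IntermediateField s.const K :=
  algebraicClosure s.const K

end Field

end SDStruct

/-- `S` is a Picard-Vessiot extension of its subring `F` for the equation `σ Z = B Z`: `F` is a
field stable under `σ`, `σ⁻¹` and `δ`, the matrix `B` belongs to `GL_m(F)`, the ring `S` has no
ideals stable under `σ` and `δ` but `0` and `S ≠ 0`, and `S` is generated over `F`, as a
`δ`-ring, by the entries of a fundamental matrix `Z` of solutions and by `(det Z)⁻¹`. -/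
structure IsPicardVessiot {S : Type*} [CommRing S] (s : SDStruct S) (F : Subring S) {m : ℕ}
    (B : Matrix (Fin m) (Fin m) S) : Prop where
  isField : IsField F
  sigma_mem : ∀ x ∈ F, s.sigma x ∈ F
  sigma_symm_mem : ∀ x ∈ F, s.sigma.symm x ∈ F
  delta_mem : ∀ x ∈ F, s.delta x ∈ F
  coeff_mem : ∀ i j, B i j ∈ F
  isUnit_det : IsUnit B.det
  nontrivial : Nontrivial S
  simple : ∀ I : Ideal S, (∀ x ∈ I, s.sigma x ∈ I) → (∀ x ∈ I, s.delta x ∈ I) → I = ⊥ ∨ I = ⊤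
  fundamental : ∃ Z : Matrix (Fin m) (Fin m) S, IsUnit Z.det ∧ Z.map s.sigma = B * Z ∧
    s.deltaAdjoin ((F : Set S) ∪ (Set.range fun p : Fin m × Fin m => Z p.1 p.2) ∪
      {Ring.inverse Z.det}) = ⊤

/-- `f : A → Q` makes `Q` the total ring of fractions of `A`. -/
def IsTotalFractionRing {A Q : Type*} [CommRing A] [CommRing Q] (f : A →+* Q) : Prop :=
  @IsFractionRing A _ Q _ f.toAlgebra

/-- The product `σ^(n-1)(A) ⋯ σ(A) A`. -/
def sigmaProd {k : Type*} [CommRing k] (s : SDStruct k) {m : ℕ} (A : Matrix (Fin m) (Fin m) k) :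
    ℕ → Matrix (Fin m) (Fin m) k
  | 0 => 1
  | n + 1 => A.map (s.sigma^[n]) * sigmaProd s A n

/-- The projection of `S` onto its direct factor `eS`, `e` an idempotent. -/
def toCorner {S : Type*} [CommRing S] {e : S} (he : IsIdempotentElem e) : S →+* he.Corner where
  toFun x := ⟨e * x * e, x, rfl⟩
  map_one' := Subtype.ext (by change e * 1 * e = e; rw [mul_one, he.eq])
  map_zero' := Subtype.ext (by change e * 0 * e = 0; simp)
  map_add' x y := Subtype.ext (by change e * (x + y) * e = e * x * e + e * y * e; ring)
  map_mul' x y := Subtype.ext (by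
    change e * (x * y) * e = e * x * e * (e * y * e)
    have h := he.eq
    linear_combination (-((e ^ 2 + e) * x * y)) * h)

/-- A decomposition of the `σδ`-ring `S` as a direct sum `R₀ ⊕ ⋯ ⊕ R_{l-1}` of domains such that
`σ(R_i) = R_{i+1}` (indices modulo `l`), given by the idempotents `e i` with `R_i = (e i) S`. -/
structure IsSigmaDecomposition {S : Type*} [CommRing S] (s : SDStruct S) {l : ℕ}
    (e : Fin l → S) : Prop where
  complete : CompleteOrthogonalIdempotents e
  sigma_apply : ∀ i, s.sigma (e i) = e (finRotate l i)
  isDomain : ∀ i, IsDomain (complete.idem i).Corner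

theorem IsSigmaDecomposition.pow_apply {S : Type*} [CommRing S] {s : SDStruct S} {l : ℕ}
    {e : Fin l → S} (h : IsSigmaDecomposition s e) (i : Fin l) :
    (s.pow l).sigma (e i) = e i := by
  have key : ∀ n, s.sigma^[n] (e i) = e ((finRotate l)^[n] i) := by
    intro n
    induction n with
    | zero => rfl
    | succ n ih => rw [Function.iterate_succ_apply', ih, h.sigma_apply,
        Function.iterate_succ_apply']
  change ((s.sigma : RingAut S) ^ l) (e i) = e i
  rw [SDStruct.pow_sigma_apply, key]
  congr 1
  cases l with
  | zero => exact i.elim0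
  | succ r =>
    have key2 : ∀ n : ℕ, ((finRotate (r + 1))^[n] i : ℕ) = (i + n) % (r + 1) := by
      intro n
      induction n with
      | zero => simp [Nat.mod_eq_of_lt i.2]
      | succ n ih =>
        rw [Function.iterate_succ_apply', finRotate_apply, Fin.val_add, ih, Fin.val_one',
          ← Nat.add_mod, add_assoc]
    apply Fin.ext
    rw [key2, Nat.add_mod_right, Nat.mod_eq_of_lt i.2]

/-- The `σ^l δ`-structure on the summand `R_i`. -/
def IsSigmaDecomposition.summandSD {S : Type*} [CommRing S] {s : SDStruct S} {l : ℕ}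
    {e : Fin l → S} (h : IsSigmaDecomposition s e) (i : Fin l) :
    SDStruct (h.complete.idem i).Corner :=
  (s.pow l).corner (h.complete.idem i) (h.pow_apply i)

section Setup

variable {k L : Type*} [Field k] [Field L] [Algebra k L] {m : ℕ}

/-- The `σδ`-field `L` is the extension `k⟨X⟩` of the `σδ`-field `k` that is generated, as a
differential field, by an `m × m` matrix `X` of differential indeterminates over `k`, with
`σ X = A X`. -/
structure IsGenericSolutionField (sk : SDStruct k) (sL : SDStruct L) (A : GL (Fin m) k)
    (X : Matrix (Fin m) (Fin m) L) : Prop where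
  isSDHom : IsSDHom sk sL (algebraMap k L)
  sigma_X : X.map sL.sigma = (A : Matrix (Fin m) (Fin m) k).map (algebraMap k L) * X
  indeterminates : AlgebraicIndependent k
    (fun p : ℕ × Fin m × Fin m => sL.delta^[p.1] (X p.2.1 p.2.2))
  generates : IntermediateField.adjoin k
    (Set.range fun p : ℕ × Fin m × Fin m => sL.delta^[p.1] (X p.2.1 p.2.2)) = ⊤

variable (k) in
/-- The compositum `k C_L` inside `L`. -/
def constCompositum (sL : SDStruct L) : Subfield L :=
  (algebraMap k L).fieldRange ⊔ sL.const

variable (k) in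
/-- The ring `R = k C_L {X, (det X)⁻¹}`, as a `C_L`-subalgebra of `L`. -/
def pvRing (sL : SDStruct L) (X : Matrix (Fin m) (Fin m) L) : Subalgebra sL.const L :=
  { sL.deltaAdjoin ((constCompositum k sL : Set L) ∪
      (Set.range fun p : Fin m × Fin m => X p.1 p.2) ∪ {X.det⁻¹}) with
    algebraMap_mem' := fun c => sL.subset_deltaAdjoin _
      (Or.inl (Or.inl ((le_sup_right : sL.const ≤ constCompositum k sL) c.2))) }

variable (k) in
/-- The ring `R ⊗ C`, the tensor product being over `C_L`. -/
def PvTensor (sL : SDStruct L) (X : Matrix (Fin m) (Fin m) L) (C : Type*) [Field C]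
    [Algebra sL.const C] : Type _ :=
  pvRing k sL X ⊗[sL.const] C

instance (sL : SDStruct L) (X : Matrix (Fin m) (Fin m) L) (C : Type*) [Field C]
    [Algebra sL.const C] : CommRing (PvTensor k sL X C) :=
  inferInstanceAs (CommRing (pvRing k sL X ⊗[sL.const] C))

namespace IsGenericSolutionField

variable {sk : SDStruct k} {sL : SDStruct L} {A : GL (Fin m) k} {X : Matrix (Fin m) (Fin m) L}

theorem map_constCompositum {f : L →+* L} {g : k → k}
    (hf : ∀ x, f (algebraMap k L x) = algebraMap k L (g x))
    (hc : ∀ x ∈ sL.const, f x = x) :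
    ∀ x ∈ constCompositum k sL, f x ∈ constCompositum k sL := by
  have : constCompositum k sL ≤ (constCompositum k sL).comap f := by
    refine sup_le ?_ ?_
    · rintro _ ⟨x, rfl⟩
      rw [Subfield.mem_comap, hf]
      exact (le_sup_left : (algebraMap k L).fieldRange ≤ constCompositum k sL) ⟨_, rfl⟩
    · intro x hx
      rw [Subfield.mem_comap]
      rw [hc x hx]
      exact (le_sup_right : sL.const ≤ constCompositum k sL) hx
  exact this

theorem map_pvRing {f : L →+* L} {g : k → k}
    (hf : ∀ x, f (algebraMap k L x) = algebraMap k L (g x))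
    (hc : ∀ x ∈ sL.const, f x = x) (hd : ∀ x, f (sL.delta x) = sL.delta (f x))
    (B : Matrix (Fin m) (Fin m) k)
    (hX : X.map f = B.map (algebraMap k L) * X) :
    ∀ x ∈ pvRing k sL X, f x ∈ pvRing k sL X := by
  have hk : ∀ a : k, algebraMap k L a ∈ constCompositum k sL := fun a =>
    (le_sup_left : (algebraMap k L).fieldRange ≤ constCompositum k sL) ⟨_, rfl⟩
  refine sL.map_mem_deltaAdjoin _ f hd ?_
  rintro x ((hx | ⟨⟨i, j⟩, rfl⟩) | rfl)
  · exact sL.subset_deltaAdjoin _ (Or.inl (Or.inl (map_constCompositum hf hc x hx)))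
  · have h := congrFun (congrFun hX i) j
    simp only [Matrix.map_apply, Matrix.mul_apply] at h
    rw [h]
    refine Subring.sum_mem _ fun c _ => Subring.mul_mem _ ?_ ?_
    · exact sL.subset_deltaAdjoin _ (Or.inl (Or.inl (hk _)))
    · exact sL.subset_deltaAdjoin _ (Or.inl (Or.inr ⟨(c, j), rfl⟩))
  · have h : f X.det = algebraMap k L B.det * X.det := by
      have := congrArg Matrix.det hX
      rw [Matrix.det_mul] at this
      rw [RingHom.map_det, RingHom.map_det]
      exact this
    rw [map_inv₀, h, mul_inv]
    refine Subring.mul_mem _ ?_ ?_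
    · exact sL.subset_deltaAdjoin _
        (Or.inl (Or.inl ((constCompositum k sL).inv_mem (hk _))))
    · exact sL.subset_deltaAdjoin _ (Or.inr rfl)

/-- The `σδ`-structure of `R`. -/
def pvRingSD (h : IsGenericSolutionField sk sL A X) : SDStruct (pvRing k sL X) :=
  sL.restrict (pvRing k sL X)
    (map_pvRing (f := (sL.sigma : L →+* L)) (g := sk.sigma) (fun x => (h.isSDHom.sigma x).symm)
      (fun _ hx => hx) sL.comm A h.sigma_X)
    (map_pvRing (f := (sL.sigma.symm : L →+* L)) (g := sk.sigma.symm)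
      (fun x => by
        change sL.sigma.symm _ = _
        rw [RingEquiv.symm_apply_eq, ← h.isSDHom.sigma, RingEquiv.apply_symm_apply])
      (fun x hx => by
        change sL.sigma.symm x = x
        rw [RingEquiv.symm_apply_eq]; exact hx.symm)
      sL.symm_comm
      (((A⁻¹ : GL (Fin m) k) : Matrix (Fin m) (Fin m) k).map sk.sigma.symm)
      (by
        have hA : ((A⁻¹ : GL (Fin m) k) : Matrix (Fin m) (Fin m) k) * A = 1 := by
          rw [← Matrix.GeneralLinearGroup.coe_mul, inv_mul_cancel]; rfl
        have h1 : ((A⁻¹ : GL (Fin m) k) : Matrix (Fin m) (Fin m) k).map (algebraMap k L) *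
            X.map sL.sigma = X := by
          rw [h.sigma_X, ← mul_assoc, ← Matrix.map_mul, hA]
          simp
        have h2 := congrArg (fun M => M.map (sL.sigma.symm : L →+* L)) h1
        simp only [Matrix.map_mul] at h2
        rw [← h2]
        congr 1
        · ext i j
          simp only [Matrix.map_apply]
          change sL.sigma.symm _ = algebraMap k L (sk.sigma.symm _)
          rw [RingEquiv.symm_apply_eq, ← h.isSDHom.sigma, RingEquiv.apply_symm_apply]
        · ext i j
          simp))
    (sL.delta_mem_deltaAdjoin _)

theorem pvRingSD_isSDHom (h : IsGenericSolutionField sk sL A X) :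
    IsSDHom sL.constSD h.pvRingSD (algebraMap sL.const (pvRing k sL X)) :=
  ⟨fun _ => rfl, fun _ => rfl⟩

variable {C : Type*} [Field C] [Algebra sL.const C]

/-- The `σδ`-ring `R ⊗ C` over `C_L`, where `σ` is trivial on `C`. -/
def pvTensorSD (h : IsGenericSolutionField sk sL A X) {dC : Derivation ℤ C C}
    (hC : IsSDHom sL.constSD (SDStruct.ofDerivation dC) (algebraMap sL.const C)) :
    SDStruct (PvTensor k sL X C) :=
  SDStruct.tensor sL.constSD h.pvRingSD (SDStruct.ofDerivation dC) h.pvRingSD_isSDHom hC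

end IsGenericSolutionField

variable (k) in
/-- The structure map `k → R`. -/
def toPvRing (sL : SDStruct L) (X : Matrix (Fin m) (Fin m) L) : k →+* pvRing k sL X :=
  (algebraMap k L).codRestrict (pvRing k sL X) fun a =>
    sL.subset_deltaAdjoin _ (Or.inl (Or.inl
      ((le_sup_left : (algebraMap k L).fieldRange ≤ constCompositum k sL) ⟨a, rfl⟩)))

variable (k) in
/-- The structure map `k → R ⊗ C`. -/
def toPvTensor (sL : SDStruct L) (X : Matrix (Fin m) (Fin m) L) (C : Type*) [Field C]
    [Algebra sL.const C] : k →+* PvTensor k sL X C :=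
  (Algebra.TensorProduct.includeLeftRingHom :
    pvRing k sL X →+* pvRing k sL X ⊗[sL.const] C).comp (toPvRing k sL X)

variable (k) in
/-- The compositum `k C` of `k C_L` and `C` in `R ⊗ C`: the subring generated by `k C_L ⊗ 1` and
`1 ⊗ C`. (It is a field, so it is the field generated by `k` and `C`.) -/
def compositum (sL : SDStruct L) (X : Matrix (Fin m) (Fin m) L) (C : Type*) [Field C]
    [Algebra sL.const C] : Subring (PvTensor k sL X C) :=
  Subring.closure
    ({z | ∃ x : pvRing k sL X, (x : L) ∈ constCompositum k sL ∧ z = x ⊗ₜ[sL.const] (1 : C)} ∪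
      Set.range fun c : C => (1 : pvRing k sL X) ⊗ₜ[sL.const] c)

variable (k) in
/-- The natural map `R ⊗ C → L ⊗ C` over `C_L`. -/
def pvTensorToField (sL : SDStruct L) (X : Matrix (Fin m) (Fin m) L) (C : Type*) [Field C]
    [Algebra sL.const C] : PvTensor k sL X C →+* L ⊗[sL.const] C :=
  (Algebra.TensorProduct.map (pvRing k sL X).val (AlgHom.id sL.const C)).toRingHom

end Setup

end

/-! The core of the argument is that R ⊗ C has no ideals except 0 and itself that are stable under σ
alone. Put F = kC. Differentiating a system σM = BM yields a system with fundamental matrix (M, δM;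
0, M), so R ⊗ C is an increasing union of rings F[M, (det M)⁻¹] with M a fundamental matrix of a
system over F. For one such M and a proper σ-stable ideal, let P be the ideal of polynomial
relations satisfied by M and (det M)⁻¹, and J ⊇ P the ideal of polynomials whose value lies in the
given ideal. The substitution Y = MY' turns J into a proper ideal of L ⊗ C[Y'], and σ fixes the new
variables. As C_L is the fixed field of L, a σ-stable ideal of L ⊗ C[Y'] comes from C[Y'], so by the
Nullstellensatz it has a zero Z with coordinates in C. Then Y ↦ YZ is a surjective endomorphism of a
noetherian polynomial ring that maps J into P, and this forces J = P
(`aeval_eq_zero_of_sigma_stable`, `eq_bot_or_eq_top_of_sigma_stable`).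

That kC is a field and that l is finite are statements about algebraic elements. An element
algebraic over C_L is fixed by some σⁿ. Since C_k = D_k, the elements of k fixed by σⁿ are those of
C_k, and a linear independence argument shows that C_L is algebraically closed in kC_L
(`mem_const_of_mem_constCompositum`). Hence kC_L ⊗ C is a field, with image kC. Moreover δⁿX = XW,
where σW - W involves only lower derivatives of X; in characteristic 0 the adjunction of such W
creates no algebraic elements. So D_L lies in kC_L(X), which is finitely generated over kC_L, and
there the degrees of algebraic elements are bounded.

For the decomposition, D_L is cyclic over C_L with group generated by σ. An ideal of denominators
and σ-simplicity show that D_L ⊗ 1 lies in R ⊗ C. The ring L ⊗ C over D_L is a field, and the l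
composites of R ⊗ C → L ⊗ C (over D_L) with powers of σ have coprime kernels with intersection 0;
the Chinese remainder theorem splits R ⊗ C. For an arbitrary decomposition, this map kills all
summands but one, a power of σ carries R_i to that summand, and σ^l-simplicity of R_i makes the
resulting map injective. -/

noncomputable section

/-! ### Algebraically closed subfields, tensor products and degrees -/

open Polynomial in
/-- If `K` is algebraically closed in `E`, then a minimal polynomial over `K` does not factor
over `E`. -/
theorem minpoly_eq_map_of_forall_isIntegral {K E M : Type*} [Field K] [Field E] [Field M]
    [Algebra K E] [Algebra K M] [Algebra E M] [IsScalarTower K E M]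
    (hE : ∀ x : E, IsIntegral K x → x ∈ (algebraMap K E).range) {g : M} (hg : IsIntegral K g) :
    minpoly E g = (minpoly K g).map (algebraMap K E) := by
  have hgE : IsIntegral E g := hg.tower_top
  -- A monic factor of a monic polynomial over K has coefficients integral over K; as K is
  -- algebraically closed in E, they lie in K.
  obtain ⟨q, hq⟩ := integralClosure.mem_lifts_of_monic_of_dvd_map E (minpoly.monic hg)
    (minpoly.monic hgE) (minpoly.dvd_map_of_isScalarTower K E g)
  have hlift : minpoly E g ∈ lifts (algebraMap K E) := by
    rw [lifts_iff_coeff_lifts]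
    intro n
    have : (minpoly E g).coeff n = ((q.coeff n : integralClosure K E) : E) := by
      rw [← hq]
      change (Polynomial.map (algebraMap (integralClosure K E) E) q).coeff n = _
      rw [coeff_map]
      rfl
    rw [this]
    exact hE _ (q.coeff n).2
  obtain ⟨p, hp, -, hpm⟩ := lifts_and_natDegree_eq_and_monic hlift (minpoly.monic hgE)
  have hpg : aeval g p = 0 := by
    have := minpoly.aeval E g
    rwa [← hp, aeval_map_algebraMap] at this
  have h1 : minpoly K g = p := by
    refine eq_of_monic_of_associated (minpoly.monic hg) hpm
      (associated_of_dvd_dvd (minpoly.dvd K g hpg) ?_)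
    have := minpoly.dvd_map_of_isScalarTower K E g
    rw [← hp] at this
    exact (Polynomial.map_dvd_map' (algebraMap K E)).1 this
  rw [h1, hp]

open Polynomial IntermediateField in
/-- If `K` is algebraically closed in `E` and `M/K` is algebraic and separable, then `E ⊗ M` is
a field. -/
theorem isField_tensorProduct_of_forall_isIntegral {K E M : Type*} [Field K] [Field E] [Field M]
    [Algebra K E] [Algebra K M] [Algebra.IsSeparable K M]
    (hE : ∀ x : E, IsIntegral K x → x ∈ (algebraMap K E).range) : IsField (E ⊗[K] M) := by
  -- E ⊗ K(α) is a quotient of E[T]/(p), where p is the minimal polynomial of α over K. This p stays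
  -- irreducible over E, so non-zero elements are invertible.
  have simple : ∀ α : M, ∀ x ∈ (Algebra.TensorProduct.map (AlgHom.id K E)
      (IntermediateField.val K⟮α⟯)).range, x ≠ 0 → ∃ y, x * y = 1 := by
    rintro α _ ⟨x, rfl⟩ hx
    have hα : IsIntegral K α := Algebra.IsIntegral.isIntegral α
    set p := (minpoly K α).map (algebraMap K E) with hp
    have hirr : Irreducible p := by
      -- Comparing minimal polynomials over K and E requires a common overfield of E and K(α).
      let Ω := AlgebraicClosure E
      let j : K⟮α⟯ →ₐ[K] Ω := IsAlgClosed.lift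
      let β : Ω := j (IntermediateField.AdjoinSimple.gen K α)
      have hmin : minpoly K β = minpoly K α := by
        rw [minpoly.algHom_eq j j.injective, IntermediateField.minpoly_gen]
      have hβ : IsIntegral K β := by
        rw [← minpoly.ne_zero_iff, hmin]
        exact minpoly.ne_zero hα
      rw [hp, ← hmin, ← minpoly_eq_map_of_forall_isIntegral hE hβ]
      exact minpoly.irreducible hβ.tower_top
    let a : E ⊗[K] K⟮α⟯ := 1 ⊗ₜ IntermediateField.AdjoinSimple.gen K α
    have ha : aeval a p = 0 := by
      rw [hp, aeval_map_algebraMap]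
      have : a = Algebra.TensorProduct.includeRight (R := K) (A := E)
        (IntermediateField.AdjoinSimple.gen K α) := rfl
      rw [this, aeval_algHom_apply, IntermediateField.aeval_gen_minpoly, map_zero]
    let f : AdjoinRoot p →+* E ⊗[K] K⟮α⟯ :=
      AdjoinRoot.lift (algebraMap E (E ⊗[K] K⟮α⟯)) a (by rw [← ha]; rfl)
    have hf : ∀ y, y ∈ f.range := by
      intro y
      induction y with
      | zero => exact zero_mem _
      | add x y hx hy => exact add_mem hx hy
      | tmul e m =>
        have h1 : e ⊗ₜ[K] m = (e ⊗ₜ[K] (1 : K⟮α⟯)) * ((1 : E) ⊗ₜ[K] m) := by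
          rw [Algebra.TensorProduct.tmul_mul_tmul, mul_one, one_mul]
        rw [h1]
        refine mul_mem ⟨AdjoinRoot.of p e, AdjoinRoot.lift_of _⟩ ?_
        obtain ⟨q, rfl⟩ : ∃ q : K[X], aeval (IntermediateField.AdjoinSimple.gen K α) q = m := by
          have := (IntermediateField.adjoin.powerBasis hα).exists_eq_aeval' m
          obtain ⟨q, hq⟩ := this
          exact ⟨q, by rw [hq]; rfl⟩
        have h2 : (1 : E) ⊗ₜ[K] aeval (IntermediateField.AdjoinSimple.gen K α) q =
            aeval a (q.map (algebraMap K E)) := by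
          rw [aeval_map_algebraMap]
          exact (aeval_algHom_apply (Algebra.TensorProduct.includeRight (R := K) (A := E))
            (IntermediateField.AdjoinSimple.gen K α) q).symm
        rw [h2]
        exact ⟨AdjoinRoot.mk p (q.map (algebraMap K E)), AdjoinRoot.lift_mk _ _⟩
    obtain ⟨z, rfl⟩ := hf x
    have hz : z ≠ 0 := by
      rintro rfl
      exact hx (by simp)
    obtain ⟨z', hz'⟩ : ∃ z', z * z' = 1 := by
      have : Fact (Irreducible p) := ⟨hirr⟩
      exact ⟨z⁻¹, mul_inv_cancel₀ hz⟩
    refine ⟨Algebra.TensorProduct.map (AlgHom.id K E) (IntermediateField.val K⟮α⟯) (f z'), ?_⟩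
    change Algebra.TensorProduct.map (AlgHom.id K E) (IntermediateField.val K⟮α⟯) (f z) * _ = _
    rw [← map_mul, ← map_mul, hz', map_one, map_one]
  -- A tensor involves finitely many elements of M; by separability they lie in one simple
  -- extension.
  have dir : ∀ x : E ⊗[K] M, ∃ α : M, x ∈ (Algebra.TensorProduct.map (AlgHom.id K E)
      (IntermediateField.val K⟮α⟯)).range := by
    have mono : ∀ α β : M, K⟮α⟯ ≤ K⟮β⟯ → (Algebra.TensorProduct.map (AlgHom.id K E)
      (IntermediateField.val K⟮α⟯)).range ≤ (Algebra.TensorProduct.map (AlgHom.id K E)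
      (IntermediateField.val K⟮β⟯)).range := by
      rintro α β h _ ⟨x, rfl⟩
      refine ⟨Algebra.TensorProduct.map (AlgHom.id K E) (IntermediateField.inclusion h) x, ?_⟩
      induction x with
      | zero => simp
      | add x y hx hy =>
        simp only [map_add] at hx hy ⊢
        rw [hx, hy]
      | tmul a b => rfl
    intro x
    induction x with
    | zero => exact ⟨0, zero_mem _⟩
    | tmul e m =>
      exact ⟨m, e ⊗ₜ IntermediateField.AdjoinSimple.gen K m, rfl⟩
    | add x y hx hy =>
      obtain ⟨α, hα⟩ := hx
      obtain ⟨β, hβ⟩ := hy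
      have : FiniteDimensional K K⟮α⟯ :=
        IntermediateField.adjoin.finiteDimensional (Algebra.IsIntegral.isIntegral α)
      have : FiniteDimensional K K⟮β⟯ :=
        IntermediateField.adjoin.finiteDimensional (Algebra.IsIntegral.isIntegral β)
      obtain ⟨γ, hγ⟩ := Field.exists_primitive_element K (K⟮α⟯ ⊔ K⟮β⟯ : IntermediateField K M)
      have hγ' : K⟮(γ : M)⟯ = K⟮α⟯ ⊔ K⟮β⟯ := by
        have := congrArg (IntermediateField.map (IntermediateField.val _)) hγ
        rw [IntermediateField.adjoin_map] at this
        simpa [← AlgHom.fieldRange_eq_map] using this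
      refine ⟨γ, add_mem (mono α γ ?_ hα) (mono β γ ?_ hβ)⟩
      · rw [hγ']; exact le_sup_left
      · rw [hγ']; exact le_sup_right
  have : Nontrivial (E ⊗[K] M) := inferInstance
  refine ⟨⟨0, 1, zero_ne_one⟩, mul_comm, fun {x} hx => ?_⟩
  obtain ⟨α, hα⟩ := dir x
  exact simple α x hα hx

open IntermediateField in
/-- A field is algebraically closed in a simple transcendental extension. -/
theorem mem_range_of_isIntegral_of_mem_adjoin_transcendental {K E : Type*} [Field K] [Field E]
    [Algebra K E] {x : E} (hx : Transcendental K x) {y : E} (hy : y ∈ K⟮x⟯)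
    (hyK : IsIntegral K y) : y ∈ (algebraMap K E).range := by
  let e := RatFunc.algEquivOfTranscendental x hx
  by_contra hne
  have h1 : Transcendental K (e.symm ⟨y, hy⟩) := by
    refine RatFunc.transcendental_of_ne_C _ ?_
    rintro ⟨c, hc⟩
    refine hne ⟨c, ?_⟩
    have h2 := congrArg e hc
    rw [AlgEquiv.apply_symm_apply, ← RatFunc.algebraMap_eq_C, AlgEquiv.commutes] at h2
    exact (congrArg Subtype.val h2).symm
  refine h1 ?_
  have h3 : IsAlgebraic K (⟨y, hy⟩ : K⟮x⟯) := by
    rw [← isAlgebraic_algebraMap_iff (A := E) (algebraMap K⟮x⟯ E).injective]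
    exact hyK.isAlgebraic
  exact h3.algHom e.symm.toAlgHom

open IntermediateField in
/-- In a finitely generated field extension, the degrees of the algebraic elements are
bounded. -/
theorem exists_natDegree_minpoly_le_of_mem_adjoin.{u} {E : Type u} [Field E] (s : Finset E) :
    ∀ (K : Type u) [Field K] [Algebra K E], ∃ n, ∀ g ∈ adjoin K (s : Set E), IsIntegral K g →
      (minpoly K g).natDegree ≤ n := by
  classical
  -- K stays universally quantified, since the induction step replaces it by K(x). That field is a
  -- subtype of E, which is why K and E share a universe.
  induction s using Finset.induction with
  | empty =>
    intro K _ _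
    refine ⟨1, fun g hg _ => ?_⟩
    rw [Finset.coe_empty, adjoin_empty, mem_bot] at hg
    obtain ⟨a, rfl⟩ := hg
    rw [minpoly.eq_X_sub_C]
    simp
  | insert x s _ ih =>
    intro K _ _
    obtain ⟨n, hn⟩ := ih K⟮x⟯
    have hle : ∀ g ∈ adjoin K ((insert x s : Finset E) : Set E),
        g ∈ adjoin K⟮x⟯ (s : Set E) := by
      have : adjoin K ((insert x s : Finset E) : Set E) ≤
          (adjoin K⟮x⟯ (s : Set E)).restrictScalars K := by
        rw [adjoin_le_iff]
        intro y hy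
        rw [Finset.coe_insert] at hy
        rw [coe_restrictScalars]
        rcases hy with hy | hy
        · rw [hy]
          have := (adjoin K⟮x⟯ (s : Set E)).algebraMap_mem (AdjoinSimple.gen K x)
          rwa [AdjoinSimple.algebraMap_gen] at this
        · exact subset_adjoin _ _ hy
      exact this
    -- An algebraic generator multiplies the bound by at most [K(x) : K]. A transcendental one
    -- leaves K algebraically closed in K(x), so minimal polynomials over K and K(x) have the same
    -- degree.
    by_cases hx : IsIntegral K x
    · refine ⟨Module.finrank K K⟮x⟯ * n, fun g hg hgK => ?_⟩
      have hg' : IsIntegral K⟮x⟯ g := hgK.tower_top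
      have := adjoin.finiteDimensional hx
      have := adjoin.finiteDimensional hg'
      have h1 := hn g (hle g hg) hg'
      rw [← adjoin.finrank hg'] at h1
      have : FiniteDimensional K K⟮x⟯⟮g⟯ := FiniteDimensional.trans K K⟮x⟯ _
      have h2 : Module.finrank K K⟮g⟯ ≤ Module.finrank K (K⟮x⟯⟮g⟯.restrictScalars K) := by
        have : FiniteDimensional K (K⟮x⟯⟮g⟯.restrictScalars K) :=
          inferInstanceAs (FiniteDimensional K K⟮x⟯⟮g⟯)
        refine finrank_le_of_le_right ?_
        rw [adjoin_simple_le_iff]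
        exact mem_adjoin_simple_self K⟮x⟯ g
      rw [← adjoin.finrank hgK]
      refine h2.trans ?_
      change Module.finrank K K⟮x⟯⟮g⟯ ≤ _
      have : Module.Free K⟮x⟯ K⟮x⟯⟮g⟯ := Module.Free.of_divisionRing _ _
      rw [← Module.finrank_mul_finrank K K⟮x⟯ K⟮x⟯⟮g⟯]
      exact Nat.mul_le_mul_left _ h1
    · refine ⟨n, fun g hg hgK => ?_⟩
      have h1 := hn g (hle g hg) hgK.tower_top
      rw [minpoly_eq_map_of_forall_isIntegral (K := K) ?_ hgK, Polynomial.natDegree_map] at h1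
      · exact h1
      intro y hy
      obtain ⟨a, ha⟩ := mem_range_of_isIntegral_of_mem_adjoin_transcendental
        (fun h => hx h.isIntegral) y.2 (hy.map (IsScalarTower.toAlgHom K K⟮x⟯ E))
      exact ⟨a, Subtype.ext ha⟩

/-! ### Algebraic elements and equations σ w - w = b -/

open Polynomial in
/-- An algebraic solution `w` of `σ w - w = b` over `K` lies in `K`. -/
theorem mem_of_isIntegral_of_sub_mem {L : Type*} [Field L] [CharZero L] (σ : L →+* L)
    (K : Subfield L) (hσ : ∀ x ∈ K, σ x ∈ K) (hfix : ∀ x, σ x = x → x ∈ K) {w : L}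
    (hw : σ w - w ∈ K) (hint : IsIntegral K w) : w ∈ K := by
  let τ : K →+* K := (σ.comp K.subtype).codRestrict K fun x => hσ x x.2
  let b : K := ⟨σ w - w, hw⟩
  set p := minpoly K w with hp
  set n := p.natDegree with hn
  have hn0 : 0 < n := minpoly.natDegree_pos hint
  have hpm : p.Monic := minpoly.monic hint
  -- With b = σ w - w, the polynomial q(T) = p^σ(T + b) satisfies q(w) = p^σ(σ w) = σ(p(w)) = 0. It
  -- is monic of the same degree as p, hence equal to p.
  let q := taylor b (p.map τ)
  have hqm : q.Monic := by
    rw [Monic, show q = taylor b (p.map τ) from rfl, taylor_apply,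
      leadingCoeff_comp (by rw [natDegree_X_add_C]; exact one_ne_zero)]
    simp [(hpm.map τ).leadingCoeff]
  have hqn : q.natDegree = n := by
    rw [show q = taylor b (p.map τ) from rfl, natDegree_taylor, natDegree_map]
  have hq0 : aeval w q = 0 := by
    have h1 : σ (aeval w p) = 0 := by rw [minpoly.aeval, map_zero]
    rw [aeval_def, hom_eval₂] at h1
    rw [show q = taylor b (p.map τ) from rfl, taylor_apply, aeval_comp]
    have h2 : aeval w (X + C b) = σ w := by
      rw [map_add, aeval_X, aeval_C]
      exact add_sub_cancel w (σ w)
    rw [h2, aeval_def, eval₂_map]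
    exact h1
  have hpq : q = p := by
    refine (eq_of_monic_of_dvd_of_natDegree_le hpm hqm (minpoly.dvd K w hq0) ?_)
    rw [hqn]
  -- If c is the coefficient of T^(n-1) in p, comparison in p = q gives c = σ c + n b. So w + c/n is
  -- fixed by σ, where characteristic 0 allows division by n.
  have hcoef : p.coeff (n - 1) = τ (p.coeff (n - 1)) + n * b := by
    conv_lhs => rw [← hpq]
    rw [show q = taylor b (p.map τ) from rfl, taylor_coeff]
    have hdeg : (hasseDeriv (n - 1) (p.map τ)).natDegree < 2 := by
      refine lt_of_le_of_lt (natDegree_hasseDeriv_le _ _) ?_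
      rw [natDegree_map]
      omega
    rw [eval_eq_sum_range' hdeg, Finset.sum_range_succ, Finset.sum_range_one, hasseDeriv_coeff,
      hasseDeriv_coeff, coeff_map, coeff_map]
    have h1 : 1 + (n - 1) = n := by omega
    rw [h1, zero_add, Nat.choose_self]
    have h2 : p.coeff n = 1 := hpm.coeff_natDegree
    rw [h2]
    have h3 : n.choose (n - 1) = n := by
      rw [Nat.choose_symm (by omega : 1 ≤ n), Nat.choose_one_right]
    rw [h3]
    simp
  have hnK : (n : L) ≠ 0 := Nat.cast_ne_zero.2 hn0.ne'
  have hcoef' : ((p.coeff (n - 1) : K) : L) = σ (p.coeff (n - 1) : K) + n * (σ w - w) := by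
    have := congrArg K.subtype hcoef
    rw [map_add, map_mul, map_natCast] at this
    exact this
  have hmem : w + (p.coeff (n - 1) : K) / n ∈ K := by
    refine hfix _ ?_
    rw [map_add, map_div₀, map_natCast, eq_sub_of_add_eq hcoef'.symm]
    field_simp
    ring
  have := sub_mem hmem (div_mem (p.coeff (n - 1)).2 (natCast_mem K n))
  simpa using this

/-- If the `σ`-field `L` is obtained from `K₀`, which contains the constants, by adjoining
solutions of equations `σ w - w = b`, then `K₀` is algebraically closed in `L`. -/
theorem mem_of_isIntegral_of_forall_sub_mem {L : Type*} [Field L] [CharZero L] (σ : L →+* L)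
    (K₀ : Subfield L) (hσ : ∀ x ∈ K₀, σ x ∈ K₀) (hfix : ∀ x, σ x = x → x ∈ K₀)
    (hgen : ∀ K : Subfield L, K₀ ≤ K → (∀ w, σ w - w ∈ K → w ∈ K) → K = ⊤)
    {y : L} (hy : IsIntegral K₀ y) : y ∈ K₀ := by
  -- Zorn's lemma gives a maximal σ-stable K containing no new elements algebraic over K₀. If σ w -
  -- w is in K, then either w is algebraic over K and lies in K, or K is algebraically closed in the
  -- σ-stable field K(w), and maximality again puts w in K. So K = L.
  let 𝒢 : Set (Subfield L) := {K | K₀ ≤ K ∧ (∀ x ∈ K, σ x ∈ K) ∧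
    ∀ z ∈ K, IsIntegral K₀ z → z ∈ K₀}
  have h₀ : K₀ ∈ 𝒢 := ⟨le_rfl, hσ, fun z hz _ => hz⟩
  obtain ⟨K, hK₀, hmax⟩ := zorn_le_nonempty₀ 𝒢 (fun c hc hchain x hx => by
    have hdir := hchain.directedOn
    have hne : c.Nonempty := ⟨x, hx⟩
    refine ⟨sSup c, ⟨(hc hx).1.trans (le_sSup hx), ?_, ?_⟩, fun z hz => le_sSup hz⟩
    · intro z hz
      rw [Subfield.mem_sSup_of_directedOn hne hdir] at hz ⊢
      obtain ⟨s, hs, hzs⟩ := hz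
      exact ⟨s, hs, (hc hs).2.1 z hzs⟩
    · intro z hz
      rw [Subfield.mem_sSup_of_directedOn hne hdir] at hz
      obtain ⟨s, hs, hzs⟩ := hz
      exact (hc hs).2.2 z hzs) K₀ h₀
  have hKG : K ∈ 𝒢 := hmax.prop
  have htop : K = ⊤ := by
    refine hgen K hKG.1 fun w hw => ?_
    by_cases hint : IsIntegral K w
    · exact mem_of_isIntegral_of_sub_mem σ K hKG.2.1 (fun x hx => hKG.1 (hfix x hx)) hw hint
    · have hle : K ≤ (IntermediateField.adjoin K {w}).toSubfield := fun x hx =>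
        (IntermediateField.adjoin K {w}).algebraMap_mem ⟨x, hx⟩
      have hwm : w ∈ (IntermediateField.adjoin K {w}).toSubfield :=
        IntermediateField.mem_adjoin_simple_self K w
      refine hmax.le_of_ge (y := (IntermediateField.adjoin K {w}).toSubfield) ?_ hle hwm
      refine ⟨hKG.1.trans hle, ?_, ?_⟩
      · have h1 : (IntermediateField.adjoin K {w}).toSubfield ≤
            (IntermediateField.adjoin K {w}).toSubfield.comap σ := by
          rw [IntermediateField.adjoin_toSubfield, Subfield.closure_le]
          rintro x (⟨a, rfl⟩ | hx)
          · exact hle (hKG.2.1 a a.2)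
          · rw [Set.mem_singleton_iff] at hx
            subst hx
            have := add_mem (hle hw) hwm
            rwa [sub_add_cancel] at this
        exact h1
      · intro z hz hzint
        let : Algebra K₀ K := (Subfield.inclusion hKG.1).toAlgebra
        have : IsScalarTower K₀ K L := IsScalarTower.of_algebraMap_eq fun _ => rfl
        obtain ⟨a, rfl⟩ := mem_range_of_isIntegral_of_mem_adjoin_transcendental
          (fun h => hint h.isIntegral) hz hzint.tower_top
        exact hKG.2.2 a a.2 hzint
  exact hKG.2.2 y (htop ▸ Subfield.mem_top y) hy

/-! ### Descent of relations and σ-stable ideals to the fixed field -/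

/-- Elements fixed by `τ` that are linearly independent over the subfield of `k` fixed by `τ`
are linearly independent over `k`. -/
theorem linearIndependent_of_fixed {K k L ι : Type*} [Field K] [Field k] [Field L] [Algebra K k]
    [Algebra k L] [Algebra K L] [IsScalarTower K k L] (τ : L →+* L) (g : k → k)
    (hg : ∀ a, τ (algebraMap k L a) = algebraMap k L (g a))
    (hfix : ∀ a, g a = a → a ∈ (algebraMap K k).range) {v : ι → L} (hv : ∀ i, τ (v i) = v i)
    (hK : LinearIndependent K v) : LinearIndependent k v := by
  classical
  rw [linearIndependent_iff'] at hK ⊢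
  intro s
  induction s using Finset.induction with
  | empty => simp
  | insert j s hj ih =>
    intro c hc
    -- After division by c j, subtracting the image of the relation under τ removes the term of v j.
    -- By induction the remaining coefficients are fixed by g, so the relation is one over K.
    have hcj : c j = 0 := by
      by_contra hne
      have h1 : ∑ i ∈ insert j s, (c i / c j) • v i = 0 := by
        have := congrArg (fun z => (c j)⁻¹ • z) hc
        simp only [Finset.smul_sum, smul_smul, smul_zero] at this
        rw [← this]
        exact Finset.sum_congr rfl fun i _ => by rw [div_eq_inv_mul]
      have h2 : ∑ i ∈ insert j s, (g (c i / c j)) • v i = 0 := by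
        have := congrArg τ h1
        simpa only [map_sum, Algebra.smul_def, map_mul, hg, hv, map_zero] using this
      have hg1 : g 1 = 1 := by
        apply (algebraMap k L).injective
        rw [← hg, map_one, map_one]
      have h3 : ∑ i ∈ s, (g (c i / c j) - c i / c j) • v i = 0 := by
        rw [Finset.sum_insert hj, div_self hne] at h1 h2
        rw [hg1] at h2
        simp only [sub_smul, Finset.sum_sub_distrib]
        rw [← add_sub_add_left_eq_sub _ _ ((1 : k) • v j), h1, h2, sub_zero]
      have h4 : ∀ i ∈ insert j s, c i / c j ∈ (algebraMap K k).range := by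
        intro i hi
        rw [Finset.mem_insert] at hi
        rcases hi with rfl | hi
        · rw [div_self hne]
          exact one_mem _
        · exact hfix _ (sub_eq_zero.1 (ih _ h3 i hi))
      choose! d hd using h4
      have h5 : ∑ i ∈ insert j s, d i • v i = 0 := by
        rw [← h1]
        refine Finset.sum_congr rfl fun i hi => ?_
        rw [← hd i hi, algebraMap_smul]
      have h6 := hK _ d h5 j (Finset.mem_insert_self j s)
      have h7 := hd j (Finset.mem_insert_self j s)
      rw [h6, map_zero, div_self hne] at h7
      exact zero_ne_one h7
    intro i hi
    rw [Finset.mem_insert] at hi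
    rcases hi with rfl | hi
    · exact hcj
    · rw [Finset.sum_insert hj, hcj, zero_smul, zero_add] at hc
      exact ih c hc i hi

/-- Let `K` be the fixed field of `σ` on the field `L`. A non-zero ideal of `L ⊗ E` stable under
`σ ⊗ 1` meets `E` non-trivially. -/
theorem exists_one_tmul_mem_of_sigma_stable {K L E : Type*} [Field K] [Field L] [Algebra K L]
    [CommRing E] [Algebra K E] (σ : L →ₐ[K] L) (hfix : ∀ x, σ x = x → x ∈ (algebraMap K L).range)
    (I : Ideal (L ⊗[K] E)) (hI : ∀ x ∈ I, Algebra.TensorProduct.map σ (AlgHom.id K E) x ∈ I)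
    (hne : I ≠ ⊥) : ∃ e : E, e ≠ 0 ∧ (1 : L) ⊗ₜ[K] e ∈ I := by
  classical
  let b := Module.Basis.ofVectorSpace K E
  let B := Algebra.TensorProduct.basis L b
  have hrepr : ∀ x i, B.repr (Algebra.TensorProduct.map σ (AlgHom.id K E) x) i =
      σ (B.repr x i) := by
    intro x i
    induction x with
    | zero => simp
    | add x y hx hy => simp only [map_add, Finsupp.add_apply, hx, hy]
    | tmul l e =>
      simp [B, Algebra.TensorProduct.basis_repr_tmul]
  -- Take x in I of minimal support with respect to a basis of E, and normalise one coefficient to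
  -- 1. Then (σ ⊗ 1)y - y has smaller support and vanishes, so all coefficients of y lie in K.
  obtain ⟨x, hx⟩ : ∃ x, (x ∈ I ∧ x ≠ 0) ∧ ∀ y, y ∈ I ∧ y ≠ 0 →
      (B.repr x).support.card ≤ (B.repr y).support.card := by
    obtain ⟨x₀, hx₀⟩ := (Submodule.ne_bot_iff I).1 hne
    obtain ⟨x, hx, hmin⟩ := WellFounded.has_min
      (InvImage.wf (fun x => (B.repr x).support.card) Nat.lt_wfRel.wf)
      {x | x ∈ I ∧ x ≠ 0} ⟨x₀, hx₀⟩
    exact ⟨x, hx, fun y hy => not_lt.1 (hmin y hy)⟩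
  obtain ⟨⟨hxI, hx0⟩, hmin⟩ := hx
  obtain ⟨i, hi⟩ : ∃ i, B.repr x i ≠ 0 := by
    by_contra! h
    exact hx0 (B.repr.map_eq_zero_iff.1 (Finsupp.ext h))
  let y := (B.repr x i)⁻¹ • x
  have hyI : y ∈ I := Submodule.smul_of_tower_mem I _ hxI
  have hyr : ∀ j, B.repr y j = (B.repr x i)⁻¹ * B.repr x j := fun j => by
    simp [y]
  have hyi : B.repr y i = 1 := by rw [hyr, inv_mul_cancel₀ hi]
  have hy0 : y ≠ 0 := by
    intro h
    rw [h] at hyi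
    simp at hyi
  have hz : Algebra.TensorProduct.map σ (AlgHom.id K E) y - y = 0 := by
    by_contra hz0
    have h1 := hmin _ ⟨sub_mem (hI y hyI) hyI, hz0⟩
    refine absurd h1 (not_le.2 (Finset.card_lt_card ?_))
    rw [Finset.ssubset_iff_of_subset]
    · refine ⟨i, Finsupp.mem_support_iff.2 hi, ?_⟩
      rw [Finsupp.notMem_support_iff, map_sub, Finsupp.sub_apply, hrepr, hyi, map_one, sub_self]
    · intro j hj
      rw [Finsupp.mem_support_iff] at hj ⊢
      intro h0
      apply hj
      rw [map_sub, Finsupp.sub_apply, hrepr, hyr, h0, mul_zero, map_zero, sub_self]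
  have hc : ∀ j, ∃ d : K, algebraMap K L d = B.repr y j := by
    intro j
    refine hfix _ ?_
    have := congrArg (fun w => B.repr w j) hz
    simpa only [map_sub, Finsupp.sub_apply, hrepr, map_zero, Finsupp.coe_zero, Pi.zero_apply,
      sub_eq_zero] using this
  choose d hd using hc
  have hy : y = (1 : L) ⊗ₜ[K] (∑ j ∈ (B.repr y).support, d j • b j) := by
    conv_lhs => rw [← B.linearCombination_repr y]
    rw [Finsupp.linearCombination_apply, Finsupp.sum, TensorProduct.tmul_sum]
    refine Finset.sum_congr rfl fun j _ => ?_
    rw [← hd j, algebraMap_smul, Algebra.TensorProduct.basis_apply, TensorProduct.tmul_smul]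
  refine ⟨_, ?_, hy ▸ hyI⟩
  intro h0
  rw [h0, TensorProduct.tmul_zero] at hy
  exact hy0 hy

/-- An ideal of `L ⊗ E` stable under `σ ⊗ 1` is contained in the ideal generated by its
intersection with `E`. -/
theorem map_mk_eq_zero_of_sigma_stable {K L E : Type*} [Field K] [Field L] [Algebra K L]
    [CommRing E] [Algebra K E] (σ : L →ₐ[K] L) (hfix : ∀ x, σ x = x → x ∈ (algebraMap K L).range)
    (I : Ideal (L ⊗[K] E)) (hI : ∀ x ∈ I, Algebra.TensorProduct.map σ (AlgHom.id K E) x ∈ I)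
    (J : Ideal E) (hJ : ∀ e, e ∈ J ↔ (1 : L) ⊗ₜ[K] e ∈ I) {x : L ⊗[K] E} (hx : x ∈ I) :
    Algebra.TensorProduct.map (AlgHom.id K L) (Ideal.Quotient.mkₐ K J) x = 0 := by
  let f : L ⊗[K] E →ₐ[K] L ⊗[K] (E ⧸ J) :=
    Algebra.TensorProduct.map (AlgHom.id K L) (Ideal.Quotient.mkₐ K J)
  have hmk : Function.Surjective (Ideal.Quotient.mkₐ K J) := Ideal.Quotient.mk_surjective
  have hf : Function.Surjective f :=
    LinearMap.lTensor_surjective L (g := (Ideal.Quotient.mkₐ K J).toLinearMap) hmk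
  have hker : RingHom.ker f ≤ I := by
    have h1 := Algebra.TensorProduct.lTensor_ker (A := L) (Ideal.Quotient.mkₐ K J) hmk
    change RingHom.ker (Algebra.TensorProduct.map (AlgHom.id K L) (Ideal.Quotient.mkₐ K J)) ≤ I
    rw [h1, Ideal.map_le_iff_le_comap]
    intro e he
    rw [RingHom.mem_ker, Ideal.Quotient.mkₐ_eq_mk, Ideal.Quotient.eq_zero_iff_mem] at he
    exact (hJ e).1 he
  by_contra hne
  have hcomm : ∀ z, Algebra.TensorProduct.map σ (AlgHom.id K (E ⧸ J)) (f z) =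
      f (Algebra.TensorProduct.map σ (AlgHom.id K E) z) := by
    intro z
    induction z with
    | zero => simp
    | add z w hz hw => simp only [map_add, hz, hw]
    | tmul l e => rfl
  -- Since ker f ⊆ I, the image of I in L ⊗ (E/J) meets E/J only in 0. It is σ-stable, so the
  -- preceding result shows that it is 0.
  obtain ⟨e, he, heI⟩ := exists_one_tmul_mem_of_sigma_stable σ hfix (I.map f) (fun z hz => by
      obtain ⟨w, hw, rfl⟩ := (Ideal.mem_map_iff_of_surjective f hf).1 hz
      rw [hcomm]
      exact Ideal.mem_map_of_mem f (hI w hw))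
    (fun h0 => hne (by
      have := Ideal.mem_map_of_mem f hx
      rwa [h0, Ideal.mem_bot] at this))
  obtain ⟨e, rfl⟩ := hmk e
  obtain ⟨w, hw, hwe⟩ := (Ideal.mem_map_iff_of_surjective f hf).1 heI
  apply he
  rw [Ideal.Quotient.mkₐ_eq_mk, Ideal.Quotient.eq_zero_iff_mem, hJ]
  have h2 : w - (1 : L) ⊗ₜ[K] e ∈ I := by
    refine hker ?_
    rw [RingHom.mem_ker, map_sub, hwe]
    exact sub_self _
  have := sub_mem hw h2
  rwa [sub_sub_cancel] at this

/-- A proper ideal of `L ⊗ C[V]` stable under `σ ⊗ 1` has a zero with coordinates in the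
algebraically closed field `C`. -/
theorem exists_aeval_eq_zero_of_sigma_stable {K L C V : Type*} [Field K] [Field L] [Algebra K L]
    [Field C] [Algebra K C] [IsAlgClosed C] [Finite V]
    (σ : L →ₐ[K] L) (hfix : ∀ x, σ x = x → x ∈ (algebraMap K L).range)
    (I : Ideal (L ⊗[K] MvPolynomial V C))
    (hI : ∀ x ∈ I, Algebra.TensorProduct.map σ (AlgHom.id K (MvPolynomial V C)) x ∈ I)
    (hne : I ≠ ⊤) : ∃ z : V → C, ∀ x ∈ I, Algebra.TensorProduct.map (AlgHom.id K L)
      ((MvPolynomial.aeval z : MvPolynomial V C →ₐ[C] C).restrictScalars K) x = 0 := by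
  let inc : MvPolynomial V C →ₐ[K] L ⊗[K] MvPolynomial V C :=
    Algebra.TensorProduct.includeRight
  let J : Ideal (MvPolynomial V C) := I.comap inc
  have hJ : J ≠ ⊤ := by
    rw [Ideal.ne_top_iff_one] at hne ⊢
    intro h
    apply hne
    have : inc 1 ∈ I := h
    rwa [map_one] at this
  -- By the Nullstellensatz a maximal ideal above J is a point z. Evaluation at z factors through L
  -- ⊗ (C[V]/J), where I becomes 0.
  obtain ⟨N, hN, hJN⟩ := Ideal.exists_le_maximal J hJ
  obtain ⟨z, hz⟩ := MvPolynomial.isMaximal_iff_eq_vanishingIdeal_singleton.1 hN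
  refine ⟨z, fun x hx => ?_⟩
  have h1 := map_mk_eq_zero_of_sigma_stable σ hfix I hI J (fun e => Iff.rfl) hx
  let ev := (MvPolynomial.aeval z : MvPolynomial V C →ₐ[C] C).restrictScalars K
  have hev : ∀ a ∈ J, ev a = 0 := by
    intro a ha
    have h2 := hJN ha
    rw [hz, MvPolynomial.mem_vanishingIdeal_singleton_iff] at h2
    exact h2
  have h3 := congrArg (Algebra.TensorProduct.map (AlgHom.id K L)
    (Ideal.Quotient.liftₐ J ev hev)) h1
  rw [map_zero, ← AlgHom.comp_apply, ← Algebra.TensorProduct.map_comp] at h3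
  rw [← h3]
  congr 1

/-- A surjective endomorphism of a noetherian ring that maps `J` into a smaller ideal `P` forces
`J = P`. -/
theorem Ideal.le_of_le_comap_of_surjective {R : Type*} [CommRing R] [IsNoetherianRing R]
    {ψ : R →+* R} (hψ : Function.Surjective ψ) {P J : Ideal R} (hPJ : P ≤ J)
    (h : J ≤ P.comap ψ) : J ≤ P := by
  -- The chain P ⊆ ψ⁻¹P ⊆ ψ⁻²P ⊆ ⋯ becomes stationary. Preimage under a surjection is injective on
  -- ideals, so ψ⁻¹P = P, which contains J.
  have hmono : Monotone fun n => (Ideal.comap ψ)^[n] P := by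
    refine monotone_nat_of_le_succ fun n => ?_
    rw [Function.iterate_succ_apply]
    exact (show Monotone (Ideal.comap ψ) from fun _ _ h => Ideal.comap_mono h).iterate n
      (hPJ.trans h)
  obtain ⟨n, hn⟩ := monotone_stabilizes_iff_noetherian.2 (inferInstance : IsNoetherian R R)
    ⟨_, hmono⟩
  have h1 : (Ideal.comap ψ)^[n] P = (Ideal.comap ψ)^[n] (P.comap ψ) := by
    have := hn (n + 1) n.le_succ
    rwa [← Function.iterate_succ_apply]
  have h2 := (Ideal.comap_injective_of_surjective ψ hψ).iterate n h1
  rw [← h2] at h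
  exact h

/-! ### σ-stable ideals meet a solution ring F[M, (det M)⁻¹] trivially -/

/-- Two ring homomorphisms that agree on `K` define one on the tensor product. -/
theorem exists_ringHom_tmul {K A B R : Type*} [CommRing K] [CommRing A] [CommRing B] [CommRing R]
    [Algebra K A] [Algebra K B] (f : A →+* R) (g : B →+* R)
    (h : ∀ x, f (algebraMap K A x) = g (algebraMap K B x)) :
    ∃ φ : A ⊗[K] B →+* R, ∀ a b, φ (a ⊗ₜ b) = f a * g b := by
  let : Algebra K R := (f.comp (algebraMap K A)).toAlgebra
  let f' : A →ₐ[K] R := { f with commutes' := fun _ => rfl }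
  let g' : B →ₐ[K] R := { g with commutes' := fun x => (h x).symm }
  exact ⟨(Algebra.TensorProduct.productMap f' g').toRingHom, fun a b =>
    Algebra.TensorProduct.productMap_apply_tmul f' g' a b⟩

/-- Over a field the tensor product of non-zero rings is non-zero. It serves as a test ring: an
ideal killed by a homomorphism into a non-zero ring is proper. -/
theorem exists_nontrivial_pushout.{u, v, w} {F : Type w} {A : Type u} {B : Type v} [Field F]
    [CommRing A] [Nontrivial A] [CommRing B] [Nontrivial B] (f : F →+* A) (g : F →+* B) :
    ∃ (R : Type (max u v)) (_ : CommRing R) (_ : Nontrivial R) (a : A →+* R) (b : B →+* R),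
      ∀ x, a (f x) = b (g x) := by
  let := f.toAlgebra
  let := g.toAlgebra
  refine ⟨TensorProduct F A B, inferInstance, inferInstance,
    Algebra.TensorProduct.includeLeftRingHom,
    (Algebra.TensorProduct.includeRight : B →ₐ[F] TensorProduct F A B).toRingHom, fun x => ?_⟩
  change (algebraMap F A x) ⊗ₜ[F] (1 : B) = (1 : A) ⊗ₜ[F] (algebraMap F B x)
  rw [Algebra.algebraMap_eq_smul_one, Algebra.algebraMap_eq_smul_one, TensorProduct.smul_tmul]

/-- Let `K` be the fixed field of `σ` on the field `L`, and let `S ⊆ L ⊗ C` be an extension of the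
field `F` containing `C`. If `M` is an invertible matrix over `S` with `σ M = B M`, `B` over `F`,
then a proper ideal of `S` stable under `σ` does not meet `F[M, (det M)⁻¹]`. -/
theorem aeval_eq_zero_of_sigma_stable {K L C F S n : Type*} [Field K] [Field L] [Algebra K L]
    [Field C] [Algebra K C] [IsAlgClosed C] [Field F] [CommRing S] [Algebra F S]
    [Fintype n] [DecidableEq n]
    (σ : L →ₐ[K] L) (hfix : ∀ x, σ x = x → x ∈ (algebraMap K L).range)
    (ι : S →+* L ⊗[K] C) (hι : Function.Injective ι) (σS : S →+* S)
    (hσS : ∀ x, ι (σS x) = Algebra.TensorProduct.map σ (AlgHom.id K C) (ι x))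
    (σF : F →+* F) (hσF : ∀ a, σS (algebraMap F S a) = algebraMap F S (σF a))
    (jC : C →+* F) (hjC : ∀ c, ι (algebraMap F S (jC c)) = (1 : L) ⊗ₜ[K] c)
    (M : Matrix n n S) {u : S} (hu : M.det * u = 1) (B : Matrix n n F)
    (hM : M.map σS = B.map (algebraMap F S) * M)
    (I : Ideal S) (hI : ∀ x ∈ I, σS x ∈ I) (hne : I ≠ ⊤) (p : MvPolynomial (Option (n × n)) F)
    (hp : MvPolynomial.aeval (fun v : Option (n × n) => v.elim u fun q => M q.1 q.2) p ∈ I) :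
    MvPolynomial.aeval (fun v : Option (n × n) => v.elim u fun q => M q.1 q.2) p = 0 := by
  classical
  -- The variable `none` stands for the inverse determinant u, and `some (i, j)` for the matrix
  -- entry at (i, j).
  let V := Option (n × n)
  let ev : MvPolynomial V F →ₐ[F] S :=
    MvPolynomial.aeval (fun v : V => v.elim u fun q => M q.1 q.2)
  have ev_some : ∀ i j, ev (MvPolynomial.X (some (i, j))) = M i j := fun i j =>
    MvPolynomial.aeval_X _ _
  have ev_none : ev (MvPolynomial.X none) = u := MvPolynomial.aeval_X _ _
  let J : Ideal (MvPolynomial V F) := I.comap ev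
  let P : Ideal (MvPolynomial V F) := RingHom.ker ev
  have hPJ : P ≤ J := fun q hq => by
    change ev q ∈ I
    rw [show ev q = 0 from hq]
    exact I.zero_mem
  have hntS : Nontrivial S := by
    by_contra h
    rw [not_nontrivial_iff_subsingleton] at h
    exact hne (Subsingleton.elim _ _)
  have hnt : Nontrivial (L ⊗[K] C) := inferInstance
  let θ : F →+* L ⊗[K] C := ι.comp (algebraMap F S)
  let σΩ : L ⊗[K] C →ₐ[K] L ⊗[K] C := Algebra.TensorProduct.map σ (AlgHom.id K C)
  have hθσ : ∀ a, σΩ (θ a) = θ (σF a) := fun a => by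
    change σΩ (ι _) = ι _
    rw [← hσS, hσF]
  have hMσ : ∀ i j, σS (M i j) = ∑ a, algebraMap F S (B i a) * M a j := fun i j =>
    congrFun (congrFun hM i) j
  have hdetσ : σS M.det = algebraMap F S B.det * M.det := by
    rw [RingHom.map_det, RingHom.map_det, ← Matrix.det_mul]
    exact congrArg Matrix.det hM
  have hB : B.det ≠ 0 := by
    intro h0
    have h1 := congrArg σS hu
    rw [map_mul, hdetσ, h0, map_zero, zero_mul, zero_mul, map_one] at h1
    exact zero_ne_one h1
  have huσ : σS u = algebraMap F S B.det⁻¹ * u := by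
    have h1 := congrArg σS hu
    rw [map_mul, hdetσ, map_one] at h1
    have h2 : algebraMap F S B.det⁻¹ * algebraMap F S B.det = 1 := by
      rw [← map_mul, inv_mul_cancel₀ hB, map_one]
    calc σS u = (algebraMap F S B.det⁻¹ * algebraMap F S B.det) * (M.det * u) * σS u := by
          rw [h2, hu]; ring
      _ = algebraMap F S B.det⁻¹ * u * (algebraMap F S B.det * M.det * σS u) := by ring
      _ = _ := by rw [h1, mul_one]
  -- The lift of σ to polynomials, Y ↦ BY and u ↦ (det B)⁻¹u, chosen so that `ev` commutes with σ.
  let σ' : MvPolynomial V F →+* MvPolynomial V F := MvPolynomial.eval₂Hom (MvPolynomial.C.comp σF)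
    (fun v : V => v.elim (MvPolynomial.C B.det⁻¹ * MvPolynomial.X none)
      fun q => ∑ a, MvPolynomial.C (B q.1 a) * MvPolynomial.X (some (a, q.2)))
  have σ'_C : ∀ a, σ' (MvPolynomial.C a) = MvPolynomial.C (σF a) := fun a =>
    MvPolynomial.eval₂Hom_C _ _ _
  have σ'_some : ∀ i j, σ' (MvPolynomial.X (some (i, j))) =
      ∑ a, MvPolynomial.C (B i a) * MvPolynomial.X (some (a, j)) := fun i j =>
    MvPolynomial.eval₂Hom_X' _ _ _
  have σ'_none : σ' (MvPolynomial.X none) = MvPolynomial.C B.det⁻¹ * MvPolynomial.X none :=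
    MvPolynomial.eval₂Hom_X' _ _ _
  have ev_C : ∀ a, ev (MvPolynomial.C a) = algebraMap F S a := fun a => MvPolynomial.aeval_C _ _
  have hevσ : ∀ q, ev (σ' q) = σS (ev q) := by
    have : (ev : MvPolynomial V F →+* S).comp σ' = σS.comp (ev : MvPolynomial V F →+* S) := by
      refine MvPolynomial.ringHom_ext (fun a => ?_) ?_
      · change ev (σ' _) = σS (ev _)
        rw [σ'_C, ev_C, ev_C, hσF]
      · rintro (_ | ⟨i, j⟩)
        · change ev (σ' _) = σS (ev _)
          rw [σ'_none, ev_none, map_mul, ev_C, ev_none, huσ]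
        · change ev (σ' _) = σS (ev _)
          rw [σ'_some, ev_some, hMσ, map_sum]
          exact Finset.sum_congr rfl fun a _ => by rw [map_mul, ev_C, ev_some]
    exact fun q => RingHom.congr_fun this q
  -- the substitution `Y = M Z`
  let E := MvPolynomial V C
  let α : L ⊗[K] C →ₐ[K] L ⊗[K] E :=
    Algebra.TensorProduct.map (AlgHom.id K L) (IsScalarTower.toAlgHom K C E)
  let σT : L ⊗[K] E →ₐ[K] L ⊗[K] E := Algebra.TensorProduct.map σ (AlgHom.id K E)
  have hσα : ∀ x, σT (α x) = α (σΩ x) := by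
    intro x
    induction x with
    | zero => simp
    | add x y hx hy => simp only [map_add, hx, hy]
    | tmul l c => rfl
  let y : V → L ⊗[K] E := fun v => 1 ⊗ₜ MvPolynomial.X v
  have hσy : ∀ v, σT (y v) = y v := fun v => by
    change σ 1 ⊗ₜ[K] _ = _
    rw [map_one]
    rfl
  let sub : MvPolynomial V F →+* L ⊗[K] E := MvPolynomial.eval₂Hom ((α : _ →+* _).comp θ)
    (fun v : V => v.elim (α (ι u) * y none) fun q => ∑ a, α (ι (M q.1 a)) * y (some (a, q.2)))
  have sub_C : ∀ a, sub (MvPolynomial.C a) = α (θ a) := fun a => MvPolynomial.eval₂Hom_C _ _ _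
  have sub_some : ∀ i j, sub (MvPolynomial.X (some (i, j))) =
      ∑ a, α (ι (M i a)) * y (some (a, j)) := fun i j => MvPolynomial.eval₂Hom_X' _ _ _
  have sub_none : sub (MvPolynomial.X none) = α (ι u) * y none := MvPolynomial.eval₂Hom_X' _ _ _
  have hsubσ : ∀ q, σT (sub q) = sub (σ' q) := by
    have : (σT : L ⊗[K] E →+* L ⊗[K] E).comp sub = sub.comp σ' := by
      refine MvPolynomial.ringHom_ext (fun a => ?_) ?_
      · change σT (sub _) = sub (σ' _)
        rw [σ'_C, sub_C, sub_C, hσα, hθσ]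
      · rintro (_ | ⟨i, j⟩)
        · change σT (sub _) = sub (σ' _)
          rw [σ'_none, map_mul, sub_none, sub_C, map_mul, hσα, hσy, ← hσS, huσ, map_mul, map_mul,
            mul_assoc]
          rfl
        · change σT (sub _) = sub (σ' _)
          rw [σ'_some, sub_some, map_sum, map_sum]
          have h1 : ∀ b, sub (MvPolynomial.C (B i b) * MvPolynomial.X (some (b, j))) =
              ∑ a, α (θ (B i b)) * (α (ι (M b a)) * y (some (a, j))) := fun b => by
            rw [map_mul, sub_C, sub_some, Finset.mul_sum]
          simp_rw [h1]
          rw [Finset.sum_comm]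
          refine Finset.sum_congr rfl fun a _ => ?_
          rw [map_mul, hσα, hσy, ← hσS, hMσ, map_sum, map_sum, Finset.sum_mul]
          refine Finset.sum_congr rfl fun b _ => ?_
          rw [map_mul, map_mul, mul_assoc]
          rfl
    exact fun q => RingHom.congr_fun this q
  have hJσ : ∀ q ∈ J, σ' q ∈ J := fun q hq => by
    change ev (σ' q) ∈ I
    rw [hevσ]
    exact hI _ hq
  have hJ2σ : ∀ x ∈ J.map sub, σT x ∈ J.map sub := by
    have : J.map sub ≤ (J.map sub).comap (σT : L ⊗[K] E →+* L ⊗[K] E) := by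
      rw [Ideal.map_le_iff_le_comap]
      intro q hq
      change σT (sub q) ∈ J.map sub
      rw [hsubσ]
      exact Ideal.mem_map_of_mem sub (hJσ q hq)
    exact this
  -- The substitution is undone in a non-zero ring R that receives both F[Y, u]/J and L ⊗ C over F.
  -- Sending the new variables to M⁻¹Y, with M⁻¹ = u · adj M, defines β such that β ∘ `sub` is the
  -- reduction modulo J; so β kills the extended ideal.
  have hJ2 : J.map sub ≠ ⊤ := by
    have hJtop : J ≠ ⊤ := by
      rw [Ideal.ne_top_iff_one] at hne ⊢
      intro h1
      apply hne
      have : ev 1 ∈ I := h1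
      rwa [map_one] at this
    have : Nontrivial (MvPolynomial V F ⧸ J) := Ideal.Quotient.nontrivial_iff.2 hJtop
    obtain ⟨R, _, _, ρ, ω, hρω⟩ := exists_nontrivial_pushout
      ((Ideal.Quotient.mk J).comp MvPolynomial.C) θ
    let N := ι.mapMatrix M.adjugate
    let g : E →+* R := MvPolynomial.eval₂Hom
      (ω.comp (Algebra.TensorProduct.includeRight : C →ₐ[K] L ⊗[K] C).toRingHom)
      (fun v : V => v.elim (ω (ι M.det) * ρ (Ideal.Quotient.mk J (MvPolynomial.X none)))
        fun q => ∑ b, ω (ι u * ι (M.adjugate q.1 b)) *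
          ρ (Ideal.Quotient.mk J (MvPolynomial.X (some (b, q.2)))))
    have g_C : ∀ c, g (MvPolynomial.C c) = ω ((1 : L) ⊗ₜ c) := fun c =>
      MvPolynomial.eval₂Hom_C _ _ _
    have g_some : ∀ i j, g (MvPolynomial.X (some (i, j))) =
        ∑ b, ω (ι u * ι (M.adjugate i b)) *
          ρ (Ideal.Quotient.mk J (MvPolynomial.X (some (b, j)))) := fun i j =>
      MvPolynomial.eval₂Hom_X' _ _ _
    have g_none : g (MvPolynomial.X none) =
        ω (ι M.det) * ρ (Ideal.Quotient.mk J (MvPolynomial.X none)) :=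
      MvPolynomial.eval₂Hom_X' _ _ _
    obtain ⟨β, hβ⟩ := exists_ringHom_tmul (K := K) (A := L) (B := E)
      (ω.comp (Algebra.TensorProduct.includeLeftRingHom : L →+* L ⊗[K] C)) g (fun x => by
        rw [show algebraMap K E x = MvPolynomial.C (algebraMap K C x) from rfl, g_C]
        change ω ((algebraMap K L x) ⊗ₜ[K] (1 : C)) = ω ((1 : L) ⊗ₜ[K] (algebraMap K C x))
        rw [Algebra.algebraMap_eq_smul_one, Algebra.algebraMap_eq_smul_one,
          TensorProduct.smul_tmul])
    have hβα : ∀ x, β (α x) = ω x := by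
      intro x
      induction x with
      | zero => simp
      | add x y hx hy => simp only [map_add, hx, hy]
      | tmul l c =>
        change β (l ⊗ₜ[K] MvPolynomial.C c) = _
        rw [hβ, g_C]
        change ω (l ⊗ₜ[K] (1 : C)) * _ = _
        rw [← map_mul, Algebra.TensorProduct.tmul_mul_tmul, mul_one, one_mul]
    have hβy : ∀ v, β (y v) = g (MvPolynomial.X v) := fun v => by
      rw [hβ, map_one, one_mul]
    have hβsub : ∀ q, β (sub q) = ρ (Ideal.Quotient.mk J q) := by
      have : β.comp sub = ρ.comp (Ideal.Quotient.mk J) := by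
        refine MvPolynomial.ringHom_ext (fun a => ?_) ?_
        · change β (sub _) = _
          rw [sub_C, hβα]
          exact (hρω a).symm
        · rintro (_ | ⟨i, j⟩)
          · change β (sub _) = _
            rw [sub_none, map_mul, hβα, hβy, g_none, ← mul_assoc, ← map_mul, ← map_mul,
              mul_comm u, hu, map_one, map_one, one_mul]
            rfl
          · change β (sub _) = ρ (Ideal.Quotient.mk J _)
            rw [sub_some, map_sum]
            simp_rw [map_mul β, hβα, hβy, g_some, Finset.mul_sum]
            rw [Finset.sum_comm]
            have h1 : ∀ b, ∑ a, M i a * (u * M.adjugate a b) = if i = b then 1 else 0 := by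
              intro b
              have h2 := congrFun (congrFun (Matrix.mul_adjugate M) i) b
              rw [Matrix.mul_apply] at h2
              calc ∑ a, M i a * (u * M.adjugate a b) = u * ∑ a, M i a * M.adjugate a b := by
                    rw [Finset.mul_sum]; exact Finset.sum_congr rfl fun a _ => by ring
                _ = _ := by
                    rw [h2, Matrix.smul_apply, Matrix.one_apply, smul_eq_mul, ← mul_assoc,
                      mul_comm u, hu, one_mul]
            have h3 : ∀ b, ∑ a, ω (ι (M i a)) * (ω (ι u * ι (M.adjugate a b)) *
                ρ (Ideal.Quotient.mk J (MvPolynomial.X (some (b, j))))) =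
                if i = b then ρ (Ideal.Quotient.mk J (MvPolynomial.X (some (b, j)))) else 0 := by
              intro b
              have h4 := congrArg (fun z => ω (ι z)) (h1 b)
              simp only [map_sum, map_mul] at h4
              simp only [← mul_assoc, map_mul] at h4 ⊢
              rw [← Finset.sum_mul, h4]
              split_ifs <;> simp
            simp_rw [h3]
            simp
      exact fun q => RingHom.congr_fun this q
    have hle : J.map sub ≤ RingHom.ker β := by
      rw [Ideal.map_le_iff_le_comap]
      intro q hq
      change β (sub q) = 0
      rw [hβsub, Ideal.Quotient.eq_zero_iff_mem.2 hq, map_zero]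
    intro htop
    rw [htop] at hle
    have : β 1 = 0 := hle Submodule.mem_top
    rw [map_one] at this
    exact one_ne_zero this
  -- The point z makes every polynomial of J vanish at Y = MZ, with Z the constant matrix formed
  -- from z.
  obtain ⟨z, hz⟩ := exists_aeval_eq_zero_of_sigma_stable σ hfix (J.map sub) hJ2σ hJ2
  let evz : L ⊗[K] E →ₐ[K] L ⊗[K] C := Algebra.TensorProduct.map (AlgHom.id K L)
    ((MvPolynomial.aeval z : MvPolynomial V C →ₐ[C] C).restrictScalars K)
  have evz_α : ∀ x, evz (α x) = x := by
    intro x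
    induction x with
    | zero => simp
    | add x y hx hy => simp only [map_add, hx, hy]
    | tmul l c =>
      change l ⊗ₜ[K] (MvPolynomial.aeval z (MvPolynomial.C c)) = _
      rw [MvPolynomial.aeval_C]
      rfl
  have evz_y : ∀ v, evz (y v) = (1 : L) ⊗ₜ z v := fun v => by
    change (1 : L) ⊗ₜ[K] (MvPolynomial.aeval z (MvPolynomial.X v)) = _
    rw [MvPolynomial.aeval_X]
  let Z : Matrix n n C := Matrix.of fun i j => z (some (i, j))
  let inc : C →ₐ[K] L ⊗[K] C := Algebra.TensorProduct.includeRight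
  have hinc : Function.Injective inc := Algebra.TensorProduct.includeRight_injective
    (algebraMap K L).injective
  -- the point `Z` is invertible
  have hZ : z none * Z.det = 1 := by
    let q : MvPolynomial V F := MvPolynomial.X none *
      (Matrix.of fun i j => (MvPolynomial.X (some (i, j)) : MvPolynomial V F)).det - 1
    have hq : q ∈ P := by
      change ev q = 0
      rw [map_sub, map_mul, ev_none, map_one, AlgHom.map_det]
      have : (ev.mapMatrix (Matrix.of fun i j => MvPolynomial.X (some (i, j)))) = M := by
        ext i j
        exact ev_some i j
      rw [this, mul_comm, hu, sub_self]
    have h1 := hz _ (Ideal.mem_map_of_mem sub (hPJ hq))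
    change evz (sub q) = 0 at h1
    have h2 : (evz : L ⊗[K] E →+* L ⊗[K] C).comp sub
        (Matrix.of fun i j => (MvPolynomial.X (some (i, j)) : MvPolynomial V F)).det =
        ι M.det * inc Z.det := by
      rw [RingHom.map_det, RingHom.map_det, AlgHom.map_det, ← Matrix.det_mul]
      congr 1
      ext i j
      change evz (sub (MvPolynomial.X (some (i, j)))) = _
      rw [sub_some, map_sum, Matrix.mul_apply]
      refine Finset.sum_congr rfl fun a _ => ?_
      rw [map_mul, evz_α, evz_y]
      rfl
    have h3 : evz (sub q) = ι u * inc (z none) * (ι M.det * inc Z.det) - 1 := by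
      rw [← h2, map_sub, map_sub, map_mul, map_mul, map_one, map_one, sub_none, map_mul, evz_α,
        evz_y]
      rfl
    rw [h3, sub_eq_zero] at h1
    apply hinc
    rw [map_one, ← h1, map_mul]
    have h4 : ι u * ι M.det = 1 := by rw [← map_mul, mul_comm, hu, map_one]
    linear_combination (-(inc (z none) * inc Z.det)) * h4
  -- the automorphism `Y ↦ Y Z`
  let Ψ : MvPolynomial V F →ₐ[F] MvPolynomial V F := MvPolynomial.aeval
    (fun v : V => v.elim (MvPolynomial.X none * MvPolynomial.C (jC (z none)))
      fun q => ∑ a, MvPolynomial.X (some (q.1, a)) * MvPolynomial.C (jC (Z a q.2)))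
  have Ψ_some : ∀ i j, Ψ (MvPolynomial.X (some (i, j))) =
      ∑ a, MvPolynomial.X (some (i, a)) * MvPolynomial.C (jC (Z a j)) := fun i j =>
    MvPolynomial.aeval_X _ _
  have Ψ_none : Ψ (MvPolynomial.X none) = MvPolynomial.X none * MvPolynomial.C (jC (z none)) :=
    MvPolynomial.aeval_X _ _
  have Ψ_C : ∀ a, Ψ (MvPolynomial.C a) = MvPolynomial.C a := fun a => MvPolynomial.aeval_C _ _
  have hΨ : ∀ q, ι (ev (Ψ q)) = evz (sub q) := by
    have : (ι.comp (ev : MvPolynomial V F →+* S)).comp (Ψ : MvPolynomial V F →+* _) =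
        (evz : L ⊗[K] E →+* L ⊗[K] C).comp sub := by
      refine MvPolynomial.ringHom_ext (fun a => ?_) ?_
      · change ι (ev (Ψ _)) = evz (sub _)
        rw [Ψ_C, ev_C, sub_C, evz_α]
        rfl
      · rintro (_ | ⟨i, j⟩)
        · change ι (ev (Ψ _)) = evz (sub _)
          rw [Ψ_none, sub_none, map_mul, map_mul, map_mul, evz_α, evz_y, ev_none, ev_C, hjC]
        · change ι (ev (Ψ _)) = evz (sub _)
          rw [Ψ_some, sub_some, map_sum, map_sum, map_sum]
          refine Finset.sum_congr rfl fun a _ => ?_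
          rw [map_mul, map_mul, map_mul, evz_α, evz_y, ev_some, ev_C, hjC]
          rfl
    exact fun q => RingHom.congr_fun this q
  -- The composite `ev` ∘ Ψ is evaluation at MZ, so Ψ maps J into the relation ideal P.
  -- Invertibility of Z makes Ψ surjective.
  have hΨP : J ≤ P.comap (Ψ : MvPolynomial V F →+* _) := by
    intro q hq
    change ev (Ψ q) = 0
    apply hι
    rw [hΨ, map_zero]
    exact hz _ (Ideal.mem_map_of_mem sub hq)
  have hΨs : Function.Surjective (Ψ : MvPolynomial V F →+* MvPolynomial V F) := by
    have hz0 : z none ≠ 0 := left_ne_zero_of_mul_eq_one hZ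
    have hZu : IsUnit Z.det := IsUnit.of_mul_eq_one_right _ hZ
    have hr : ∀ q, q ∈ Ψ.range := by
      intro q
      induction q using MvPolynomial.induction_on with
      | C a => exact ⟨MvPolynomial.C a, Ψ_C a⟩
      | add p q hp hq => exact add_mem hp hq
      | mul_X p v hp =>
        refine mul_mem hp ?_
        rcases v with _ | ⟨i, j⟩
        · refine ⟨MvPolynomial.X none * MvPolynomial.C (jC (z none)⁻¹), ?_⟩
          change Ψ _ = _
          rw [map_mul, Ψ_none, Ψ_C, mul_assoc, ← MvPolynomial.C_mul, ← map_mul,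
            mul_inv_cancel₀ hz0, map_one, MvPolynomial.C_1, mul_one]
        · refine ⟨∑ b, MvPolynomial.X (some (i, b)) * MvPolynomial.C (jC (Z⁻¹ b j)), ?_⟩
          change Ψ _ = _
          rw [map_sum]
          simp_rw [map_mul Ψ, Ψ_some, Ψ_C, Finset.sum_mul]
          rw [Finset.sum_comm]
          have h1 : ∀ a, ∑ b, (MvPolynomial.X (some (i, a)) : MvPolynomial V F) *
              MvPolynomial.C (jC (Z a b)) * MvPolynomial.C (jC (Z⁻¹ b j)) =
              if a = j then MvPolynomial.X (some (i, a)) else 0 := by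
            intro a
            have h2 := congrFun (congrFun (Matrix.mul_nonsing_inv Z hZu) a) j
            rw [Matrix.mul_apply, Matrix.one_apply] at h2
            have h3 := congrArg (fun c => (MvPolynomial.C (jC c) : MvPolynomial V F)) h2
            simp only [map_sum, map_mul] at h3
            simp_rw [mul_assoc]
            rw [← Finset.mul_sum, h3]
            split_ifs <;> simp
          simp_rw [h1]
          simp
    exact hr
  exact Ideal.le_of_le_comap_of_surjective hΨs hPJ hΨP hp

/-! ### Exhaustion by solution rings and σ-simplicity -/

/-- The subring of `S` generated over `F` by the entries of `M` and by `u = (det M)⁻¹`, where `M`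
is a fundamental matrix of solutions of a system `σ M = B M` over `F`. -/
def IsSolutionSubring (F : Type*) {S : Type*} [CommRing F] [CommRing S] [Algebra F S]
    (σ : S →+* S) (T : Subring S) : Prop :=
  ∃ (n : Type) (_ : Fintype n) (_ : DecidableEq n) (M : Matrix n n S) (u : S) (B : Matrix n n F),
    M.det * u = 1 ∧ M.map σ = B.map (algebraMap F S) * M ∧
    T = Subring.closure (Set.range (algebraMap F S) ∪ (Set.range fun q : n × n => M q.1 q.2) ∪ {u})

/-- Differentiating a system: `(M, δM; 0, M)` is a fundamental matrix of solutions for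
`(B, δB; 0, B)`. -/
theorem IsSolutionSubring.exists_delta_mem {F S : Type*} [CommRing F] [CommRing S] [Algebra F S]
    (s : SDStruct S) {d : F → F} (hd : ∀ a, s.delta (algebraMap F S a) = algebraMap F S (d a))
    {T : Subring S} (hT : IsSolutionSubring F (s.sigma : S →+* S) T) :
    ∃ T', IsSolutionSubring F (s.sigma : S →+* S) T' ∧ T ≤ T' ∧ ∀ x ∈ T, s.delta x ∈ T' := by
  obtain ⟨n, _, _, M, u, B, hu, hM, rfl⟩ := hT
  let M' : Matrix (n ⊕ n) (n ⊕ n) S := Matrix.fromBlocks M (M.map s.delta) 0 M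
  let B' : Matrix (n ⊕ n) (n ⊕ n) F := Matrix.fromBlocks B (B.map d) 0 B
  have hdet : M'.det = M.det * M.det := Matrix.det_fromBlocks_zero₂₁ _ _ _
  let T' : Subring S := Subring.closure
    (Set.range (algebraMap F S) ∪ (Set.range fun q : (n ⊕ n) × (n ⊕ n) => M' q.1 q.2) ∪ {u * u})
  have hF : ∀ a, algebraMap F S a ∈ T' := fun a =>
    Subring.subset_closure (Or.inl (Or.inl ⟨a, rfl⟩))
  have hM' : ∀ i j, M i j ∈ T' := fun i j =>
    Subring.subset_closure (Or.inl (Or.inr ⟨(Sum.inl i, Sum.inl j), rfl⟩))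
  have hδM' : ∀ i j, s.delta (M i j) ∈ T' := fun i j =>
    Subring.subset_closure (Or.inl (Or.inr ⟨(Sum.inl i, Sum.inr j), rfl⟩))
  have huu : u * u ∈ T' := Subring.subset_closure (Or.inr rfl)
  -- W collects the elements that lie in T' together with their derivative; it suffices that it
  -- contains the generators of T.
  let W : Subring S :=
    { carrier := {x | x ∈ T' ∧ s.delta x ∈ T'}
      mul_mem' := fun {x y} hx hy => ⟨mul_mem hx.1 hy.1, by
        rw [Derivation.leibniz, smul_eq_mul, smul_eq_mul]
        exact add_mem (mul_mem hx.1 hy.2) (mul_mem hy.1 hx.2)⟩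
      one_mem' := ⟨one_mem _, by simp⟩
      add_mem' := fun {x y} hx hy => ⟨add_mem hx.1 hy.1, by
        rw [map_add]; exact add_mem hx.2 hy.2⟩
      zero_mem' := ⟨zero_mem _, by simp⟩
      neg_mem' := fun {x} hx => ⟨neg_mem hx.1, by rw [map_neg]; exact neg_mem hx.2⟩ }
  have hMW : ∀ i j, M i j ∈ W := fun i j => ⟨hM' i j, hδM' i j⟩
  have hdetW : M.det ∈ W := by
    rw [Matrix.det_apply]
    refine sum_mem fun τ _ => ?_
    rw [Units.smul_def]
    exact zsmul_mem (prod_mem fun i _ => hMW _ _) _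
  -- The added generator is only u², the inverse of det M' = (det M)²; u is recovered from it by
  -- multiplying with det M.
  have huT' : u ∈ T' := by
    have : u = u * u * M.det := by linear_combination (-u) * hu
    rw [this]
    exact mul_mem huu hdetW.1
  have hδu : s.delta u = -(u * u * s.delta M.det) := by
    have h1 := congrArg s.delta hu
    rw [Derivation.leibniz, smul_eq_mul, smul_eq_mul, Derivation.map_one_eq_zero] at h1
    linear_combination u * h1 - s.delta u * hu
  have hle : Subring.closure
      (Set.range (algebraMap F S) ∪ (Set.range fun q : n × n => M q.1 q.2) ∪ {u}) ≤ W := by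
    rw [Subring.closure_le]
    rintro x ((⟨a, rfl⟩ | ⟨q, rfl⟩) | rfl)
    · exact ⟨hF a, by rw [hd]; exact hF _⟩
    · exact ⟨hM' _ _, hδM' _ _⟩
    · exact ⟨huT', by rw [hδu]; exact neg_mem (mul_mem huu hdetW.2)⟩
  refine ⟨T', ⟨n ⊕ n, inferInstance, inferInstance, M', u * u, B', ?_, ?_, rfl⟩,
    fun x hx => (hle hx).1, fun x hx => (hle hx).2⟩
  · rw [hdet]
    linear_combination (M.det * u + 1) * hu
  · have h1 : (M.map s.delta).map (s.sigma : S →+* S) =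
        B.map (algebraMap F S) * M.map s.delta + (B.map d).map (algebraMap F S) * M := by
      ext i j
      have h2 := congrArg s.delta (congrFun (congrFun hM i) j)
      rw [Matrix.map_apply, Matrix.mul_apply, map_sum] at h2
      simp only [Matrix.map_apply, Matrix.add_apply, Matrix.mul_apply]
      change s.sigma (s.delta _) = _
      rw [s.comm, ← Finset.sum_add_distrib]
      refine h2.trans (Finset.sum_congr rfl fun a _ => ?_)
      rw [Derivation.leibniz, Matrix.map_apply, hd, smul_eq_mul, smul_eq_mul]
      ring
    rw [Matrix.fromBlocks_map, Matrix.fromBlocks_map, Matrix.fromBlocks_multiply, h1, hM]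
    congr 1 <;> ext <;> simp

/-- Picard-Vessiot rings inside `L ⊗ C` are `σ`-simple. -/
theorem eq_bot_or_eq_top_of_sigma_stable {K L C F S : Type*} [Field K] [Field L] [Algebra K L]
    [Field C] [Algebra K C] [IsAlgClosed C] [Field F] [CommRing S] [Algebra F S]
    (σ : L →ₐ[K] L) (hfix : ∀ x, σ x = x → x ∈ (algebraMap K L).range)
    (ι : S →+* L ⊗[K] C) (hι : Function.Injective ι) (s : SDStruct S)
    (hs : ∀ x, ι (s.sigma x) = Algebra.TensorProduct.map σ (AlgHom.id K C) (ι x))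
    (σF : F →+* F) (hσF : ∀ a, s.sigma (algebraMap F S a) = algebraMap F S (σF a))
    {d : F → F} (hd : ∀ a, s.delta (algebraMap F S a) = algebraMap F S (d a))
    (jC : C →+* F) (hjC : ∀ c, ι (algebraMap F S (jC c)) = (1 : L) ⊗ₜ[K] c)
    {m : ℕ} (Z : Matrix (Fin m) (Fin m) S) (hZ : IsUnit Z.det) (B : Matrix (Fin m) (Fin m) F)
    (hB : Z.map s.sigma = B.map (algebraMap F S) * Z)
    (hgen : s.deltaAdjoin (Set.range (algebraMap F S) ∪
      (Set.range fun q : Fin m × Fin m => Z q.1 q.2) ∪ {Ring.inverse Z.det}) = ⊤)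
    (I : Ideal S) (hI : ∀ x ∈ I, s.sigma x ∈ I) : I = ⊥ ∨ I = ⊤ := by
  rw [or_iff_not_imp_right]
  intro hne
  let T₀ : Subring S := Subring.closure (Set.range (algebraMap F S) ∪
      (Set.range fun q : Fin m × Fin m => Z q.1 q.2) ∪ {Ring.inverse Z.det})
  have hT₀ : IsSolutionSubring F (s.sigma : S →+* S) T₀ :=
    ⟨Fin m, inferInstance, inferInstance, Z, Ring.inverse Z.det, B,
      Ring.mul_inverse_cancel _ hZ, hB, rfl⟩
  -- A chain of solution subrings, each containing the derivatives of the preceding one. Its union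
  -- is δ-stable, hence all of S, while a proper σ-stable ideal meets every member in 0.
  let f : ℕ → {T : Subring S // IsSolutionSubring F (s.sigma : S →+* S) T} := fun n =>
    Nat.rec ⟨T₀, hT₀⟩ (fun _ T => ⟨(T.2.exists_delta_mem s hd).choose,
      (T.2.exists_delta_mem s hd).choose_spec.1⟩) n
  have hf : ∀ n, (f n).1 ≤ (f (n + 1)).1 ∧ ∀ x ∈ (f n).1, s.delta x ∈ (f (n + 1)).1 := fun n =>
    ((f n).2.exists_delta_mem s hd).choose_spec.2
  have hmono : Monotone fun n => (f n).1 := monotone_nat_of_le_succ fun n => (hf n).1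
  have hmem : ∀ x, x ∈ (⨆ n, (f n).1) ↔ ∃ n, x ∈ (f n).1 := fun x =>
    Subring.mem_iSup_of_directed hmono.directed_le
  have htop : ∀ x, x ∈ (⨆ n, (f n).1) := by
    have h1 : s.deltaAdjoin (Set.range (algebraMap F S) ∪
      (Set.range fun q : Fin m × Fin m => Z q.1 q.2) ∪ {Ring.inverse Z.det}) ≤ ⨆ n, (f n).1 := by
      refine sInf_le ⟨fun x hx => (hmem x).2 ⟨0, Subring.subset_closure hx⟩, fun x hx => ?_⟩
      obtain ⟨n, hn⟩ := (hmem x).1 hx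
      exact (hmem _).2 ⟨n + 1, (hf n).2 x hn⟩
    rw [hgen] at h1
    exact fun x => h1 (Subring.mem_top x)
  rw [eq_bot_iff]
  intro x hx
  obtain ⟨n, hn⟩ := (hmem x).1 (htop x)
  obtain ⟨N, _, _, M, u, B', hu, hM, hT⟩ := (f n).2
  rw [hT] at hn
  have hle : Subring.closure
      (Set.range (algebraMap F S) ∪ (Set.range fun q : N × N => M q.1 q.2) ∪ {u}) ≤
      (MvPolynomial.aeval (R := F)
        (fun v : Option (N × N) => v.elim u fun q => M q.1 q.2)).range.toSubring := by
    rw [Subring.closure_le]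
    rintro y ((⟨a, rfl⟩ | ⟨q, rfl⟩) | hy)
    · exact ⟨MvPolynomial.C a, MvPolynomial.aeval_C _ _⟩
    · exact ⟨MvPolynomial.X (some q), MvPolynomial.aeval_X _ _⟩
    · rw [Set.mem_singleton_iff] at hy
      rw [hy]
      exact ⟨MvPolynomial.X none, MvPolynomial.aeval_X _ _⟩
  obtain ⟨p, rfl⟩ := hle hn
  exact aeval_eq_zero_of_sigma_stable σ hfix ι hι (s.sigma : S →+* S) hs σF hσF jC hjC M hu B' hM
    I hI hne p hx

/-! ### Finite orbits of σ and algebraicity over the constants -/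

namespace SDStruct

theorem iterate_algebraMap {k L : Type*} [CommRing k] [CommRing L] {sk : SDStruct k}
    {sL : SDStruct L} {f : k →+* L} (h : IsSDHom sk sL f) (n : ℕ) (a : k) :
    sL.sigma^[n] (f a) = f (sk.sigma^[n] a) := by
  induction n generalizing a with
  | zero => rfl
  | succ n ih => rw [Function.iterate_succ_apply, ← h.sigma, ih, Function.iterate_succ_apply]

/-- The `n`-th iterate of `σ`, as a ring homomorphism. -/
def iter {R : Type*} [CommRing R] (s : SDStruct R) (n : ℕ) : R →+* R :=
  ((s.pow n).sigma : R →+* R)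

@[simp] theorem iter_apply {R : Type*} [CommRing R] (s : SDStruct R) (n : ℕ) (x : R) :
    s.iter n x = s.sigma^[n] x :=
  s.pow_sigma_apply n x

section Field

variable {K : Type*} [Field K] (s : SDStruct K)

/-- The orbits of `σ` on elements that are algebraic over the constants are finite. -/
theorem exists_iterate_eq_of_isIntegral {x : K} (hx : IsIntegral s.const x) :
    ∃ n, 0 < n ∧ s.sigma^[n] x = x := by
  let p := minpoly s.const x
  let σ : K →ₐ[s.const] K := { (s.sigma : K →+* K) with commutes' := fun c => c.2 }
  have hroot : ∀ n, s.sigma^[n] x ∈ p.rootSet K := by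
    intro n
    rw [Polynomial.mem_rootSet]
    refine ⟨minpoly.ne_zero hx, ?_⟩
    induction n with
    | zero => exact minpoly.aeval _ _
    | succ n ih =>
      rw [Function.iterate_succ_apply']
      change Polynomial.aeval (σ (s.sigma^[n] x)) p = 0
      rw [Polynomial.aeval_algHom_apply, ih, map_zero]
  -- The orbit stays among the finitely many roots of p, so two iterates coincide; injectivity of σ
  -- cancels the common part.
  have hinj : ¬ Function.Injective fun n : ℕ => (⟨_, hroot n⟩ : p.rootSet K) := by
    intro h
    have : Finite (p.rootSet K) := p.rootSet_finite K
    exact not_injective_infinite_finite _ h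
  rw [Function.not_injective_iff] at hinj
  obtain ⟨i, j, hij, hne⟩ := hinj
  have hij' : s.sigma^[i] x = s.sigma^[j] x := congrArg Subtype.val hij
  have key : ∀ i j : ℕ, i < j → s.sigma^[i] x = s.sigma^[j] x →
      ∃ n, 0 < n ∧ s.sigma^[n] x = x := by
    intro i j hlt h
    refine ⟨j - i, by omega, ?_⟩
    apply s.sigma.injective.iterate i
    rw [← Function.iterate_add_apply, h]
    congr 2
    omega
  rcases lt_or_gt_of_ne hne with h | h
  · exact key i j h hij'
  · exact key j i h hij'.symm

open Polynomial in
/-- Elements with a finite orbit under `σ` are algebraic over the constants. -/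
theorem isIntegral_of_iterate_eq {x : K} {n : ℕ} (hn : 0 < n) (hx : s.sigma^[n] x = x) :
    IsIntegral s.const x := by
  -- σ permutes the factors of the orbit polynomial cyclically, so its coefficients are constants.
  let p : K[X] := ∏ i ∈ Finset.range n, (X - C (s.sigma^[i] x))
  have hp : p.map (s.sigma : K →+* K) = p := by
    have h1 : p.map (s.sigma : K →+* K) =
        ∏ i ∈ Finset.range n, (X - C (s.sigma^[i + 1] x)) := by
      simp only [p, Polynomial.map_prod, Polynomial.map_sub, map_X, map_C]
      refine Finset.prod_congr rfl fun i _ => ?_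
      rw [Function.iterate_succ_apply']
      rfl
    rw [h1]
    obtain ⟨r, rfl⟩ : ∃ r, n = r + 1 := ⟨n - 1, by omega⟩
    rw [Finset.prod_range_succ, hx]
    exact (Finset.prod_range_succ' (fun i => X - C (s.sigma^[i] x)) r).symm
  have hlift : p ∈ lifts (algebraMap s.const K) := by
    rw [lifts_iff_coeff_lifts]
    intro i
    have h2 := congrArg (fun q => q.coeff i) hp
    simp only [coeff_map] at h2
    exact ⟨⟨p.coeff i, h2⟩, rfl⟩
  have hmonic : p.Monic := monic_prod_of_monic _ _ fun i _ => monic_X_sub_C _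
  obtain ⟨q, hq, -, hqm⟩ := lifts_and_natDegree_eq_and_monic hlift hmonic
  refine ⟨q, hqm, ?_⟩
  rw [← eval_map, hq]
  simp only [p, eval_prod]
  exact Finset.prod_eq_zero (Finset.mem_range.2 hn) (by simp)

theorem mem_const_of_isIntegral (hs : s.algConst = ⊥) {x : K} (hx : IsIntegral s.const x) :
    x ∈ s.const := by
  have h1 : x ∈ s.algConst := hx
  rw [hs, IntermediateField.mem_bot] at h1
  obtain ⟨c, rfl⟩ := h1
  exact c.2

end Field

end SDStruct

/-! ### Linear disjointness of k and the constants of L -/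

section Constants

variable {k L : Type*} [Field k] [Field L] [Algebra k L] {sk : SDStruct k} {sL : SDStruct L}

/-- The fields `k` and `L^{σⁿ}` are linearly disjoint over `C_k = k^{σⁿ}`; so an element of
`k C_L` fixed by `σⁿ` is a constant. -/
theorem mem_const_of_mem_constCompositum (h : IsSDHom sk sL (algebraMap k L))
    (hk : sk.algConst = ⊥) {n : ℕ} (hn : 0 < n) {x : L} (hx : x ∈ constCompositum k sL)
    (hσ : sL.sigma^[n] x = x) : x ∈ sL.const := by
  by_contra hne
  let K₀ := sk.const
  obtain ⟨a, ha, b, hb, rfl⟩ : ∃ a ∈ Algebra.adjoin k (sL.const : Set L),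
      ∃ b ∈ Algebra.adjoin k (sL.const : Set L), x = a / b := by
    rw [← IntermediateField.mem_adjoin_iff_div]
    have : constCompositum k sL ≤
        (IntermediateField.adjoin k (sL.const : Set L)).toSubfield := by
      refine sup_le ?_ (fun c hc => IntermediateField.subset_adjoin _ _ hc)
      rintro _ ⟨c, rfl⟩
      exact IntermediateField.algebraMap_mem _ c
    exact this hx
  set x := a / b with hxdef
  have hb0 : b ≠ 0 := by
    rintro rfl
    rw [div_zero] at hxdef
    exact hne (hxdef ▸ zero_mem _)
  have hx0 : x ≠ 0 := fun h0 => hne (h0 ▸ zero_mem _)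
  have hcl : (Submonoid.closure (sL.const : Set L) : Set L) = sL.const :=
    congrArg SetLike.coe (Submonoid.closure_eq sL.const.toSubmonoid)
  rw [← Subalgebra.mem_toSubmodule, Algebra.adjoin_eq_span, hcl] at ha hb
  -- Here t is a basis of C_L over C_k. If x is not in C_L, then C_L ∩ xC_L = 0, so t together with
  -- xt is independent over C_k. Independence over k then contradicts a = xb, which lies in the
  -- k-spans of both t and xt.
  obtain ⟨t, ht, hspan, hli⟩ := exists_linearIndependent K₀ (sL.const : Set L)
  have hK₀c : ∀ c : K₀, algebraMap K₀ L c ∈ sL.const := fun c => by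
    rw [SDStruct.mem_const]
    change sL.sigma (algebraMap k L c) = algebraMap k L c
    rw [← h.sigma, c.2]
  have hspanC : ∀ y ∈ Submodule.span K₀ (sL.const : Set L), y ∈ sL.const := by
    intro y hy
    induction hy using Submodule.span_induction with
    | mem y hy => exact hy
    | zero => exact zero_mem _
    | add y z _ _ hy hz => exact add_mem hy hz
    | smul c y _ hy =>
      rw [Algebra.smul_def]
      exact mul_mem (hK₀c c) hy
  have hspank : Submodule.span k (sL.const : Set L) = Submodule.span k t := by
    refine le_antisymm ?_ (Submodule.span_mono ht)
    rw [Submodule.span_le]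
    intro c hc
    have h1 : c ∈ Submodule.span K₀ t := hspan ▸ Submodule.subset_span hc
    exact Submodule.span_le_restrictScalars K₀ k t h1
  rw [hspank] at ha hb
  let v : t → L := Subtype.val
  let w : t → L := fun i => x * i
  have hwr : Set.range w = (fun z => x * z) '' t := (Set.image_eq_range (fun z => x * z) t).symm
  have hw : LinearIndependent K₀ w := by
    have h1 := hli.map' (LinearMap.mulLeft K₀ x)
      (LinearMap.ker_eq_bot.2 (mul_right_injective₀ hx0))
    exact h1
  have hdisj : Disjoint (Submodule.span K₀ (Set.range v)) (Submodule.span K₀ (Set.range w)) := by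
    rw [Submodule.disjoint_def]
    intro y hy1 hy2
    by_contra hy0
    have hy1' : y ∈ sL.const := by
      rw [Subtype.range_coe, hspan] at hy1
      exact hspanC y hy1
    have hy2' : x⁻¹ * y ∈ sL.const := by
      have h1 : y ∈ (Submodule.span K₀ t).map (LinearMap.mulLeft K₀ x) := by
        rw [Submodule.map_span]
        rwa [hwr] at hy2
      obtain ⟨z, hz, rfl⟩ := h1
      rw [LinearMap.mulLeft_apply, inv_mul_cancel_left₀ hx0]
      rw [hspan] at hz
      exact hspanC z hz
    apply hne
    have h2 : x = y * (x⁻¹ * y)⁻¹ := by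
      field_simp
    rw [h2]
    exact mul_mem hy1' (inv_mem hy2')
  have hfixed : ∀ i : t ⊕ t, sL.iter n (Sum.elim v w i) = Sum.elim v w i := by
    have h1 : ∀ c ∈ sL.const, sL.sigma^[n] c = c := fun c hc => Function.iterate_fixed hc n
    rintro (i | i)
    · rw [SDStruct.iter_apply]
      exact h1 _ (ht i.2)
    · change sL.iter n (x * i) = x * i
      rw [map_mul, SDStruct.iter_apply, SDStruct.iter_apply, hσ, h1 _ (ht i.2)]
  -- The hypothesis C_k = D_k enters here: an element of k fixed by σⁿ is algebraic over C_k and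
  -- therefore belongs to C_k.
  have hlik := linearIndependent_of_fixed (sL.iter n) (sk.sigma^[n])
    (fun c => by rw [SDStruct.iter_apply, SDStruct.iterate_algebraMap h])
    (fun c hc => ⟨⟨c, sk.mem_const_of_isIntegral hk (sk.isIntegral_of_iterate_eq hn hc)⟩, rfl⟩)
    hfixed (hli.sum_type hw hdisj)
  rw [linearIndependent_sum] at hlik
  have hd := hlik.2.2
  rw [Submodule.disjoint_def] at hd
  have ha1 : a = x * b := by rw [hxdef, div_mul_cancel₀ _ hb0]
  have ha0 : a = 0 := by
    refine hd a ?_ ?_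
    · change a ∈ Submodule.span k (Set.range v)
      rwa [Subtype.range_coe]
    · have h1 : a ∈ (Submodule.span k t).map (LinearMap.mulLeft k x) := ⟨b, hb, ha1.symm⟩
      rw [Submodule.map_span] at h1
      change a ∈ Submodule.span k (Set.range w)
      rw [hwr]
      exact h1
  exact hx0 (by rw [hxdef, ha0, zero_div])

/-- An element algebraic over the constants has a finite orbit, so some σⁿ with n > 0 fixes it. In
other words, C_L is algebraically closed in kC_L. -/
theorem mem_const_of_isIntegral_of_mem_constCompositum (h : IsSDHom sk sL (algebraMap k L))
    (hk : sk.algConst = ⊥) {x : L} (hx : x ∈ constCompositum k sL)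
    (hint : IsIntegral sL.const x) : x ∈ sL.const := by
  obtain ⟨n, hn, hσ⟩ := sL.exists_iterate_eq_of_isIntegral hint
  exact mem_const_of_mem_constCompositum h hk hn hx hσ

end Constants

/-! ### Derivations on algebraic elements -/

open Polynomial in
/-- The derivative of a value of a polynomial. -/
theorem Derivation.apply_eval₂_eq {A B : Type*} [CommRing A] [CommRing B] (f : A →+* B)
    (dA : Derivation ℤ A A) (dB : Derivation ℤ B B) (h : ∀ a, dB (f a) = f (dA a)) (x : B)
    (p : A[X]) :
    dB (eval₂ f x p) = eval₂ f x (p.sum fun i a => C (dA a) * X ^ i) +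
      eval₂ f x (derivative p) * dB x := by
  induction p using Polynomial.induction_on' with
  | add p q hp hq =>
    rw [sum_add_index _ _ _ (fun i => by simp) (fun i a b => by rw [map_add, map_add, add_mul]),
      eval₂_add, map_add, hp, hq, eval₂_add, derivative_add, eval₂_add]
    ring
  | monomial n a =>
    rw [sum_monomial_index _ _ (by simp), eval₂_monomial, Derivation.leibniz, h,
      Derivation.leibniz_pow, derivative_monomial, eval₂_monomial, eval₂_mul, eval₂_C, eval₂_pow,
      eval₂_X]
    simp only [smul_eq_mul, nsmul_eq_mul, map_mul, _root_.map_natCast]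
    ring

/-- A derivation extends in at most one way to an algebraic extension. -/
theorem Derivation.algebraMap_eq_of_isAlgebraic {K D C : Type*} [Field K] [CharZero K] [Field D]
    [Field C] [Algebra K D] [Algebra K C] [Algebra D C] [IsScalarTower K D C]
    (dK : Derivation ℤ K K) (dD : Derivation ℤ D D) (dC : Derivation ℤ C C)
    (hD : ∀ a, dD (algebraMap K D a) = algebraMap K D (dK a))
    (hC : ∀ a, dC (algebraMap K C a) = algebraMap K C (dK a)) {x : D} (hx : IsIntegral K x) :
    dC (algebraMap D C x) = algebraMap D C (dD x) := by
  let p := minpoly K x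
  let q := p.sum fun i a => Polynomial.C (dK a) * Polynomial.X ^ i
  -- Differentiating p(x) = 0 in D and in C gives the same linear equation for both candidates, and
  -- its coefficient p'(x) is non-zero by separability.
  have h1 := Derivation.apply_eval₂_eq (algebraMap K D) dK dD hD x p
  have h2 := Derivation.apply_eval₂_eq (algebraMap K C) dK dC hC (algebraMap D C x) p
  have hp : Polynomial.eval₂ (algebraMap K D) x p = 0 := minpoly.aeval K x
  have hmap : ∀ r : Polynomial K, Polynomial.eval₂ (algebraMap K C) (algebraMap D C x) r =
      algebraMap D C (Polynomial.eval₂ (algebraMap K D) x r) := fun r => by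
    rw [Polynomial.hom_eval₂, ← IsScalarTower.algebraMap_eq]
  rw [hmap, hmap, hmap, hp, map_zero, map_zero] at h2
  rw [hp, map_zero] at h1
  have h3 := congrArg (algebraMap D C) h1
  rw [map_add, map_mul, map_zero] at h3
  have hsep : Polynomial.aeval x (Polynomial.derivative p) ≠ 0 :=
    (minpoly.irreducible hx).separable.aeval_derivative_ne_zero (minpoly.aeval K x)
  refine mul_left_cancel₀ ((map_ne_zero (algebraMap D C)).2 hsep) ?_
  change algebraMap D C (Polynomial.eval₂ (algebraMap K D) x (Polynomial.derivative p)) * _ =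
    algebraMap D C (Polynomial.eval₂ (algebraMap K D) x (Polynomial.derivative p)) * _
  linear_combination h3 - h2

/-- Differentiating p(x) = 0, where p is the minimal polynomial over the constants, gives δx =
-p^δ(x)/p'(x), with p^δ obtained by applying δ to the coefficients. -/
theorem SDStruct.delta_mem_algConst {L : Type*} [Field L] [CharZero L] (s : SDStruct L) {x : L}
    (hx : x ∈ s.algConst) : s.delta x ∈ s.algConst := by
  let p := minpoly s.const x
  let q := p.sum fun i a => Polynomial.C (s.constSD.delta a) * Polynomial.X ^ i
  have h1 := Derivation.apply_eval₂_eq (algebraMap s.const L) s.constSD.delta s.delta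
    (fun _ => rfl) x p
  have hp : Polynomial.eval₂ (algebraMap s.const L) x p = 0 := minpoly.aeval s.const x
  rw [hp, map_zero] at h1
  have hsep : Polynomial.aeval x (Polynomial.derivative p) ≠ 0 :=
    (minpoly.irreducible (show IsIntegral s.const x from hx)).separable.aeval_derivative_ne_zero
      (minpoly.aeval s.const x)
  have hmem : ∀ r : Polynomial s.const, Polynomial.aeval x r ∈ s.algConst := fun r =>
    Subalgebra.mem_toSubmodule _ |>.1 (Polynomial.aeval_mem_adjoin_singleton s.const x |>
      fun h => Algebra.adjoin_le (S := s.algConst.toSubalgebra) (Set.singleton_subset_iff.2 hx) h)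
  have h2 : s.delta x = -(Polynomial.aeval x q) / Polynomial.aeval x (Polynomial.derivative p) := by
    rw [eq_div_iff hsep]
    rw [Polynomial.aeval_def, Polynomial.aeval_def]
    linear_combination -h1
  rw [h2]
  exact div_mem (neg_mem (hmem _)) (hmem _)

/-! ### Finiteness of D_L over C_L -/

section Finiteness

variable {k L : Type*} [Field k] [Field L] [Algebra k L] {sk : SDStruct k} {sL : SDStruct L}

theorem algebraMap_mem_constCompositum (a : k) : algebraMap k L a ∈ constCompositum k sL :=
  (le_sup_left : (algebraMap k L).fieldRange ≤ constCompositum k sL) ⟨a, rfl⟩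

theorem const_le_constCompositum : sL.const ≤ constCompositum k sL := le_sup_right

theorem sigma_mem_constCompositum (h : IsSDHom sk sL (algebraMap k L)) :
    ∀ x ∈ constCompositum k sL, sL.sigma x ∈ constCompositum k sL :=
  IsGenericSolutionField.map_constCompositum (f := (sL.sigma : L →+* L)) (g := sk.sigma)
    (fun x => (h.sigma x).symm) fun _ hx => hx

theorem sigma_symm_mem_constCompositum (h : IsSDHom sk sL (algebraMap k L)) :
    ∀ x ∈ constCompositum k sL, sL.sigma.symm x ∈ constCompositum k sL :=
  IsGenericSolutionField.map_constCompositum (f := (sL.sigma.symm : L →+* L)) (g := sk.sigma.symm)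
    (fun x => by
      change sL.sigma.symm _ = _
      rw [RingEquiv.symm_apply_eq, ← h.sigma, RingEquiv.apply_symm_apply])
    fun x hx => by
      change sL.sigma.symm x = x
      rw [RingEquiv.symm_apply_eq]
      exact hx.symm

theorem delta_mem_constCompositum (h : IsSDHom sk sL (algebraMap k L)) :
    ∀ x ∈ constCompositum k sL, sL.delta x ∈ constCompositum k sL := by
  let W : Subfield L :=
    { carrier := {x | x ∈ constCompositum k sL ∧ sL.delta x ∈ constCompositum k sL}
      mul_mem' := fun {x y} hx hy => ⟨mul_mem hx.1 hy.1, by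
        rw [Derivation.leibniz, smul_eq_mul, smul_eq_mul]
        exact add_mem (mul_mem hx.1 hy.2) (mul_mem hy.1 hx.2)⟩
      one_mem' := ⟨one_mem _, by simp⟩
      add_mem' := fun {x y} hx hy => ⟨add_mem hx.1 hy.1, by
        rw [map_add]; exact add_mem hx.2 hy.2⟩
      zero_mem' := ⟨zero_mem _, by simp⟩
      neg_mem' := fun {x} hx => ⟨neg_mem hx.1, by rw [map_neg]; exact neg_mem hx.2⟩
      inv_mem' := fun x hx => ⟨inv_mem hx.1, by
        rw [Derivation.leibniz_inv, smul_eq_mul]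
        exact mul_mem (neg_mem (pow_mem (inv_mem hx.1) 2)) hx.2⟩ }
  have hle : constCompositum k sL ≤ W := by
    refine sup_le ?_ fun x hx => ⟨const_le_constCompositum hx, const_le_constCompositum ?_⟩
    · rintro _ ⟨x, rfl⟩
      refine ⟨algebraMap_mem_constCompositum x, ?_⟩
      rw [← h.delta]
      exact algebraMap_mem_constCompositum _
    · rw [SDStruct.mem_const] at hx ⊢
      rw [sL.comm, hx]
  exact fun x hx => (hle hx).2

/-- By Leibniz' rule every term of δⁿ(ax) other than aδⁿx contains only lower derivatives of x. It
follows that σ(δⁿX) agrees with AδⁿX up to lower derivatives of X. -/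
theorem iterate_delta_mul_sub_mem (h : IsSDHom sk sL (algebraMap k L)) (K : Subfield L)
    (hK : ∀ a, algebraMap k L a ∈ K) (n : ℕ) (a : k) (x : L)
    (hx : ∀ j < n, sL.delta^[j] x ∈ K) :
    sL.delta^[n] (algebraMap k L a * x) - algebraMap k L a * sL.delta^[n] x ∈ K := by
  induction n generalizing a x with
  | zero => simp
  | succ n ih =>
    have hadd : ∀ y z, sL.delta^[n] (y + z) = sL.delta^[n] y + sL.delta^[n] z := by
      intro y z
      exact iterate_map_add sL.delta n y z
    rw [Function.iterate_succ_apply, Derivation.leibniz, smul_eq_mul, smul_eq_mul, hadd,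
      ← h.delta, mul_comm x]
    have h1 := ih a (sL.delta x) fun j hj => by
      have := hx (j + 1) (by omega)
      rwa [Function.iterate_succ_apply] at this
    have h2 := ih (sk.delta a) x fun j hj => hx j (by omega)
    have h3 := mul_mem (hK (sk.delta a)) (hx n (by omega))
    rw [Function.iterate_succ_apply]
    have := add_mem h1 (add_mem h2 h3)
    ring_nf at this ⊢
    exact this

theorem IsGenericSolutionField.det_ne_zero {m : ℕ} {A : GL (Fin m) k}
    {X : Matrix (Fin m) (Fin m) L} (h : IsGenericSolutionField sk sL A X) : X.det ≠ 0 := by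
  have h1 : AlgebraicIndependent k fun p : Fin m × Fin m => X p.1 p.2 := by
    have := h.indeterminates.comp (fun p : Fin m × Fin m => (0, p)) fun p q hpq =>
      (Prod.ext_iff.1 hpq).2
    exact this
  have h2 : X.det = MvPolynomial.aeval (fun p : Fin m × Fin m => X p.1 p.2)
      (Matrix.mvPolynomialX (Fin m) (Fin m) k).det := by
    rw [AlgHom.map_det]
    congr 1
    ext i j
    simp [Matrix.mvPolynomialX]
  rw [h2]
  intro h0
  exact Matrix.det_mvPolynomialX_ne_zero (Fin m) k
    ((injective_iff_map_eq_zero _).1 h1 _ h0)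

theorem exists_inv_mem_of_mem {m : ℕ} (K : Subfield L) (M : Matrix (Fin m) (Fin m) L)
    (hM : ∀ i j, M i j ∈ K) : ∀ i j, M⁻¹ i j ∈ K := by
  intro i j
  let M' : Matrix (Fin m) (Fin m) K := Matrix.of fun i j => ⟨M i j, hM i j⟩
  have hM' : K.subtype.mapMatrix M' = M := rfl
  have h1 : M⁻¹ = K.subtype.mapMatrix M'⁻¹ := by
    rw [Matrix.inv_def, Matrix.inv_def, ← hM', ← RingHom.map_det, Ring.inverse_eq_inv',
      Ring.inverse_eq_inv', ← RingHom.map_adjugate, ← map_inv₀]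
    ext i j
    simp
  rw [h1]
  exact (M'⁻¹ i j).2

/-- The subfield `k C_L (X)` is algebraically closed in `L`. -/
theorem IsGenericSolutionField.mem_adjoin_of_isIntegral [CharZero L] {m : ℕ} {A : GL (Fin m) k}
    {X : Matrix (Fin m) (Fin m) L} (h : IsGenericSolutionField sk sL A X) {y : L}
    (hy : IsIntegral sL.const y) :
    y ∈ IntermediateField.adjoin (constCompositum k sL)
      (Set.range fun p : Fin m × Fin m => X p.1 p.2) := by
  let K₀ : Subfield L := (IntermediateField.adjoin (constCompositum k sL)
      (Set.range fun p : Fin m × Fin m => X p.1 p.2)).toSubfield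
  have hF : ∀ x ∈ constCompositum k sL, x ∈ K₀ := fun x hx =>
    IntermediateField.algebraMap_mem _ (⟨x, hx⟩ : constCompositum k sL)
  have hX : ∀ i j, X i j ∈ K₀ := fun i j => IntermediateField.subset_adjoin _ _ ⟨(i, j), rfl⟩
  have hσX : ∀ i j, sL.sigma (X i j) = ∑ a, algebraMap k L (A.1 i a) * X a j := fun i j =>
    congrFun (congrFun h.sigma_X i) j
  let : Algebra sL.const K₀ :=
    (Subfield.inclusion (fun x hx => hF x (const_le_constCompositum hx) :
      sL.const ≤ K₀)).toAlgebra
  have : IsScalarTower sL.const K₀ L := IsScalarTower.of_algebraMap_eq fun _ => rfl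
  refine mem_of_isIntegral_of_forall_sub_mem (sL.sigma : L →+* L) K₀ ?_
    (fun x hx => hF x (const_le_constCompositum hx)) ?_ (hy.tower_top (A := K₀))
  · have h1 : K₀ ≤ K₀.comap (sL.sigma : L →+* L) := by
      have h2 : K₀ = Subfield.closure (Set.range (algebraMap (constCompositum k sL) L) ∪
          Set.range fun p : Fin m × Fin m => X p.1 p.2) := rfl
      conv_lhs => rw [h2]
      rw [Subfield.closure_le]
      rintro x (⟨a, rfl⟩ | ⟨p, rfl⟩)
      · exact hF _ (sigma_mem_constCompositum h.isSDHom _ a.2)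
      · change sL.sigma (X p.1 p.2) ∈ K₀
        rw [hσX]
        exact sum_mem fun a _ => mul_mem (hF _ (algebraMap_mem_constCompositum _)) (hX _ _)
    exact h1
  · intro K hK₀K hw
    have hk : ∀ a : k, algebraMap k L a ∈ K := fun a =>
      hK₀K (hF _ (algebraMap_mem_constCompositum a))
    have hXK : ∀ i j, X i j ∈ K := fun i j => hK₀K (hX i j)
    -- For Y = δⁿX one has σY = AY + N, where the entries of N lie in K by induction. Then W = X⁻¹Y
    -- satisfies σW - W = X⁻¹A⁻¹N, so W, and with it Y = XW, has entries in K.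
    have hδ : ∀ n, ∀ i j, sL.delta^[n] (X i j) ∈ K := by
      intro n
      induction n using Nat.strong_induction_on with
      | _ n ih =>
        let Y : Matrix (Fin m) (Fin m) L := X.map (sL.delta^[n])
        let AL : Matrix (Fin m) (Fin m) L := A.1.map (algebraMap k L)
        let N : Matrix (Fin m) (Fin m) L := Y.map sL.sigma - AL * Y
        have hN : ∀ i j, N i j ∈ K := by
          intro i j
          have hcomm : ∀ x, sL.sigma (sL.delta^[n] x) = sL.delta^[n] (sL.sigma x) :=
            fun x => Function.Commute.iterate_right (f := sL.sigma) (g := sL.delta) sL.comm n x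
          have hNij : N i j = ∑ a, (sL.delta^[n] (algebraMap k L (A.1 i a) * X a j) -
              algebraMap k L (A.1 i a) * sL.delta^[n] (X a j)) := by
            simp only [N, Matrix.sub_apply, Matrix.map_apply, Matrix.mul_apply, Y, AL]
            rw [hcomm, hσX, Finset.sum_sub_distrib]
            congr 1
            induction (Finset.univ : Finset (Fin m)) using Finset.cons_induction with
            | empty => simp [iterate_map_zero]
            | cons a t ha hh => rw [Finset.sum_cons, Finset.sum_cons, iterate_map_add, hh]
          rw [hNij]
          exact sum_mem fun a _ => iterate_delta_mul_sub_mem h.isSDHom K hk n _ _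
            fun l hl => ih l hl a j
        have hXdet : IsUnit X.det := isUnit_iff_ne_zero.2 h.det_ne_zero
        have hAdet : IsUnit AL.det := by
          have : AL.det = algebraMap k L A.1.det := by rw [RingHom.map_det]; rfl
          rw [this]
          exact (A.isUnit.map Matrix.detMonoidHom).map (algebraMap k L)
        have hXinv : (X⁻¹).map sL.sigma = X⁻¹ * AL⁻¹ := by
          rw [← Matrix.mul_inv_rev]
          symm
          apply Matrix.inv_eq_left_inv
          rw [← h.sigma_X]
          have := congrArg (fun M => M.map (sL.sigma : L →+* L)) (Matrix.nonsing_inv_mul X hXdet)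
          simp only [Matrix.map_mul] at this
          refine this.trans ?_
          ext i j
          simp [Matrix.one_apply, apply_ite]
        let W : Matrix (Fin m) (Fin m) L := X⁻¹ * Y
        have hWσ : W.map sL.sigma = W + X⁻¹ * (AL⁻¹ * N) := by
          have h1 : W.map sL.sigma = (X⁻¹).map sL.sigma * Y.map sL.sigma :=
            Matrix.map_mul (f := (sL.sigma : L →+* L))
          have h2 : Y.map sL.sigma = AL * Y + N := by simp [N]
          rw [h1, hXinv, h2, mul_add, ← mul_assoc, mul_assoc (X⁻¹), Matrix.nonsing_inv_mul _ hAdet,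
            mul_one, mul_assoc (X⁻¹)]
        have hW : ∀ i j, W i j ∈ K := by
          intro i j
          apply hw
          have h1 : sL.sigma (W i j) = W i j + (X⁻¹ * (AL⁻¹ * N)) i j :=
            congrFun (congrFun hWσ i) j
          change sL.sigma (W i j) - W i j ∈ K
          rw [h1, add_sub_cancel_left, Matrix.mul_apply]
          refine sum_mem fun a _ => mul_mem (exists_inv_mem_of_mem K X hXK _ _) ?_
          rw [Matrix.mul_apply]
          exact sum_mem fun b _ => mul_mem
            (exists_inv_mem_of_mem K AL (fun _ _ => hk _) _ _) (hN _ _)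
        intro i j
        have h1 : Y = X * W := by
          rw [← mul_assoc, Matrix.mul_nonsing_inv _ hXdet, one_mul]
        change Y i j ∈ K
        rw [h1, Matrix.mul_apply]
        exact sum_mem fun a _ => mul_mem (hXK _ _) (hW _ _)
    rw [eq_top_iff]
    intro x _
    let K' : IntermediateField k L := { K with algebraMap_mem' := hk }
    have h1 : IntermediateField.adjoin k
        (Set.range fun p : ℕ × Fin m × Fin m => sL.delta^[p.1] (X p.2.1 p.2.2)) ≤ K' := by
      rw [IntermediateField.adjoin_le_iff]
      rintro _ ⟨p, rfl⟩
      exact hδ _ _ _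
    rw [h.generates] at h1
    exact h1 IntermediateField.mem_top

/-- `D_L` is finite over `C_L`. -/
theorem IsGenericSolutionField.finiteDimensional_algConst [CharZero L] {m : ℕ}
    {A : GL (Fin m) k} {X : Matrix (Fin m) (Fin m) L} (h : IsGenericSolutionField sk sL A X)
    (hk : sk.algConst = ⊥) : FiniteDimensional sL.const sL.algConst := by
  classical
  let F := constCompositum k sL
  -- D_L lies in kC_L(X), so degrees of its elements over kC_L are at most n. They equal the degrees
  -- over C_L, because C_L is algebraically closed in kC_L. A finite subextension of degree greater
  -- than n would have a primitive element violating this bound.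
  obtain ⟨n, hn⟩ := exists_natDegree_minpoly_le_of_mem_adjoin
    (Finset.univ.image fun p : Fin m × Fin m => X p.1 p.2) F
  let : Algebra sL.const F := (Subfield.inclusion const_le_constCompositum).toAlgebra
  have : IsScalarTower sL.const F L := IsScalarTower.of_algebraMap_eq fun _ => rfl
  by_contra hinf
  obtain ⟨M, hM, hlt⟩ := IntermediateField.exists_lt_finrank_of_infinite_dimensional hinf n
  obtain ⟨γ, hγ⟩ := Field.exists_primitive_element sL.const M
  have h1 : Module.finrank sL.const M = (minpoly sL.const γ).natDegree := by
    rw [← IntermediateField.adjoin.finrank (Algebra.IsIntegral.isIntegral γ), hγ,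
      IntermediateField.finrank_top']
  let g : L := ((γ : sL.algConst) : L)
  have h2 : minpoly sL.const g = minpoly sL.const γ :=
    minpoly.algHom_eq ((sL.algConst.val).comp M.val) (RingHom.injective _) γ
  have hg : IsIntegral sL.const g := (γ : sL.algConst).2
  have h3 := hn g (by
    rw [Finset.coe_image, Finset.coe_univ, Set.image_univ]
    exact h.mem_adjoin_of_isIntegral hg) hg.tower_top
  rw [minpoly_eq_map_of_forall_isIntegral (K := sL.const) (E := F) ?_ hg, Polynomial.natDegree_map,
    h2, ← h1] at h3
  · omega
  · intro x hx
    refine ⟨⟨x, ?_⟩, rfl⟩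
    exact mem_const_of_isIntegral_of_mem_constCompositum h.isSDHom hk x.2
      (hx.map (IsScalarTower.toAlgHom sL.const F L))

end Finiteness

/-- If `D_K` is finite over `C_K`, it is generated by an element whose orbit under `σ` has
`[D_K : C_K]` elements. -/
theorem SDStruct.exists_generator_algConst {K : Type*} [Field K] [CharZero K] (s : SDStruct K)
    [FiniteDimensional s.const s.algConst] :
    (∀ d ∈ s.algConst, s.sigma^[Module.finrank s.const s.algConst] d = d) ∧
    ∃ θ ∈ s.algConst, ∀ n, s.sigma^[n] θ = θ → Module.finrank s.const s.algConst ∣ n := by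
  let σ : K ≃ₐ[s.const] K := { s.sigma with commutes' := fun c => c.2 }
  let τ : s.algConst ≃ₐ[s.const] s.algConst := algebraicClosure.algEquivOfAlgEquiv σ
  have hτ : ∀ d, ((τ d : s.algConst) : K) = s.sigma d := fun d => rfl
  have hτn : ∀ n d, (((τ ^ n) d : s.algConst) : K) = s.sigma^[n] d := by
    intro n d
    induction n with
    | zero => rfl
    | succ n ih => rw [pow_succ', AlgEquiv.mul_apply, hτ, ih, Function.iterate_succ_apply']
  -- The fixed field of the group generated by τ is C_K, so by Artin's theorem the order of τ is the
  -- degree. A power of τ fixing a primitive element is the identity, and thus its exponent is a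
  -- multiple of that order.
  have hfix : IntermediateField.fixedField (Subgroup.zpowers τ) = ⊥ := by
    rw [eq_bot_iff]
    intro d hd
    have h1 : τ d = d := hd ⟨τ, Subgroup.mem_zpowers τ⟩
    rw [IntermediateField.mem_bot]
    refine ⟨⟨d, ?_⟩, rfl⟩
    rw [SDStruct.mem_const, ← hτ, h1]
  have hord : orderOf τ = Module.finrank s.const s.algConst := by
    have h1 := IntermediateField.finrank_fixedField_eq_card (Subgroup.zpowers τ)
    rw [Nat.card_zpowers, hfix, IntermediateField.finrank_bot'] at h1
    exact h1.symm
  refine ⟨fun d hd => ?_, ?_⟩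
  · rw [← hord, ← hτn _ ⟨d, hd⟩, pow_orderOf_eq_one]
    rfl
  · obtain ⟨θ, hθ⟩ := Field.exists_primitive_element s.const s.algConst
    refine ⟨θ, θ.2, fun n hn => ?_⟩
    rw [← hord]
    apply orderOf_dvd_of_pow_eq_one
    have h1 : Subgroup.zpowers (τ ^ n) ≤
        MulAction.stabilizer (s.algConst ≃ₐ[s.const] s.algConst) θ := by
      rw [Subgroup.zpowers_le, MulAction.mem_stabilizer_iff]
      exact Subtype.ext ((hτn n θ).trans hn)
    have h2 : (⊤ : IntermediateField s.const s.algConst) ≤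
        IntermediateField.fixedField (Subgroup.zpowers (τ ^ n)) := by
      rw [← hθ, IntermediateField.adjoin_simple_le_iff]
      exact fun g => h1 g.2
    ext d
    exact congrArg Subtype.val
      (h2 (IntermediateField.mem_top (x := d)) ⟨τ ^ n, Subgroup.mem_zpowers _⟩)

/-! ### R ⊗ C and its total ring of fractions -/

/-- Every element of Q becomes an element of S after multiplication by a unit, so a non-zero-divisor
of S is still one in Q, and there it is a unit by `hunit`. -/
theorem isTotalFractionRing_of_injective {S Q : Type*} [CommRing S] [CommRing Q] (ι : S →+* Q)
    (hι : Function.Injective ι) (hden : ∀ z, ∃ a b, IsUnit (ι b) ∧ z * ι b = ι a)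
    (hunit : ∀ y ∈ nonZeroDivisors Q, IsUnit y) : IsTotalFractionRing ι := by
  let : Algebra S Q := ι.toAlgebra
  change IsLocalization (nonZeroDivisors S) Q
  rw [isLocalization_iff]
  refine ⟨fun y => hunit _ ?_, fun z => ?_, fun {x y} hxy => ⟨1, by rw [hι hxy]⟩⟩
  · rw [mem_nonZeroDivisors_iff_right]
    intro z hz
    obtain ⟨a, b, hb, hab⟩ := hden z
    have h1 : a * y.1 = 0 := hι (by
      rw [map_mul, map_zero, ← hab]
      change z * ι y = 0 at hz
      linear_combination ι b * hz)
    rw [(mem_nonZeroDivisors_iff_right.1 y.2) a h1, map_zero] at hab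
    exact (hb.mul_left_eq_zero).1 hab
  · obtain ⟨a, b, hb, hab⟩ := hden z
    refine ⟨(a, ⟨b, ?_⟩), hab⟩
    rw [mem_nonZeroDivisors_iff_right]
    intro x hx
    refine hι ?_
    rw [map_zero]
    refine (hb.mul_left_eq_zero).1 ?_
    rw [← map_mul, hx, map_zero]

/-- L ⊗ C is integral over the field L because C is algebraic over K, and an integral
non-zero-divisor over an artinian ring is a unit. -/
theorem isUnit_tensorProduct_of_mem_nonZeroDivisors {K L C : Type*} [Field K] [Field L] [Field C]
    [Algebra K L] [Algebra K C] [Algebra.IsAlgebraic K C] :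
    ∀ y ∈ nonZeroDivisors (L ⊗[K] C), IsUnit y := by
  intro y hy
  have : Algebra.IsIntegral K C := Algebra.IsAlgebraic.isIntegral
  exact IsArtinianRing.isUnit_of_isIntegral_of_nonZeroDivisor (R := L) (Algebra.IsIntegral.isIntegral y) hy

section PvTensor

variable {k L : Type*} [Field k] [Field L] [Algebra k L] {m : ℕ}

/-- L is generated as a field by k and the derivatives of X, all of which lie in R. -/
theorem exists_div_mem_pvRing {sk : SDStruct k} {sL : SDStruct L} {A : GL (Fin m) k}
    {X : Matrix (Fin m) (Fin m) L} (h : IsGenericSolutionField sk sL A X) (x : L) :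
    ∃ a b : pvRing k sL X, (b : L) ≠ 0 ∧ x * b = a := by
  have hx : x ∈ IntermediateField.adjoin k
    (Set.range fun p : ℕ × Fin m × Fin m => sL.delta^[p.1] (X p.2.1 p.2.2)) := by
    rw [h.generates]; trivial
  let T : Subalgebra k L := 
    { (pvRing k sL X).toSubring with
      algebraMap_mem' := fun a => (toPvRing k sL X a).2 }
  have hle : Algebra.adjoin k
      (Set.range fun p : ℕ × Fin m × Fin m => sL.delta^[p.1] (X p.2.1 p.2.2)) ≤ T := by
    rw [Algebra.adjoin_le_iff]
    rintro _ ⟨⟨n, i, j⟩, rfl⟩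
    change sL.delta^[n] (X i j) ∈ sL.deltaAdjoin _
    induction n with
    | zero => exact sL.subset_deltaAdjoin _ (Or.inl (Or.inr ⟨(i, j), rfl⟩))
    | succ n ih =>
      rw [Function.iterate_succ_apply']
      exact sL.delta_mem_deltaAdjoin _ _ ih
  rw [IntermediateField.mem_adjoin_iff_div] at hx
  obtain ⟨r, hr, s, hs, rfl⟩ := hx
  -- For s = 0 the quotient r / s is 0 by convention.
  by_cases h0 : s = 0
  · exact ⟨0, 1, by simp, by simp [h0]⟩
  · exact ⟨⟨r, hle hr⟩, ⟨s, hle hs⟩, h0, div_mul_cancel₀ _ h0⟩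

variable (sL : SDStruct L) (X : Matrix (Fin m) (Fin m) L) (C : Type*) [Field C]
  [Algebra sL.const C]

variable (k) in
/-- The structure map `R → R ⊗ C`. -/
def pvInl : pvRing k sL X →+* PvTensor k sL X C :=
  (Algebra.TensorProduct.includeLeftRingHom : pvRing k sL X →+* pvRing k sL X ⊗[sL.const] C)

variable (k) in
/-- The structure map `C → R ⊗ C`. -/
def pvInr : C →+* PvTensor k sL X C :=
  ((Algebra.TensorProduct.includeRight : C →ₐ[sL.const] pvRing k sL X ⊗[sL.const] C) :
    C →+* pvRing k sL X ⊗[sL.const] C)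

variable {sL X C}

/-- Products of the two structure maps replace pure tensors, so that σ and δ on `PvTensor` can be
computed on each factor separately. -/
theorem pvTensor_induction {P : PvTensor k sL X C → Prop} (zero : P 0)
    (mul : ∀ r c, P (pvInl k sL X C r * pvInr k sL X C c))
    (add : ∀ x y, P x → P y → P (x + y)) (x : PvTensor k sL X C) : P x := by
  refine TensorProduct.induction_on (R := sL.const) (M := pvRing k sL X) (N := C) x zero
    (fun r c => ?_) add
  have h1 : pvInl k sL X C r * pvInr k sL X C c = (r ⊗ₜ[sL.const] c : pvRing k sL X ⊗[sL.const] C) :=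
    (Algebra.TensorProduct.tmul_mul_tmul (R := sL.const) r 1 (1 : C) c).trans (by
      rw [mul_one, one_mul])
  exact h1 ▸ mul r c

theorem pvInl_algebraMap (c : sL.const) :
    pvInl k sL X C (algebraMap sL.const (pvRing k sL X) c) =
      pvInr k sL X C (algebraMap sL.const C c) := by
  change (algebraMap sL.const (pvRing k sL X) c) ⊗ₜ[sL.const] (1 : C) =
    (1 : pvRing k sL X) ⊗ₜ[sL.const] (algebraMap sL.const C c)
  rw [Algebra.algebraMap_eq_smul_one, Algebra.algebraMap_eq_smul_one, TensorProduct.smul_tmul]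

theorem pvTensorToField_pvInl (r : pvRing k sL X) :
    pvTensorToField k sL X C (pvInl k sL X C r) = (r : L) ⊗ₜ[sL.const] (1 : C) := rfl

theorem pvTensorToField_pvInr (c : C) :
    pvTensorToField k sL X C (pvInr k sL X C c) = (1 : L) ⊗ₜ[sL.const] c := rfl

theorem pvTensorToField_injective : Function.Injective (pvTensorToField k sL X C) :=
  Module.Flat.rTensor_preserves_injective_linearMap (M := C) (pvRing k sL X).val.toLinearMap
    Subtype.val_injective

variable {sk : SDStruct k} {A : GL (Fin m) k} (h : IsGenericSolutionField sk sL A X)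
  {dC : Derivation ℤ C C}
  (hC : IsSDHom sL.constSD (SDStruct.ofDerivation dC) (algebraMap sL.const C))

theorem pvTensorSD_sigma_pvInl (r : pvRing k sL X) :
    (h.pvTensorSD hC).sigma (pvInl k sL X C r) = pvInl k sL X C (h.pvRingSD.sigma r) := rfl

theorem pvTensorSD_sigma_pvInr (c : C) :
    (h.pvTensorSD hC).sigma (pvInr k sL X C c) = pvInr k sL X C c := by
  change (h.pvRingSD.sigma 1) ⊗ₜ[sL.const] c = (1 : pvRing k sL X) ⊗ₜ[sL.const] c
  rw [map_one]

theorem pvTensorSD_delta_pvInl (r : pvRing k sL X) :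
    (h.pvTensorSD hC).delta (pvInl k sL X C r) = pvInl k sL X C (h.pvRingSD.delta r) := by
  change (h.pvRingSD.delta r) ⊗ₜ[sL.const] (1 : C) + r ⊗ₜ[sL.const] (dC 1) =
    (h.pvRingSD.delta r) ⊗ₜ[sL.const] (1 : C)
  rw [Derivation.map_one_eq_zero, TensorProduct.tmul_zero, add_zero]

theorem pvTensorSD_delta_pvInr (c : C) :
    (h.pvTensorSD hC).delta (pvInr k sL X C c) = pvInr k sL X C (dC c) := by
  change (h.pvRingSD.delta 1) ⊗ₜ[sL.const] c + (1 : pvRing k sL X) ⊗ₜ[sL.const] (dC c) =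
    (1 : pvRing k sL X) ⊗ₜ[sL.const] (dC c)
  rw [Derivation.map_one_eq_zero, TensorProduct.zero_tmul, zero_add]

theorem pvTensorToField_isSDHom : IsSDHom (h.pvTensorSD hC)
    (SDStruct.tensor sL.constSD sL (SDStruct.ofDerivation dC) sL.constSD_isSDHom hC)
    (pvTensorToField k sL X C) := by
  constructor
  · intro x
    induction x using pvTensor_induction with
    | zero => simp
    | add x y hx hy => rw [map_add, map_add, hx, hy, map_add, map_add]
    | mul r c =>
      rw [map_mul, map_mul, pvTensorSD_sigma_pvInl, pvTensorSD_sigma_pvInr, map_mul, map_mul,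
        pvTensorToField_pvInl, pvTensorToField_pvInl, pvTensorToField_pvInr]
      congr 1
      change _ = sL.sigma 1 ⊗ₜ[sL.const] c
      rw [map_one]
  · intro x
    induction x using pvTensor_induction with
    | zero => simp
    | add x y hx hy => rw [map_add, map_add, hx, hy, map_add, map_add]
    | mul r c =>
      simp only [Derivation.leibniz, map_mul, map_add, smul_eq_mul, pvTensorSD_delta_pvInl,
        pvTensorSD_delta_pvInr, pvTensorToField_pvInl, pvTensorToField_pvInr]
      congr 2
      · change _ = sL.delta 1 ⊗ₜ[sL.const] c + (1 : L) ⊗ₜ[sL.const] (dC c)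
        rw [Derivation.map_one_eq_zero, TensorProduct.zero_tmul, zero_add]
      · change _ = sL.delta r ⊗ₜ[sL.const] (1 : C) + (r : L) ⊗ₜ[sL.const] (dC 1)
        rw [Derivation.map_one_eq_zero, TensorProduct.tmul_zero, add_zero]
        rfl

/-- Denominators can be chosen in R alone. They become units b ⊗ 1 both in L ⊗ C over C_L and in L ⊗
C over D_L. -/
theorem exists_pvTensorToField_mul_eq (h : IsGenericSolutionField sk sL A X) (z : L ⊗[sL.const] C) :
    ∃ (a : PvTensor k sL X C) (b : pvRing k sL X), (b : L) ≠ 0 ∧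
      z * (b : L) ⊗ₜ[sL.const] (1 : C) = pvTensorToField k sL X C a := by
  induction z with
  | zero => exact ⟨0, 1, by simp, by simp⟩
  | tmul x c =>
    obtain ⟨a, b, hb, hab⟩ := exists_div_mem_pvRing h x
    refine ⟨pvInl k sL X C a * pvInr k sL X C c, b, hb, ?_⟩
    rw [map_mul, pvTensorToField_pvInl, pvTensorToField_pvInr]
    simp [hab]
  | add x y hx hy =>
    obtain ⟨a, b, hb, hab⟩ := hx
    obtain ⟨a', b', hb', hab'⟩ := hy
    refine ⟨a * pvInl k sL X C b' + a' * pvInl k sL X C b, b * b', mul_ne_zero hb hb', ?_⟩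
    have h1 : ((b * b' : pvRing k sL X) : L) ⊗ₜ[sL.const] (1 : C) =
        (b : L) ⊗ₜ[sL.const] (1 : C) * (b' : L) ⊗ₜ[sL.const] (1 : C) := by simp
    rw [map_add, map_mul, map_mul, pvTensorToField_pvInl, pvTensorToField_pvInl, ← hab, ← hab', h1]
    ring

theorem isUnit_tmul_one {K M N : Type*} [Field K] [Field M] [CommRing N] [Algebra K M]
    [Algebra K N] {b : M} (hb : b ≠ 0) : IsUnit (b ⊗ₜ[K] (1 : N)) :=
  (hb.isUnit).map (Algebra.TensorProduct.includeLeftRingHom : M →+* M ⊗[K] N)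

theorem isTotalFractionRing_pvTensorToField (h : IsGenericSolutionField sk sL A X)
    [Algebra.IsAlgebraic sL.const C] :
    IsTotalFractionRing (pvTensorToField k sL X C) := by
  refine isTotalFractionRing_of_injective _ pvTensorToField_injective (fun z => ?_)
    isUnit_tensorProduct_of_mem_nonZeroDivisors
  obtain ⟨a, b, hb, hab⟩ := exists_pvTensorToField_mul_eq h z
  exact ⟨a, pvInl k sL X C b, isUnit_tmul_one hb, hab⟩

end PvTensor

theorem SDStruct.deltaAdjoin_le {R : Type*} [CommRing R] (s : SDStruct R) {T : Set R}
    {U : Subring R} (hT : T ⊆ U) (hU : ∀ x ∈ U, s.delta x ∈ U) : s.deltaAdjoin T ≤ U :=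
  sInf_le ⟨hT, hU⟩

theorem SDStruct.delta_mem_closure {R : Type*} [CommRing R] (s : SDStruct R) {T : Set R}
    (hT : ∀ x ∈ T, s.delta x ∈ Subring.closure T) :
    ∀ x ∈ Subring.closure T, s.delta x ∈ Subring.closure T := by
  intro x hx
  induction hx using Subring.closure_induction with
  | mem x hx => exact hT x hx
  | zero => rw [map_zero]; exact zero_mem _
  | one => rw [Derivation.map_one_eq_zero]; exact zero_mem _
  | add x y _ _ hx hy => rw [map_add]; exact add_mem hx hy
  | neg x _ hx => rw [map_neg]; exact neg_mem hx
  | mul x y hx' hy' hx hy =>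
    rw [Derivation.leibniz, smul_eq_mul, smul_eq_mul]
    exact add_mem (mul_mem hx' hy) (mul_mem hy' hx)

theorem isField_subring_map {A B : Type*} [CommRing A] [CommRing B] [Nontrivial B] (f : A →+* B)
    {T : Subring A} (hT : IsField T) : IsField (T.map f) := by
  let g : T →+* T.map f := (f.comp T.subtype).codRestrict (T.map f) fun x => ⟨x, x.2, rfl⟩
  have hg : Function.Surjective g := by
    rintro ⟨_, x, hx, rfl⟩
    exact ⟨⟨x, hx⟩, rfl⟩
  let := hT.toField
  have hg' : Function.Injective (g : T → T.map f) := RingHom.injective g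
  exact (RingEquiv.ofBijective g ⟨hg', hg⟩).symm.toMulEquiv.isField hT

theorem Ring.inverse_eq_of_mul_eq_one {R : Type*} [CommRing R] {a b : R} (h : a * b = 1) :
    Ring.inverse a = b :=
  Ring.inverse_unit ⟨a, b, h, by rw [mul_comm, h]⟩

/-! ### R ⊗ C as a Picard-Vessiot extension of kC -/

section PvTensor

variable {k L : Type*} [Field k] [Field L] [Algebra k L] {m : ℕ} {sk : SDStruct k}
  {sL : SDStruct L} {A : GL (Fin m) k} {X : Matrix (Fin m) (Fin m) L} {C : Type*} [Field C]
  [Algebra sL.const C] {dC : Derivation ℤ C C}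

variable (k sL X) in
/-- The structure map `k C_L → R`. -/
def pvBase : constCompositum k sL →+* pvRing k sL X :=
  (constCompositum k sL).subtype.codRestrict (pvRing k sL X) fun a =>
    sL.subset_deltaAdjoin _ (Or.inl (Or.inl a.2))

instance : Nontrivial (PvTensor k sL X C) :=
  (pvTensorToField k sL X C).domain_nontrivial

theorem pvInl_pvBase_mem_compositum (a : constCompositum k sL) :
    pvInl k sL X C (pvBase k sL X a) ∈ compositum k sL X C :=
  Subring.subset_closure (Or.inl ⟨_, a.2, rfl⟩)

theorem pvInr_mem_compositum (c : C) : pvInr k sL X C c ∈ compositum k sL X C :=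
  Subring.subset_closure (Or.inr ⟨c, rfl⟩)

theorem compositum_eq_closure : compositum k sL X C = Subring.closure
    (Set.range (fun a => pvInl k sL X C (pvBase k sL X a)) ∪ Set.range (pvInr k sL X C)) := by
  change Subring.closure _ = _
  congr 2
  ext z
  constructor
  · rintro ⟨x, hx, rfl⟩
    exact ⟨⟨x, hx⟩, rfl⟩
  · rintro ⟨a, rfl⟩
    exact ⟨_, a.2, rfl⟩

/-- C_L is algebraically closed in kC_L, so kC_L ⊗ C is a field, and kC is its image in R ⊗ C. -/
theorem isField_compositum [CharZero L] [Algebra.IsAlgebraic sL.const C]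
    (h : IsGenericSolutionField sk sL A X) (hk : sk.algConst = ⊥) :
    IsField (compositum k sL X C) := by
  let : Algebra sL.const (constCompositum k sL) :=
    (Subfield.inclusion const_le_constCompositum).toAlgebra
  have : IsScalarTower sL.const (constCompositum k sL) L :=
    IsScalarTower.of_algebraMap_eq fun _ => rfl
  have hF : IsField (constCompositum k sL ⊗[sL.const] C) := by
    refine isField_tensorProduct_of_forall_isIntegral fun x hx => ?_
    have h1 : IsIntegral sL.const (x : L) :=
      hx.map (IsScalarTower.toAlgHom sL.const (constCompositum k sL) L)
    exact ⟨⟨x, mem_const_of_isIntegral_of_mem_constCompositum h.isSDHom hk x.2 h1⟩, rfl⟩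
  have h0 : ∀ c, ((pvInl k sL X C).comp (pvBase k sL X))
      (algebraMap sL.const (constCompositum k sL) c) =
      pvInr k sL X C (algebraMap sL.const C c) := fun c => by
    rw [← pvInl_algebraMap]
    rfl
  obtain ⟨ψ, hψ⟩ := exists_ringHom_tmul (K := sL.const) _ _ h0
  have h1 : compositum k sL X C = (⊤ : Subring _).map ψ := by
    rw [compositum_eq_closure]
    refine le_antisymm ?_ ?_
    · rw [Subring.closure_le]
      rintro _ (⟨a, rfl⟩ | ⟨c, rfl⟩)
      · exact ⟨a ⊗ₜ 1, trivial, by rw [hψ, map_one, mul_one]; rfl⟩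
      · exact ⟨1 ⊗ₜ c, trivial, by rw [hψ, map_one, one_mul]⟩
    · rintro _ ⟨z, -, rfl⟩
      induction z with
      | zero => rw [map_zero]; exact zero_mem _
      | add x y hx hy => rw [map_add]; exact add_mem hx hy
      | tmul a c =>
        rw [hψ]
        exact mul_mem (Subring.subset_closure (Or.inl ⟨a, rfl⟩))
          (Subring.subset_closure (Or.inr ⟨c, rfl⟩))
  rw [h1]
  exact isField_subring_map ψ (Subring.topEquiv.toMulEquiv.isField hF)

variable (h : IsGenericSolutionField sk sL A X)
  (hC : IsSDHom sL.constSD (SDStruct.ofDerivation dC) (algebraMap sL.const C))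

theorem sigma_mem_compositum : ∀ x ∈ compositum k sL X C,
    (h.pvTensorSD hC).sigma x ∈ compositum k sL X C := by
  have h1 : compositum k sL X C ≤
      (compositum k sL X C).comap ((h.pvTensorSD hC).sigma : _ →+* _) := by
    conv_lhs => rw [compositum_eq_closure]
    rw [Subring.closure_le]
    rintro _ (⟨a, rfl⟩ | ⟨c, rfl⟩)
    · exact pvInl_pvBase_mem_compositum ⟨_, sigma_mem_constCompositum h.isSDHom a a.2⟩
    · change (h.pvTensorSD hC).sigma (pvInr k sL X C c) ∈ compositum k sL X C
      rw [pvTensorSD_sigma_pvInr]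
      exact pvInr_mem_compositum c
  exact h1

theorem sigma_symm_mem_compositum : ∀ x ∈ compositum k sL X C,
    (h.pvTensorSD hC).sigma.symm x ∈ compositum k sL X C := by
  have h1 : compositum k sL X C ≤
      (compositum k sL X C).comap ((h.pvTensorSD hC).sigma.symm : _ →+* _) := by
    conv_lhs => rw [compositum_eq_closure]
    rw [Subring.closure_le]
    rintro _ (⟨a, rfl⟩ | ⟨c, rfl⟩)
    · have h2 : (h.pvTensorSD hC).sigma.symm (pvInl k sL X C (pvBase k sL X a)) =
          pvInl k sL X C (pvBase k sL X
            ⟨_, sigma_symm_mem_constCompositum h.isSDHom a a.2⟩) := by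
        rw [RingEquiv.symm_apply_eq, pvTensorSD_sigma_pvInl]
        congr 1
        exact Subtype.ext (sL.sigma.apply_symm_apply _).symm
      change (h.pvTensorSD hC).sigma.symm (pvInl k sL X C (pvBase k sL X a)) ∈ compositum k sL X C
      rw [h2]
      exact pvInl_pvBase_mem_compositum _
    · change (h.pvTensorSD hC).sigma.symm (pvInr k sL X C c) ∈ compositum k sL X C
      have h2 : (h.pvTensorSD hC).sigma.symm (pvInr k sL X C c) = pvInr k sL X C c := by
        rw [RingEquiv.symm_apply_eq, pvTensorSD_sigma_pvInr]
      rw [h2]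
      exact pvInr_mem_compositum c
  exact h1

theorem delta_mem_compositum : ∀ x ∈ compositum k sL X C,
    (h.pvTensorSD hC).delta x ∈ compositum k sL X C := by
  rw [compositum_eq_closure]
  refine (h.pvTensorSD hC).delta_mem_closure ?_
  rw [← compositum_eq_closure]
  rintro _ (⟨a, rfl⟩ | ⟨c, rfl⟩)
  · change (h.pvTensorSD hC).delta (pvInl k sL X C (pvBase k sL X a)) ∈ compositum k sL X C
    rw [pvTensorSD_delta_pvInl]
    exact pvInl_pvBase_mem_compositum ⟨_, delta_mem_constCompositum h.isSDHom a a.2⟩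
  · rw [pvTensorSD_delta_pvInr]
    exact pvInr_mem_compositum _

theorem toPvTensor_mem_compositum (a : k) : toPvTensor k sL X C a ∈ compositum k sL X C :=
  pvInl_pvBase_mem_compositum ⟨_, algebraMap_mem_constCompositum a⟩

variable (k sL X) in
/-- The matrix `X` with entries in `R`. -/
def pvMatrix : Matrix (Fin m) (Fin m) (pvRing k sL X) :=
  Matrix.of fun i j => ⟨X i j, sL.subset_deltaAdjoin _ (Or.inl (Or.inr ⟨(i, j), rfl⟩))⟩

variable (k sL X C) in
/-- The matrix `X ⊗ 1`. -/
def pvTensorMatrix : Matrix (Fin m) (Fin m) (PvTensor k sL X C) :=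
  (pvMatrix k sL X).map (pvInl k sL X C)

variable (k sL X) in
/-- The inverse determinant of `X` as an element of `R`. -/
def pvDetInv : pvRing k sL X := ⟨X.det⁻¹, sL.subset_deltaAdjoin _ (Or.inr rfl)⟩

theorem pvTensorMatrix_det_mul (h : IsGenericSolutionField sk sL A X) :
    (pvTensorMatrix k sL X C).det * pvInl k sL X C (pvDetInv k sL X) = 1 := by
  have h1 : (pvTensorMatrix k sL X C).det = pvInl k sL X C (pvMatrix k sL X).det := by
    rw [RingHom.map_det]; rfl
  have h2 : ((pvMatrix k sL X).det : L) = X.det := by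
    change (pvRing k sL X).val (pvMatrix k sL X).det = _
    rw [AlgHom.map_det]; rfl
  rw [h1, ← map_mul, ← map_one (pvInl k sL X C)]
  congr 1
  refine Subtype.ext ?_
  change ((pvMatrix k sL X).det : L) * X.det⁻¹ = 1
  rw [h2, mul_inv_cancel₀ h.det_ne_zero]

theorem pvTensorMatrix_map_sigma :
    (pvTensorMatrix k sL X C).map (h.pvTensorSD hC).sigma =
      ((A : Matrix (Fin m) (Fin m) k).map (toPvTensor k sL X C)) * pvTensorMatrix k sL X C := by
  have h1 : ((A : Matrix (Fin m) (Fin m) k).map (toPvTensor k sL X C)) * pvTensorMatrix k sL X C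
      = (((A : Matrix (Fin m) (Fin m) k).map (toPvRing k sL X)) * pvMatrix k sL X).map
        (pvInl k sL X C) := by
    rw [Matrix.map_mul]; rfl
  rw [h1]
  ext i j
  change pvInl k sL X C (h.pvRingSD.sigma (pvMatrix k sL X i j)) = pvInl k sL X C _
  congr 1
  refine Subtype.ext ?_
  have h2 := congrFun (congrFun h.sigma_X i) j
  refine h2.trans ?_
  simp only [Matrix.mul_apply, Matrix.map_apply]
  change _ = (pvRing k sL X).val _
  rw [map_sum]
  rfl

theorem deltaAdjoin_pvTensor_eq_top :
    (h.pvTensorSD hC).deltaAdjoin ((compositum k sL X C : Set (PvTensor k sL X C)) ∪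
      (Set.range fun p : Fin m × Fin m => pvTensorMatrix k sL X C p.1 p.2) ∪
      {Ring.inverse (pvTensorMatrix k sL X C).det}) = ⊤ := by
  rw [Ring.inverse_eq_of_mul_eq_one (pvTensorMatrix_det_mul h)]
  set W := (h.pvTensorSD hC).deltaAdjoin ((compositum k sL X C : Set (PvTensor k sL X C)) ∪
      (Set.range fun p : Fin m × Fin m => pvTensorMatrix k sL X C p.1 p.2) ∪
      {pvInl k sL X C (pvDetInv k sL X)}) with hW
  have hsub := (h.pvTensorSD hC).subset_deltaAdjoin ((compositum k sL X C : Set _) ∪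
      (Set.range fun p : Fin m × Fin m => pvTensorMatrix k sL X C p.1 p.2) ∪
      {pvInl k sL X C (pvDetInv k sL X)})
  rw [← hW] at hsub
  -- The r in R with r ⊗ 1 in W form a δ-stable ring containing the generators of R. The comparison
  -- takes place in L, where R is defined as a generated subring.
  have h1 : sL.deltaAdjoin ((constCompositum k sL : Set L) ∪
      (Set.range fun p : Fin m × Fin m => X p.1 p.2) ∪ {X.det⁻¹}) ≤
      (W.comap (pvInl k sL X C)).map ((pvRing k sL X).val : pvRing k sL X →+* L) := by
    refine sL.deltaAdjoin_le ?_ ?_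
    · rintro x ((hx | ⟨⟨i, j⟩, rfl⟩) | rfl)
      · exact ⟨pvBase k sL X ⟨x, hx⟩, hsub (Or.inl (Or.inl (pvInl_pvBase_mem_compositum _))), rfl⟩
      · exact ⟨pvMatrix k sL X i j, hsub (Or.inl (Or.inr ⟨(i, j), rfl⟩)), rfl⟩
      · exact ⟨pvDetInv k sL X, hsub (Or.inr rfl), rfl⟩
    · rintro _ ⟨r, hr, rfl⟩
      refine ⟨h.pvRingSD.delta r, ?_, rfl⟩
      change pvInl k sL X C (h.pvRingSD.delta r) ∈ W
      rw [← pvTensorSD_delta_pvInl h hC]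
      exact (h.pvTensorSD hC).delta_mem_deltaAdjoin _ _ hr
  rw [eq_top_iff]
  intro x _
  induction x using pvTensor_induction with
  | zero => exact zero_mem _
  | add x y hx hy => exact add_mem (hx trivial) (hy trivial)
  | mul r c =>
    refine mul_mem ?_ (hsub (Or.inl (Or.inl (pvInr_mem_compositum c))))
    obtain ⟨r', hr', hrr'⟩ := h1 r.2
    rwa [← (Subtype.ext hrr' : r' = r)]

/-- Stability under δ is not required of the ideal. This stronger simplicity is what passes to the
summands of a decomposition, and it applies to ideals defined through σ only. -/
theorem pvTensor_eq_bot_or_eq_top [CharZero L] [IsAlgClosure sL.const C] (hk : sk.algConst = ⊥)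
    (I : Ideal (PvTensor k sL X C)) (hI : ∀ x ∈ I, (h.pvTensorSD hC).sigma x ∈ I) :
    I = ⊥ ∨ I = ⊤ := by
  have : IsAlgClosed C := IsAlgClosure.isAlgClosed sL.const
  have : Algebra.IsAlgebraic sL.const C := IsAlgClosure.isAlgebraic
  let : Field (compositum k sL X C) := (isField_compositum h hk).toField
  let : Algebra (compositum k sL X C) (PvTensor k sL X C) :=
    (compositum k sL X C).subtype.toAlgebra
  let σ : L →ₐ[sL.const] L := { (sL.sigma : L →+* L) with commutes' := fun c => c.2 }
  let σF : compositum k sL X C →+* compositum k sL X C :=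
    (((h.pvTensorSD hC).sigma : _ →+* _).comp (compositum k sL X C).subtype).codRestrict _
      fun x => sigma_mem_compositum h hC x x.2
  let jC : C →+* compositum k sL X C :=
    (pvInr k sL X C).codRestrict _ fun c => pvInr_mem_compositum c
  refine eq_bot_or_eq_top_of_sigma_stable σ (fun x hx => ⟨⟨x, hx⟩, rfl⟩)
    (pvTensorToField k sL X C) pvTensorToField_injective (h.pvTensorSD hC) (fun x => ?_) σF
    (fun a => rfl) (d := fun a => ⟨_, delta_mem_compositum h hC a a.2⟩) (fun a => rfl) jC
    (fun c => rfl) (pvTensorMatrix k sL X C)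
    (IsUnit.of_mul_eq_one _ (pvTensorMatrix_det_mul h))
    (Matrix.of fun i j => ⟨_, toPvTensor_mem_compositum (A.1 i j)⟩)
    (pvTensorMatrix_map_sigma h hC) ?_ I hI
  · rw [(pvTensorToField_isSDHom h hC).sigma]
    generalize pvTensorToField k sL X C x = z
    induction z with
    | zero => simp
    | add x y hx hy => rw [map_add, map_add, hx, hy]
    | tmul x c => rfl
  · have := deltaAdjoin_pvTensor_eq_top h hC
    rwa [← Subtype.range_val (s := (compositum k sL X C : Set (PvTensor k sL X C)))] at this

theorem isPicardVessiot_pvTensor [CharZero L] [IsAlgClosure sL.const C] (hk : sk.algConst = ⊥) :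
    IsPicardVessiot (h.pvTensorSD hC) (compositum k sL X C)
      ((A : Matrix (Fin m) (Fin m) k).map (toPvTensor k sL X C)) := by
  have : Algebra.IsAlgebraic sL.const C := IsAlgClosure.isAlgebraic
  refine ⟨isField_compositum h hk, sigma_mem_compositum h hC, sigma_symm_mem_compositum h hC,
    delta_mem_compositum h hC, fun i j => toPvTensor_mem_compositum _, ?_, inferInstance,
    fun I hI _ => pvTensor_eq_bot_or_eq_top h hC hk I hI,
    pvTensorMatrix k sL X C, IsUnit.of_mul_eq_one _ (pvTensorMatrix_det_mul h),
    pvTensorMatrix_map_sigma h hC, deltaAdjoin_pvTensor_eq_top h hC⟩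
  have h1 : IsUnit (A : Matrix (Fin m) (Fin m) k).det :=
    (Matrix.isUnit_iff_isUnit_det _).1 A.isUnit
  have h2 := h1.map (toPvTensor k sL X C)
  rwa [RingHom.map_det] at h2

/-- The elements of `D_L ⊗ 1` belong to the image of `R ⊗ C`. -/
theorem exists_pvTensorToField_eq_tmul_one [CharZero L] [IsAlgClosure sL.const C]
    (h : IsGenericSolutionField sk sL A X)
    (hC : IsSDHom sL.constSD (SDStruct.ofDerivation dC) (algebraMap sL.const C))
    (hk : sk.algConst = ⊥) {d : L} (hd : d ∈ sL.algConst) :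
    ∃ t : PvTensor k sL X C, pvTensorToField k sL X C t = d ⊗ₜ[sL.const] (1 : C) := by
  -- The ideal of common denominators of all conjugates σⁿd. The orbit of d is finite, so a single
  -- non-zero element of R clears all of them and I ≠ 0; σ-simplicity then yields 1 ∈ I.
  let I : Ideal (PvTensor k sL X C) :=
    { carrier := {x | ∀ n, ∃ t, pvTensorToField k sL X C t =
        pvTensorToField k sL X C x * (sL.sigma^[n] d) ⊗ₜ[sL.const] (1 : C)}
      zero_mem' := fun n => ⟨0, by simp⟩
      add_mem' := fun {x y} hx hy n => by
        obtain ⟨t, ht⟩ := hx n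
        obtain ⟨u, hu⟩ := hy n
        exact ⟨t + u, by rw [map_add, map_add, ht, hu, add_mul]⟩
      smul_mem' := fun a x hx n => by
        obtain ⟨t, ht⟩ := hx n
        exact ⟨a * t, by rw [map_mul, ht, smul_eq_mul, map_mul, mul_assoc]⟩ }
  obtain ⟨N, hN, hNd⟩ := sL.exists_iterate_eq_of_isIntegral (x := d) hd
  have hper : ∀ n, sL.sigma^[n] d = sL.sigma^[n % N] d := fun n =>
    (Function.IsPeriodicPt.iterate_mod_apply (f := sL.sigma) (n := N) hNd n).symm
  have hI : ∀ x ∈ I, (h.pvTensorSD hC).sigma x ∈ I := by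
    intro x hx n
    -- σⁿd has to be σ of a conjugate even when n = 0, hence the shift by the period N.
    have h0 : ∃ j, sL.sigma^[n] d = sL.sigma^[j + 1] d := by
      refine ⟨n + (N - 1), ?_⟩
      rw [hper n, hper (n + (N - 1) + 1), show n + (N - 1) + 1 = n + N by omega,
        Nat.add_mod_right]
    obtain ⟨j, hj⟩ := h0
    obtain ⟨t, ht⟩ := hx j
    refine ⟨(h.pvTensorSD hC).sigma t, ?_⟩
    rw [(pvTensorToField_isSDHom h hC).sigma, ht, map_mul,
      ← (pvTensorToField_isSDHom h hC).sigma, hj, Function.iterate_succ_apply']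
    rfl
  have hcom : ∀ M, ∃ b : pvRing k sL X, (b : L) ≠ 0 ∧ ∀ n < M, ∃ a : pvRing k sL X,
      sL.sigma^[n] d * b = a := by
    intro M
    induction M with
    | zero => exact ⟨1, one_ne_zero, fun n hn => by omega⟩
    | succ M ih =>
      obtain ⟨b, hb, hb'⟩ := ih
      obtain ⟨a, b', hb0, hab⟩ := exists_div_mem_pvRing h (sL.sigma^[M] d)
      refine ⟨b * b', mul_ne_zero hb hb0, fun n hn => ?_⟩
      rcases Nat.lt_succ_iff_lt_or_eq.1 hn with hn | rfl
      · obtain ⟨a', ha'⟩ := hb' n hn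
        exact ⟨a' * b', by push_cast; rw [← ha', mul_assoc]⟩
      · exact ⟨a * b, by push_cast; rw [← hab]; ring⟩
  obtain ⟨b, hb, hb'⟩ := hcom N
  have hbI : pvInl k sL X C b ∈ I := by
    intro n
    obtain ⟨a, ha⟩ := hb' (n % N) (Nat.mod_lt _ hN)
    refine ⟨pvInl k sL X C a, ?_⟩
    rw [pvTensorToField_pvInl, pvTensorToField_pvInl, hper n, ← ha, mul_comm]
    simp
  rcases pvTensor_eq_bot_or_eq_top h hC hk I hI with h1 | h1
  · rw [h1, Ideal.mem_bot] at hbI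
    have h2 := isUnit_tmul_one (K := sL.const) (N := C) hb
    rw [← pvTensorToField_pvInl, hbI, map_zero] at h2
    exact absurd h2 not_isUnit_zero
  · obtain ⟨t, ht⟩ := (h1 ▸ trivial : (1 : PvTensor k sL X C) ∈ I) 0
    exact ⟨t, by rw [ht, map_one, one_mul]; rfl⟩

end PvTensor

/-! ### Summands of decompositions permuted by σ -/

theorem toCorner_surjective {S : Type*} [CommRing S] {e : S} (he : IsIdempotentElem e) :
    Function.Surjective (toCorner he) := by
  rintro ⟨_, x, rfl⟩
  exact ⟨x, rfl⟩

theorem coe_toCorner {S : Type*} [CommRing S] {e : S} (he : IsIdempotentElem e) (x : S) :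
    (toCorner he x).1 = e * x :=
  (mul_right_comm e x e).trans (by rw [he.eq])

theorem toCorner_coe {S : Type*} [CommRing S] {e : S} (he : IsIdempotentElem e)
    (y : he.Corner) : toCorner he y.1 = y := by
  obtain ⟨_, x, rfl⟩ := y
  refine Subtype.ext ?_
  change e * (e * x * e) * e = e * x * e
  linear_combination (e * x + x * e * e) * he.eq

/-- Transport of a `σδ`-structure along an isomorphism of rings. -/
def SDStruct.transport {R S : Type*} [CommRing R] [CommRing S] (t : SDStruct S) (φ : R ≃+* S) :
    SDStruct R where
  sigma := (φ.trans t.sigma).trans φ.symm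
  delta := Derivation.mk'
    (((φ.symm : S →+* R).toAddMonoidHom.comp
      ((t.delta : S →+ S).comp (φ : R →+* S).toAddMonoidHom)).toIntLinearMap)
    (fun x y => by
      change φ.symm (t.delta (φ (x * y))) = x * φ.symm (t.delta (φ y)) +
        y * φ.symm (t.delta (φ x))
      simp)
  comm x := by
    change φ.symm (t.sigma (φ (φ.symm (t.delta (φ x))))) =
      φ.symm (t.delta (φ (φ.symm (t.sigma (φ x)))))
    rw [RingEquiv.apply_symm_apply, RingEquiv.apply_symm_apply, t.comm]

theorem SDStruct.transport_isSDHom {R S : Type*} [CommRing R] [CommRing S] (t : SDStruct S)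
    (φ : R ≃+* S) : IsSDHom (t.transport φ) t (φ : R →+* S) :=
  ⟨fun _ => φ.apply_symm_apply _, fun _ => φ.apply_symm_apply _⟩

namespace IsSigmaDecomposition

variable {S : Type*} [CommRing S] {s : SDStruct S} {l : ℕ} {e : Fin l → S}
  (he : IsSigmaDecomposition s e)

theorem iterate_apply (he : IsSigmaDecomposition s e) (n : ℕ) (i : Fin l) :
    s.sigma^[n] (e i) = e ((finRotate l)^[n] i) := by
  induction n with
  | zero => rfl
  | succ n ih => rw [Function.iterate_succ_apply', ih, he.sigma_apply, Function.iterate_succ_apply']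

theorem _root_.coe_finRotate_iterate (n : ℕ) (i : Fin l) :
    (((finRotate l)^[n] i : Fin l) : ℕ) = (i + n) % l := by
  cases l with
  | zero => exact i.elim0
  | succ r =>
    induction n with
    | zero => simp [Nat.mod_eq_of_lt i.2]
    | succ n ih =>
      rw [Function.iterate_succ_apply', finRotate_apply, Fin.val_add, ih, Fin.val_one',
        ← Nat.add_mod, add_assoc]

theorem exists_iterate_apply_eq (he : IsSigmaDecomposition s e) (i j : Fin l) :
    ∃ n, s.sigma^[n] (e i) = e j := by
  refine ⟨j + (l - i), ?_⟩
  rw [he.iterate_apply]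
  congr 1
  apply Fin.ext
  rw [coe_finRotate_iterate, show (i : ℕ) + (j + (l - i)) = j + l by omega, Nat.add_mod_right,
    Nat.mod_eq_of_lt j.2]

theorem mul_iterate_apply_eq_zero (he : IsSigmaDecomposition s e) (i : Fin l) {n : ℕ}
    (hn : ¬ l ∣ n) : e i * s.sigma^[n] (e i) = 0 := by
  rw [he.iterate_apply]
  refine he.complete.ortho fun hi => hn ?_
  have h1 := congrArg Fin.val hi
  rw [coe_finRotate_iterate] at h1
  have h2 : (i + n : ℕ) ≡ i + 0 [MOD l] := by
    rw [Nat.ModEq, ← h1, add_zero, Nat.mod_eq_of_lt i.2]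
  exact (Nat.modEq_zero_iff_dvd).1 (Nat.ModEq.add_left_cancel' _ h2)

theorem toCorner_isSDHom (i : Fin l) :
    IsSDHom (s.pow l) (he.summandSD i) (toCorner (he.complete.idem i)) := by
  refine ⟨fun x => Subtype.ext ?_, fun x => Subtype.ext ?_⟩
  · change (toCorner (he.complete.idem i) ((s.pow l).sigma x)).1 =
      (s.pow l).sigma (toCorner (he.complete.idem i) x).1
    rw [coe_toCorner, coe_toCorner, map_mul, he.pow_apply]
  · change (toCorner (he.complete.idem i) (s.delta x)).1 =
      s.delta (toCorner (he.complete.idem i) x).1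
    rw [coe_toCorner, coe_toCorner, Derivation.leibniz, s.delta_idempotent (he.complete.idem i),
      smul_zero, add_zero, smul_eq_mul]

/-- A summand `R_i` has no ideals stable under `σ^l` if `S` has none stable under `σ`. -/
theorem eq_bot_or_eq_top (hS : ∀ I : Ideal S, (∀ x ∈ I, s.sigma x ∈ I) → I = ⊥ ∨ I = ⊤)
    (i : Fin l) (I : Ideal (he.complete.idem i).Corner)
    (hI : ∀ x ∈ I, (he.summandSD i).sigma x ∈ I) : I = ⊥ ∨ I = ⊤ := by
  have hq : ∀ (q : ℕ) (x : (he.complete.idem i).Corner), x ∈ I →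
      toCorner (he.complete.idem i) (s.sigma^[l * q] x.1) ∈ I := by
    intro q
    induction q with
    | zero => exact fun x hx => by rwa [mul_zero, Function.iterate_zero_apply, toCorner_coe]
    | succ q ih =>
      intro x hx
      have h1 := ih _ (hI x hx)
      have h2 : ((he.summandSD i).sigma x).1 = s.sigma^[l] x.1 := s.pow_sigma_apply l x.1
      rwa [h2, ← Function.iterate_add_apply] at h1
  -- J consists of the x for which all σⁿx project into I; it is σ-stable, hence 0 or S. It contains
  -- I, because for y in R_i the projection of σⁿy to R_i vanishes unless l divides n.
  let J : Ideal S :=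
    { carrier := {x | ∀ n, toCorner (he.complete.idem i) (s.sigma^[n] x) ∈ I}
      zero_mem' := fun n => by rw [← s.iter_apply, map_zero, map_zero]; exact zero_mem I
      add_mem' := fun {x y} hx hy n => by
        have hx := hx n
        have hy := hy n
        rw [← s.iter_apply] at hx hy ⊢
        rw [map_add, map_add]
        exact add_mem hx hy
      smul_mem' := fun a x hx n => by
        have hx := hx n
        rw [← s.iter_apply] at hx ⊢
        rw [smul_eq_mul, map_mul, map_mul]
        exact I.mul_mem_left _ hx }
  have hJ : ∀ x ∈ J, s.sigma x ∈ J := fun x hx n => by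
    rw [← Function.iterate_succ_apply]
    exact hx (n + 1)
  rcases hS J hJ with h | h
  · left
    rw [eq_bot_iff]
    intro y hy
    have h1 : y.1 ∈ J := by
      intro n
      by_cases hn : l ∣ n
      · obtain ⟨q, rfl⟩ := hn
        exact hq q y hy
      · have h2 : toCorner (he.complete.idem i) (s.sigma^[n] y.1) = 0 := by
          refine Subtype.ext ?_
          rw [coe_toCorner]
          conv_lhs => rw [← toCorner_coe (he.complete.idem i) y, coe_toCorner, ← s.iter_apply,
            map_mul, ← mul_assoc, s.iter_apply, he.mul_iterate_apply_eq_zero i hn, zero_mul]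
          rfl
        rw [h2]
        exact zero_mem I
    rw [h] at h1
    exact Subtype.ext h1
  · right
    rw [Ideal.eq_top_iff_one]
    have h1 := (h ▸ trivial : (1 : S) ∈ J) 0
    rwa [Function.iterate_zero_apply, map_one] at h1

end IsSigmaDecomposition

theorem SDStruct.pow_sigma_symm_apply {R : Type*} [CommRing R] (s : SDStruct R) (n : ℕ) (x : R) :
    (s.pow n).sigma.symm x = s.sigma.symm^[n] x := by
  rw [RingEquiv.symm_apply_eq]
  exact ((s.pow_sigma_apply n _).trans
    (Function.LeftInverse.iterate (f := s.sigma.symm) (g := s.sigma)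
      (fun y => s.sigma.apply_symm_apply y) n x)).symm

/-- Applying σⁿ to σZ = AZ gives σⁿ⁺¹Z = σⁿ(A)σⁿ(Z), which matches the recursion of `sigmaProd`. -/
theorem map_iterate_sigma_eq_sigmaProd {k S : Type*} [CommRing k] [CommRing S] {sk : SDStruct k}
    {s : SDStruct S} (f : k →+* S) (hf : ∀ a, f (sk.sigma a) = s.sigma (f a)) {m : ℕ}
    {A : Matrix (Fin m) (Fin m) k} {Z : Matrix (Fin m) (Fin m) S}
    (hZ : Z.map s.sigma = A.map f * Z) (n : ℕ) :
    Z.map s.sigma^[n] = (sigmaProd sk A n).map f * Z := by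
  induction n with
  | zero =>
    change Z.map id = (1 : Matrix _ _ k).map f * Z
    simp
  | succ n ih =>
    have h1 : ∀ a, s.iter n (f a) = f (sk.sigma^[n] a) := by
      intro a
      rw [s.iter_apply]
      exact ((show Function.Semiconj f sk.sigma s.sigma from hf).iterate_right n a).symm
    have h2 : Z.map s.sigma^[n + 1] = (Z.map s.sigma).map (s.iter n) := by
      ext i j
      simp only [Matrix.map_apply, s.iter_apply, Function.iterate_succ_apply]
    have h3 : (A.map f).map (s.iter n) = (A.map sk.sigma^[n]).map f := by
      ext i j
      exact h1 _
    have h4 : Z.map (s.iter n) = Z.map s.sigma^[n] := by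
      ext i j
      exact s.iter_apply n _
    rw [h2, hZ, Matrix.map_mul, h3, h4, ih, ← mul_assoc, ← Matrix.map_mul]
    rfl

theorem isUnit_det_sigmaProd {k : Type*} [CommRing k] (s : SDStruct k) {m : ℕ}
    {A : Matrix (Fin m) (Fin m) k} (hA : IsUnit A.det) (n : ℕ) :
    IsUnit (sigmaProd s A n).det := by
  induction n with
  | zero =>
    change IsUnit (1 : Matrix (Fin m) (Fin m) k).det
    simp
  | succ n ih =>
    change IsUnit (A.map (s.sigma^[n]) * sigmaProd s A n).det
    rw [Matrix.det_mul]
    refine IsUnit.mul ?_ ih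
    have h1 := hA.map (s.iter n)
    rw [RingHom.map_det] at h1
    convert h1 using 2
    ext i j
    exact (s.iter_apply n _).symm

theorem SDStruct.deltaAdjoin_eq_top_of_surjective {R S : Type*} [CommRing R] [CommRing S]
    {s : SDStruct R} {t : SDStruct S} {f : R →+* S} (hf : Function.Surjective f)
    (hδ : ∀ x, f (s.delta x) = t.delta (f x)) {T : Set R} (hT : s.deltaAdjoin T = ⊤) {U : Set S}
    (hU : ∀ x ∈ T, f x ∈ U) : t.deltaAdjoin U = ⊤ := by
  have h1 : s.deltaAdjoin T ≤ (t.deltaAdjoin U).comap f :=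
    s.deltaAdjoin_le (fun x hx => t.subset_deltaAdjoin U (hU x hx)) fun x hx => by
      rw [Subring.mem_comap] at hx ⊢
      rw [hδ]
      exact t.delta_mem_deltaAdjoin U _ hx
  rw [eq_top_iff]
  intro y _
  obtain ⟨x, rfl⟩ := hf y
  exact h1 (hT ▸ trivial)

/-- The summands of a decomposition of a Picard-Vessiot extension are Picard-Vessiot extensions
for the iterated equation. -/
theorem IsSigmaDecomposition.isPicardVessiot {k S : Type*} [CommRing k] [CommRing S]
    {sk : SDStruct k} {s : SDStruct S} {l : ℕ} {e : Fin l → S} (he : IsSigmaDecomposition s e)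
    {F : Subring S} {f : k →+* S} (hf : ∀ a, f (sk.sigma a) = s.sigma (f a))
    (hfF : ∀ a, f a ∈ F) {m : ℕ} {A : Matrix (Fin m) (Fin m) k} (hA : IsUnit A.det)
    (hPV : IsPicardVessiot s F (A.map f))
    (hS : ∀ I : Ideal S, (∀ x ∈ I, s.sigma x ∈ I) → I = ⊥ ∨ I = ⊤) (i : Fin l) :
    IsPicardVessiot (he.summandSD i) (F.map (toCorner (he.complete.idem i)))
      ((sigmaProd sk A l).map ((toCorner (he.complete.idem i)).comp f)) := by
  have := he.isDomain i
  have hc := he.toCorner_isSDHom i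
  obtain ⟨Z, hZ, hZA, hgen⟩ := hPV.fundamental
  refine ⟨isField_subring_map _ hPV.isField, ?_, ?_, ?_, fun _ _ => ⟨_, hfF _, rfl⟩, ?_,
    inferInstance, fun I hI _ => he.eq_bot_or_eq_top hS i I hI, ?_⟩
  · rintro _ ⟨x, hx, rfl⟩
    refine ⟨(s.pow l).sigma x, ?_, hc.sigma x⟩
    have h1 : ∀ n, s.sigma^[n] x ∈ F := by
      intro n
      induction n with
      | zero => exact hx
      | succ n ih =>
        rw [Function.iterate_succ_apply']
        exact hPV.sigma_mem _ ih
    exact (s.pow_sigma_apply l x).symm ▸ h1 l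
  · rintro _ ⟨x, hx, rfl⟩
    refine ⟨(s.pow l).sigma.symm x, ?_, ?_⟩
    · have h1 : ∀ n, s.sigma.symm^[n] x ∈ F := by
        intro n
        induction n with
        | zero => exact hx
        | succ n ih =>
          rw [Function.iterate_succ_apply']
          exact hPV.sigma_symm_mem _ ih
      rw [s.pow_sigma_symm_apply]
      exact h1 l
    · rw [RingEquiv.eq_symm_apply, ← hc.sigma, RingEquiv.apply_symm_apply]
  · rintro _ ⟨x, hx, rfl⟩
    exact ⟨s.delta x, hPV.delta_mem x hx, hc.delta x⟩
  · have h1 := (isUnit_det_sigmaProd sk hA l).map ((toCorner (he.complete.idem i)).comp f)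
    rwa [RingHom.map_det] at h1
  · have hdet : (Z.map (toCorner (he.complete.idem i))).det =
        toCorner (he.complete.idem i) Z.det := (RingHom.map_det _ _).symm
    refine ⟨Z.map (toCorner (he.complete.idem i)), ?_, ?_, ?_⟩
    · rw [hdet]
      exact hZ.map _
    · have h1 := congrArg (fun M => M.map (toCorner (he.complete.idem i)))
        (map_iterate_sigma_eq_sigmaProd f hf hZA l)
      simp only [Matrix.map_mul] at h1
      refine Eq.trans ?_ h1
      ext1 a b
      change (he.summandSD i).sigma (toCorner (he.complete.idem i) (Z a b)) =
        toCorner (he.complete.idem i) (s.sigma^[l] (Z a b))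
      rw [← hc.sigma]
      exact congrArg _ (s.pow_sigma_apply l _)
    · refine SDStruct.deltaAdjoin_eq_top_of_surjective (s := s)
        (toCorner_surjective (he.complete.idem i)) hc.delta hgen ?_
      rintro x ((hx | ⟨p, rfl⟩) | rfl)
      · exact Or.inl (Or.inl ⟨x, hx, rfl⟩)
      · exact Or.inl (Or.inr ⟨p, rfl⟩)
      · refine Or.inr ?_
        rw [Set.mem_singleton_iff, hdet]
        refine (Ring.inverse_eq_of_mul_eq_one ?_).symm
        rw [← map_mul, Ring.mul_inverse_cancel _ hZ, map_one]

/-- Let `ρ i`, for `i` in `ℤ/l`, be homomorphisms from `S` to a domain with pairwise coprime kernels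
such that `σ` maps the kernel of `ρ i` into the kernel of `ρ (i + 1)`. If `S` has no non-trivial
`σ`-stable ideals, then `S` is the direct sum of domains permuted by `σ`. -/
theorem exists_isSigmaDecomposition {S Q : Type*} [CommRing S] [CommRing Q] [IsDomain Q]
    (s : SDStruct S)
    (hS : ∀ I : Ideal S, (∀ x ∈ I, s.sigma x ∈ I) → I = ⊥ ∨ I = ⊤) {l : ℕ} (hl : 0 < l)
    (ρ : Fin l → S →+* Q) (ψ : Fin l → Q →+* Q)
    (hρ : ∀ j x, ρ (finRotate l j) (s.sigma x) = ψ j (ρ j x))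
    (hco : Pairwise fun i j => IsCoprime (RingHom.ker (ρ i)) (RingHom.ker (ρ j))) :
    ∃ e : Fin l → S, IsSigmaDecomposition s e := by
  classical
  have hrot : ∀ i : Fin l, ∃ j, finRotate l j = i := (finRotate l).surjective
  -- The intersection of the kernels is σ-stable, as σ sends each kernel into the next one, and it
  -- does not contain 1; so it is 0. The idempotents then come from the Chinese remainder theorem.
  have hinj : ∀ x, (∀ j, ρ j x = 0) → x = 0 := by
    let I : Ideal S := ⨅ j, RingHom.ker (ρ j)
    have hmem : ∀ x, x ∈ I ↔ ∀ j, ρ j x = 0 := fun x => by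
      simp only [I, Ideal.mem_iInf, RingHom.mem_ker]
    intro x hx
    have hI : I = ⊥ := by
      refine (hS I fun x hx => ?_).resolve_right fun h => ?_
      · rw [hmem] at hx ⊢
        intro i
        obtain ⟨j, rfl⟩ := hrot i
        rw [hρ, hx, map_zero]
      · have h1 := (hmem 1).1 (h ▸ trivial) ⟨0, hl⟩
        rw [map_one] at h1
        exact one_ne_zero h1
    have := (hmem x).2 hx
    rwa [hI] at this
  have hext : ∀ x y, (∀ j, ρ j x = ρ j y) → x = y := fun x y hxy =>
    sub_eq_zero.1 (hinj _ fun j => by rw [map_sub, hxy, sub_self])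
  have hex : ∀ i, ∃ x, ∀ j, ρ j x = if i = j then 1 else 0 := by
    intro i
    obtain ⟨x, hx⟩ := Ideal.exists_forall_sub_mem_ideal hco fun j => if i = j then 1 else 0
    refine ⟨x, fun j => ?_⟩
    have h1 := hx j
    rw [RingHom.mem_ker, map_sub, sub_eq_zero] at h1
    rw [h1]
    split <;> simp
  choose e he using hex
  have hco : CompleteOrthogonalIdempotents e := by
    refine ⟨⟨fun i => hext _ _ fun j => ?_, fun i i' hii' => hext _ _ fun j => ?_⟩,
      hext _ _ fun j => ?_⟩
    · rw [map_mul, he]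
      split <;> simp
    · rw [map_mul, he, he, map_zero]
      by_cases h1 : i = j
      · have h2 : ¬ i' = j := fun h2 => hii' (h1.trans h2.symm)
        rw [if_neg h2, mul_zero]
      · rw [if_neg h1, zero_mul]
    · rw [map_sum, map_one]
      simp [he]
  refine ⟨e, hco, fun i => hext _ _ fun j => ?_, fun i => ?_⟩
  · obtain ⟨j', rfl⟩ := hrot j
    rw [hρ, he, he]
    by_cases h1 : i = j'
    · rw [if_pos h1, if_pos (congrArg _ h1), map_one]
    · rw [if_neg h1, if_neg fun h2 => h1 ((finRotate l).injective h2), map_zero]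
  · let f : (hco.idem i).Corner →+* Q :=
      { toFun := fun x => ρ i x.1
        map_one' := by
          change ρ i (e i) = 1
          rw [he, if_pos rfl]
        map_zero' := map_zero (ρ i)
        map_add' := fun x y => map_add (ρ i) x.1 y.1
        map_mul' := fun x y => map_mul (ρ i) x.1 y.1 }
    have hf : Function.Injective f := by
      rw [injective_iff_map_eq_zero]
      intro x hx
      refine Subtype.ext (hinj _ fun j => ?_)
      by_cases h1 : i = j
      · rw [← h1]
        exact hx
      · rw [← toCorner_coe (hco.idem i) x, coe_toCorner, map_mul, he, if_neg h1, zero_mul]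
    exact Function.Injective.isDomain f hf

namespace IsSigmaDecomposition

variable {S Q : Type*} [CommRing S] [CommRing Q] {s : SDStruct S} {l : ℕ} {e : Fin l → S}
  (he : IsSigmaDecomposition s e)

/-- If the field `Q` consists of fractions of elements of the image of a homomorphism of
`σ^l δ`-rings `π : S → Q`, then every summand `R_i` has a fraction field isomorphic to `Q`. -/
theorem exists_ringEquiv_fractionRing (hQ : IsField Q)
    (hS : ∀ I : Ideal S, (∀ x ∈ I, s.sigma x ∈ I) → I = ⊥ ∨ I = ⊤) {t : SDStruct Q}
    {π : S →+* Q} (hπ : IsSDHom (s.pow l) t π)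
    (hden : ∀ q, ∃ a b, IsUnit (π b) ∧ q * π b = π a) (i : Fin l) :
    ∃ (sQ : SDStruct (FractionRing (he.complete.idem i).Corner))
      (φ : FractionRing (he.complete.idem i).Corner ≃+* Q),
      IsSDHom (he.summandSD i) sQ (algebraMap _ _) ∧ IsSDHom sQ t (φ : _ →+* Q) := by
  have := hQ.isDomain
  -- In a field each π(e j) is 0 or 1, and these values sum to 1.
  obtain ⟨j, hj⟩ : ∃ j, π (e j) = 1 := by
    by_contra hne
    push Not at hne
    have h0 : ∀ j, π (e j) = 0 := fun j => by
      have h1 : π (e j) * π (e j) = π (e j) := by rw [← map_mul, (he.complete.idem j).eq]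
      exact (IsIdempotentElem.iff_eq_zero_or_one.1 h1).resolve_right (hne j)
    have h2 := congrArg π he.complete.complete
    rw [map_sum, map_one, Finset.sum_eq_zero fun j _ => h0 j] at h2
    exact zero_ne_one h2
  -- σⁿ carries R_i to the summand R_j that survives under π; therefore π ∘ σⁿ is a unital
  -- homomorphism on R_i.
  obtain ⟨n, hn⟩ := he.exists_iterate_apply_eq i j
  let f : (he.complete.idem i).Corner →+* Q :=
    { toFun := fun x => π (s.iter n x.1)
      map_one' := by
        change π (s.iter n (e i)) = 1
        rw [s.iter_apply, hn, hj]
      map_zero' := by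
        change π (s.iter n 0) = 0
        rw [map_zero, map_zero]
      map_add' := fun x y => by
        change π (s.iter n (x.1 + y.1)) = _
        rw [map_add, map_add]
      map_mul' := fun x y => by
        change π (s.iter n (x.1 * y.1)) = _
        rw [map_mul, map_mul] }
  have hfapp : ∀ x, f x = π (s.sigma^[n] x.1) := fun x => congrArg π (s.iter_apply n x.1)
  have hf : IsSDHom (he.summandSD i) t f := by
    refine ⟨fun x => ?_, fun x => ?_⟩
    · rw [hfapp, hfapp, ← hπ.sigma]
      congr 1
      change s.sigma^[n] ((s.pow l).sigma x.1) = _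
      have h1 : ∀ y, (s.pow l).sigma y = s.sigma^[l] y := s.pow_sigma_apply l
      rw [h1, h1, ← Function.iterate_add_apply, ← Function.iterate_add_apply, add_comm]
    · rw [hfapp, hfapp, ← hπ.delta]
      congr 1
      change s.sigma^[n] (s.delta x.1) = s.delta (s.sigma^[n] x.1)
      exact (show Function.Commute s.sigma s.delta from s.comm).iterate_left n x.1
  -- The kernel is a proper ideal stable under σ^l, and R_i is simple with respect to σ^l.
  have hinj : Function.Injective f := by
    rw [RingHom.injective_iff_ker_eq_bot]
    refine (he.eq_bot_or_eq_top hS i _ fun x hx => ?_).resolve_right (RingHom.ker_ne_top f)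
    rw [RingHom.mem_ker] at hx ⊢
    rw [hf.sigma, hx, map_zero]
  have hlift : ∀ a, ∃ x, f x = π a := by
    intro a
    obtain ⟨b, rfl⟩ := s.sigma.surjective.iterate n a
    refine ⟨toCorner (he.complete.idem i) b, ?_⟩
    rw [hfapp, coe_toCorner, ← s.iter_apply, map_mul, s.iter_apply, hn, map_mul, hj, one_mul,
      s.iter_apply]
  have := he.isDomain i
  let : Algebra (he.complete.idem i).Corner Q := f.toAlgebra
  have : IsFractionRing (he.complete.idem i).Corner Q := by
    refine isTotalFractionRing_of_injective f hinj (fun q => ?_) fun y hy =>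
      IsUnit.of_mul_eq_one _ (hQ.mul_inv_cancel (nonZeroDivisors.ne_zero hy)).choose_spec
    obtain ⟨a, b, hb, hab⟩ := hden q
    obtain ⟨x, hx⟩ := hlift a
    obtain ⟨y, hy⟩ := hlift b
    exact ⟨x, y, hy ▸ hb, by rw [hx, hy, hab]⟩
  let φ : FractionRing (he.complete.idem i).Corner ≃+* Q :=
    (FractionRing.algEquiv (he.complete.idem i).Corner Q).toRingEquiv
  have hφ : ∀ x, φ (algebraMap _ _ x) = f x := fun x =>
    (FractionRing.algEquiv (he.complete.idem i).Corner Q).commutes x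
  refine ⟨t.transport φ, φ, ⟨fun x => ?_, fun x => ?_⟩, t.transport_isSDHom φ⟩
  · apply φ.injective
    rw [hφ, hf.sigma, ← hφ]
    exact ((t.transport_isSDHom φ).sigma _).symm
  · apply φ.injective
    rw [hφ, hf.delta, ← hφ]
    exact ((t.transport_isSDHom φ).delta _).symm

end IsSigmaDecomposition

/-! ### The map to L ⊗ C over D_L and the existence of a decomposition -/

section Projection

variable {k L : Type*} [Field k] [Field L] [Algebra k L] {m : ℕ} {sk : SDStruct k}
  {sL : SDStruct L} {A : GL (Fin m) k} {X : Matrix (Fin m) (Fin m) L} {C : Type*} [Field C]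
  [Algebra sL.const C] {dC : Derivation ℤ C C}

/-- By transitivity of integrality D_L is algebraically closed in L, and C is algebraic over D_L. -/
theorem isField_tensorProduct_algConst [CharZero L] [Algebra.IsAlgebraic sL.const C]
    [Algebra sL.algConst C] [IsScalarTower sL.const sL.algConst C] :
    IsField (L ⊗[sL.algConst] C) := by
  have : Algebra.IsAlgebraic sL.algConst C := Algebra.IsAlgebraic.tower_top (K := sL.const) _
  refine isField_tensorProduct_of_forall_isIntegral fun x hx => ?_
  have h1 : IsIntegral sL.const x := isIntegral_trans x hx
  exact ⟨⟨x, h1⟩, rfl⟩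

/-- σ^l is trivial on D_L, hence compatible with the identity on C. The derivations agree on D_L for
any embedding into C, because a derivation extends uniquely to algebraic elements in characteristic
0. -/
theorem exists_sdStruct_tensorProduct_algConst [CharZero L] [Algebra.IsAlgebraic sL.const C]
    [Algebra sL.algConst C] [IsScalarTower sL.const sL.algConst C]
    (hC : IsSDHom sL.constSD (SDStruct.ofDerivation dC) (algebraMap sL.const C)) {l : ℕ}
    (hl : ∀ d ∈ sL.algConst, sL.sigma^[l] d = d) :
    ∃ sT : SDStruct (L ⊗[sL.algConst] C),
      (∀ (x : L) (c : C), sT.sigma (x ⊗ₜ c) = (sL.pow l).sigma x ⊗ₜ c) ∧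
      ∀ (x : L) (c : C), sT.delta (x ⊗ₜ c) = sL.delta x ⊗ₜ c + x ⊗ₜ dC c := by
  have hfix : ∀ d ∈ sL.algConst, (sL.pow l).sigma d = d := fun d hd =>
    (sL.pow_sigma_apply l d).trans (hl d hd)
  let sD : SDStruct sL.algConst := (sL.pow l).restrict sL.algConst
    (fun x hx => by rw [hfix x hx]; exact hx)
    (fun x hx => by
      have h1 : (sL.pow l).sigma.symm x = x := by rw [RingEquiv.symm_apply_eq, hfix x hx]
      rw [h1]
      exact hx)
    (fun x hx => sL.delta_mem_algConst hx)
  have hB : IsSDHom sD (sL.pow l) (algebraMap sL.algConst L) := ⟨fun _ => rfl, fun _ => rfl⟩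
  have hD : IsSDHom sD (SDStruct.ofDerivation dC) (algebraMap sL.algConst C) := by
    refine ⟨fun d => ?_, fun d => ?_⟩
    · exact congrArg (algebraMap sL.algConst C) (Subtype.ext (hfix d d.2))
    · exact (Derivation.algebraMap_eq_of_isAlgebraic sL.constSD.delta sD.delta dC
        (fun a => rfl) (fun a => (hC.delta a).symm) (Algebra.IsIntegral.isIntegral d)).symm
  exact ⟨SDStruct.tensor sD (sL.pow l) (SDStruct.ofDerivation dC) hB hD, fun _ _ => rfl,
    fun _ _ => rfl⟩

theorem exists_ringHom_tensorProduct_tower {K D M N : Type*} [Field K] [Field D] [Field M]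
    [Field N] [Algebra K D] [Algebra K M] [Algebra K N] [Algebra D M] [Algebra D N]
    [IsScalarTower K D M] [IsScalarTower K D N] :
    ∃ ω : M ⊗[K] N →+* M ⊗[D] N, Function.Surjective ω ∧ ∀ x c, ω (x ⊗ₜ c) = x ⊗ₜ c := by
  have h1 : ∀ c : K, (Algebra.TensorProduct.includeLeftRingHom : M →+* M ⊗[D] N)
      (algebraMap K M c) = ((Algebra.TensorProduct.includeRight : N →ₐ[D] M ⊗[D] N) :
      N →+* M ⊗[D] N) (algebraMap K N c) := by
    intro c
    rw [IsScalarTower.algebraMap_apply K D M, IsScalarTower.algebraMap_apply K D N]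
    exact Algebra.TensorProduct.tmul_one_eq_one_tmul _
  obtain ⟨ω, hω⟩ := exists_ringHom_tmul (K := K) _ _ h1
  have hω' : ∀ x c, ω (x ⊗ₜ c) = x ⊗ₜ c := fun x c => by
    rw [hω]
    change (x ⊗ₜ[D] (1 : N)) * ((1 : M) ⊗ₜ[D] c) = _
    rw [Algebra.TensorProduct.tmul_mul_tmul, mul_one, one_mul]
  refine ⟨ω, fun q => ?_, hω'⟩
  induction q with
  | zero => exact ⟨0, map_zero _⟩
  | tmul x c => exact ⟨x ⊗ₜ c, hω' x c⟩
  | add x y hx hy =>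
    obtain ⟨a, rfl⟩ := hx
    obtain ⟨b, rfl⟩ := hy
    exact ⟨a + b, map_add _ _ _⟩

theorem pvTensorSD_pow_sigma_pvInl (h : IsGenericSolutionField sk sL A X)
    (hC : IsSDHom sL.constSD (SDStruct.ofDerivation dC) (algebraMap sL.const C)) (l : ℕ)
    (r : pvRing k sL X) : ((h.pvTensorSD hC).pow l).sigma (pvInl k sL X C r) =
      pvInl k sL X C ((h.pvRingSD.pow l).sigma r) := by
  refine ((h.pvTensorSD hC).pow_sigma_apply l _).trans ?_
  refine Eq.trans ?_ (congrArg (pvInl k sL X C) (h.pvRingSD.pow_sigma_apply l r).symm)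
  exact ((show Function.Semiconj (pvInl k sL X C) h.pvRingSD.sigma (h.pvTensorSD hC).sigma from
    pvTensorSD_sigma_pvInl h hC).iterate_right l r).symm

theorem coe_pvRingSD_pow_sigma (h : IsGenericSolutionField sk sL A X) (l : ℕ)
    (r : pvRing k sL X) : (((h.pvRingSD.pow l).sigma r : pvRing k sL X) : L) =
      (sL.pow l).sigma r := by
  refine (congrArg Subtype.val (h.pvRingSD.pow_sigma_apply l r)).trans ?_
  exact ((show Function.Semiconj (Subtype.val : pvRing k sL X → L) h.pvRingSD.sigma sL.sigma from
    fun _ => rfl).iterate_right l r).trans (sL.pow_sigma_apply l _).symm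

/-- The natural map `R ⊗ C → L ⊗_{D_L} C` is a homomorphism of `σ^l δ`-rings. -/
theorem isSDHom_pvTensor_of_forall_tmul {D : Type*} [Field D] [Algebra D L] [Algebra D C]
    (h : IsGenericSolutionField sk sL A X)
    (hC : IsSDHom sL.constSD (SDStruct.ofDerivation dC) (algebraMap sL.const C)) {l : ℕ}
    {sT : SDStruct (L ⊗[D] C)}
    (hσ : ∀ (x : L) (c : C), sT.sigma (x ⊗ₜ c) = (sL.pow l).sigma x ⊗ₜ c)
    (hδ : ∀ (x : L) (c : C), sT.delta (x ⊗ₜ c) = sL.delta x ⊗ₜ c + x ⊗ₜ dC c)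
    {π : PvTensor k sL X C →+* L ⊗[D] C} (hinl : ∀ r, π (pvInl k sL X C r) = (r : L) ⊗ₜ (1 : C))
    (hinr : ∀ c, π (pvInr k sL X C c) = (1 : L) ⊗ₜ c) :
    IsSDHom ((h.pvTensorSD hC).pow l) sT π := by
  refine ⟨fun x => ?_, fun x => ?_⟩
  · induction x using pvTensor_induction with
    | zero => simp
    | add x y hx hy => rw [map_add, map_add, hx, hy, map_add, map_add]
    | mul r c =>
      have h2 : ((h.pvTensorSD hC).pow l).sigma (pvInr k sL X C c) = pvInr k sL X C c :=
        ((h.pvTensorSD hC).pow_sigma_apply l _).trans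
          (Function.iterate_fixed (pvTensorSD_sigma_pvInr h hC c) l)
      rw [map_mul, map_mul, pvTensorSD_pow_sigma_pvInl, h2, hinl, hinr, map_mul, hinl, hinr,
        map_mul, hσ, hσ, map_one, coe_pvRingSD_pow_sigma]
  · change π ((h.pvTensorSD hC).delta x) = _
    induction x using pvTensor_induction with
    | zero => simp
    | add x y hx hy => rw [map_add, map_add, hx, hy, map_add, map_add]
    | mul r c =>
      have h1 : ((h.pvRingSD.delta r : pvRing k sL X) : L) = sL.delta r := rfl
      rw [Derivation.leibniz, map_add, smul_eq_mul, smul_eq_mul, map_mul, map_mul, map_mul,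
        pvTensorSD_delta_pvInl, pvTensorSD_delta_pvInr, hinl, hinl, hinr, hinr,
        Derivation.leibniz, smul_eq_mul, smul_eq_mul, hδ, hδ, Derivation.map_one_eq_zero,
        Derivation.map_one_eq_zero, TensorProduct.tmul_zero, TensorProduct.zero_tmul, add_zero,
        zero_add, h1]

/-- π is the composite R ⊗ C → L ⊗ C → L ⊗ C, the last product being over D_L. Elements of D_L ⊗ 1
become elements of C there, and this is what tells the summands apart. -/
theorem exists_projection [CharZero L] [Algebra.IsAlgebraic sL.const C]
    [Algebra sL.algConst C] [IsScalarTower sL.const sL.algConst C]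
    (h : IsGenericSolutionField sk sL A X)
    (hC : IsSDHom sL.constSD (SDStruct.ofDerivation dC) (algebraMap sL.const C)) {l : ℕ}
    (hl : ∀ d ∈ sL.algConst, sL.sigma^[l] d = d) :
    ∃ (sT : SDStruct (L ⊗[sL.algConst] C)) (π : PvTensor k sL X C →+* L ⊗[sL.algConst] C),
      (∀ (x : L) (c : C), sT.sigma (x ⊗ₜ c) = (sL.pow l).sigma x ⊗ₜ c) ∧
      (∀ (x : L) (c : C), sT.delta (x ⊗ₜ c) = sL.delta x ⊗ₜ c + x ⊗ₜ dC c) ∧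
      IsSDHom ((h.pvTensorSD hC).pow l) sT π ∧
      (∀ c, π (pvInr k sL X C c) = (1 : L) ⊗ₜ c) ∧
      (∀ x d, pvTensorToField k sL X C x = d ⊗ₜ (1 : C) → π x = d ⊗ₜ (1 : C)) ∧
      ∀ q, ∃ a b, IsUnit (π b) ∧ q * π b = π a := by
  obtain ⟨sT, hσ, hδ⟩ := exists_sdStruct_tensorProduct_algConst hC hl
  obtain ⟨ω, hsurj, hω⟩ := exists_ringHom_tensorProduct_tower (K := sL.const) (D := sL.algConst)
    (M := L) (N := C)
  have hinl : ∀ r, ω.comp (pvTensorToField k sL X C) (pvInl k sL X C r) =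
      (r : L) ⊗ₜ[sL.algConst] (1 : C) := fun r => hω _ _
  have hinr : ∀ c, ω.comp (pvTensorToField k sL X C) (pvInr k sL X C c) =
      (1 : L) ⊗ₜ[sL.algConst] c := fun c => hω _ _
  refine ⟨sT, ω.comp (pvTensorToField k sL X C), hσ, hδ,
    isSDHom_pvTensor_of_forall_tmul h hC hσ hδ hinl hinr, hinr, fun x d hx => ?_, fun q => ?_⟩
  · rw [RingHom.comp_apply, hx, hω]
  · obtain ⟨z, rfl⟩ := hsurj q
    obtain ⟨a, b, hb, hab⟩ := exists_pvTensorToField_mul_eq h z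
    refine ⟨a, pvInl k sL X C b, ?_, ?_⟩
    · rw [hinl]
      exact isUnit_tmul_one hb
    · rw [hinl, ← hω, ← map_mul, hab]
      rfl

/-- A primitive element θ of D_L over C_L is represented by some t in R ⊗ C. The maps π ∘ σⁿ for n <
l send t to l different elements of C, so their kernels are pairwise coprime. -/
theorem exists_pvTensor_decomposition [CharZero L] [IsAlgClosure sL.const C]
    [Algebra sL.algConst C] [IsScalarTower sL.const sL.algConst C]
    [FiniteDimensional sL.const sL.algConst]
    (h : IsGenericSolutionField sk sL A X)
    (hC : IsSDHom sL.constSD (SDStruct.ofDerivation dC) (algebraMap sL.const C))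
    (hk : sk.algConst = ⊥) {l : ℕ} (hl : l = Module.finrank sL.const sL.algConst) :
    ∃ e : Fin l → PvTensor k sL X C, IsSigmaDecomposition (h.pvTensorSD hC) e := by
  have : Algebra.IsAlgebraic sL.const C := IsAlgClosure.isAlgebraic
  obtain ⟨hfix, θ, hθ, hθl⟩ := sL.exists_generator_algConst
  rw [← hl] at hfix hθl
  have hl0 : 0 < l := hl ▸ Module.finrank_pos
  obtain ⟨sT, π, -, -, hπ, hinr, hπd, -⟩ := exists_projection h hC hfix
  obtain ⟨t, ht⟩ := exists_pvTensorToField_eq_tmul_one h hC hk hθ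
  have : IsDomain (L ⊗[sL.algConst] C) := isField_tensorProduct_algConst.isDomain
  have hθn : ∀ n, sL.sigma^[n] θ ∈ sL.algConst := by
    intro n
    induction n with
    | zero => exact hθ
    | succ n ih =>
      rw [Function.iterate_succ_apply']
      let σ : L →ₐ[sL.const] L := { (sL.sigma : L →+* L) with commutes' := fun c => c.2 }
      exact IsIntegral.map σ ih
  obtain ⟨τ, hτθ⟩ : ∃ τ : ℕ → C, ∀ n, τ n = algebraMap sL.algConst C ⟨_, hθn n⟩ :=
    ⟨_, fun _ => rfl⟩
  have hτ : ∀ n, π ((h.pvTensorSD hC).sigma^[n] t) = π (pvInr k sL X C (τ n)) := by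
    intro n
    have h1 : pvTensorToField k sL X C ((h.pvTensorSD hC).sigma^[n] t) =
        (sL.sigma^[n] θ) ⊗ₜ (1 : C) := by
      induction n with
      | zero => exact ht
      | succ n ih =>
        rw [Function.iterate_succ_apply', (pvTensorToField_isSDHom h hC).sigma, ih,
          Function.iterate_succ_apply']
        rfl
    rw [hπd _ _ h1, hinr, hτθ]
    exact Algebra.TensorProduct.tmul_one_eq_one_tmul (A := L) (B := C)
      (⟨_, hθn n⟩ : sL.algConst)
  have hτinj : ∀ a b, a < b → b < l → τ a ≠ τ b := by
    intro a b hab hb heq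
    rw [hτθ, hτθ] at heq
    have h1 : sL.sigma^[a] θ = sL.sigma^[b] θ :=
      congrArg Subtype.val ((algebraMap sL.algConst C).injective heq)
    have h2 : sL.sigma^[b - a] θ = θ := by
      refine (sL.sigma.injective.iterate a ?_).symm
      rw [h1, ← Function.iterate_add_apply, Nat.add_sub_cancel' hab.le]
    exact absurd (Nat.le_of_dvd (by omega) (hθl _ h2)) (by omega)
  -- The j-th homomorphism is π ∘ σ^(l-1-j), whose exponent decreases so that the (j+1)-st composed
  -- with σ is the j-th. Only the step from l - 1 back to 0 produces σ^l, which π turns into the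
  -- automorphism of L ⊗ C over D_L.
  refine exists_isSigmaDecomposition (h.pvTensorSD hC)
    (fun I hI => pvTensor_eq_bot_or_eq_top h hC hk I hI) hl0
    (fun j => π.comp ((h.pvTensorSD hC).iter (l - 1 - j)))
    (fun j => if (j : ℕ) + 1 = l then (sT.sigma : _ →+* _) else RingHom.id _) (fun j x => ?_)
    (fun i j hij => ?_)
  · have hrot : ((finRotate l j : Fin l) : ℕ) = (j + 1) % l := coe_finRotate_iterate 1 j
    rw [RingHom.comp_apply, RingHom.comp_apply, SDStruct.iter_apply, SDStruct.iter_apply,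
      ← Function.iterate_succ_apply]
    by_cases hj : (j : ℕ) + 1 = l
    · rw [hj, Nat.mod_self] at hrot
      rw [if_pos hj, hrot, show (l - 1 - 0).succ = l by omega, show l - 1 - (j : ℕ) = 0 by omega]
      exact (congrArg π ((h.pvTensorSD hC).pow_sigma_apply l x).symm).trans (hπ.sigma x)
    · rw [Nat.mod_eq_of_lt (by omega)] at hrot
      rw [if_neg hj, hrot, show (l - 1 - ((j : ℕ) + 1)).succ = l - 1 - j by omega]
      rfl
  · have hu : ∀ i : Fin l, t - pvInr k sL X C (τ (l - 1 - i)) ∈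
        RingHom.ker (π.comp ((h.pvTensorSD hC).iter (l - 1 - i))) := by
      intro i
      have h1 : (h.pvTensorSD hC).sigma^[l - 1 - i] (pvInr k sL X C (τ (l - 1 - i))) =
        pvInr k sL X C (τ (l - 1 - i)) :=
          Function.iterate_fixed (pvTensorSD_sigma_pvInr h hC _) _
      rw [RingHom.mem_ker, RingHom.comp_apply, map_sub, map_sub, SDStruct.iter_apply,
        SDStruct.iter_apply, h1, hτ, sub_self]
    have hne : τ (l - 1 - j) - τ (l - 1 - i) ≠ 0 := by
      rw [sub_ne_zero]
      have hij' : (i : ℕ) ≠ j := fun h => hij (Fin.ext h)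
      rcases Nat.lt_or_ge (l - 1 - j) (l - 1 - i) with h1 | h1
      · exact hτinj _ _ h1 (by omega)
      · exact (hτinj _ _ (by omega) (by omega)).symm
    -- The elements t - τ(l-1-i) and t - τ(l-1-j) of the two kernels differ by a non-zero element of
    -- the field C, so a combination of them is 1.
    have hinv : pvInr k sL X C (τ (l - 1 - j) - τ (l - 1 - i))⁻¹ *
        (pvInr k sL X C (τ (l - 1 - j)) - pvInr k sL X C (τ (l - 1 - i))) = 1 := by
      rw [← map_sub, ← map_mul, inv_mul_cancel₀ hne, map_one]
    change IsCoprime _ _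
    rw [Ideal.isCoprime_iff_exists]
    refine ⟨_, Ideal.mul_mem_left _ (pvInr k sL X C (τ (l - 1 - j) - τ (l - 1 - i))⁻¹) (hu i),
      _, Ideal.mul_mem_left _ (-pvInr k sL X C (τ (l - 1 - j) - τ (l - 1 - i))⁻¹) (hu j), ?_⟩
    linear_combination hinv

end Projection

/-! ### The main theorem -/

/-- The embedding D_L → C over C_L is given by the algebra structure and the scalar tower, so the
assertions hold for each embedding; one always exists because C is algebraically closed. The
equation `hk` expresses C_k = D_k. The degree enters as a variable l with an equation, so that any
decomposition indexed by `Fin l` is covered. -/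
theorem mainTheorem8 {k L C : Type*} [Field k] [CharZero k] [Field L] [Algebra k L]
    (sk : SDStruct k) (sL : SDStruct L) (hk : sk.algConst = ⊥)
    {m : ℕ} (A : GL (Fin m) k) (X : Matrix (Fin m) (Fin m) L)
    (h : IsGenericSolutionField sk sL A X)
    [Field C] [Algebra sL.const C] [IsAlgClosure sL.const C]
    (dC : Derivation ℤ C C)
    (hC : IsSDHom sL.constSD (SDStruct.ofDerivation dC) (algebraMap sL.const C))
    [Algebra sL.algConst C] [IsScalarTower sL.const sL.algConst C] :
    (IsPicardVessiot (h.pvTensorSD hC) (compositum k sL X C)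
        ((A : Matrix (Fin m) (Fin m) k).map (toPvTensor k sL X C)) ∧
      IsTotalFractionRing (pvTensorToField k sL X C) ∧
      IsSDHom (h.pvTensorSD hC)
        (SDStruct.tensor sL.constSD sL (SDStruct.ofDerivation dC) sL.constSD_isSDHom hC)
        (pvTensorToField k sL X C)) ∧
    FiniteDimensional sL.const sL.algConst ∧
    (∃ e : Fin (Module.finrank sL.const sL.algConst) → PvTensor k sL X C,
      IsSigmaDecomposition (h.pvTensorSD hC) e) ∧
    ∀ (l : ℕ), l = Module.finrank sL.const sL.algConst →
      ∀ (e : Fin l → PvTensor k sL X C)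
        (he : IsSigmaDecomposition (h.pvTensorSD hC) e) (i : Fin l),
        IsPicardVessiot (he.summandSD i)
          ((compositum k sL X C).map (toCorner (he.complete.idem i)))
          ((sigmaProd sk (A : Matrix (Fin m) (Fin m) k) l).map
            ((toCorner (he.complete.idem i)).comp (toPvTensor k sL X C))) ∧
        ∃ (sQ : SDStruct (FractionRing (he.complete.idem i).Corner))
          (sT : SDStruct (L ⊗[sL.algConst] C))
          (φ : FractionRing (he.complete.idem i).Corner ≃+* L ⊗[sL.algConst] C),
          IsSDHom (he.summandSD i) sQ (algebraMap _ _) ∧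
          (∀ (x : L) (c : C), sT.sigma (x ⊗ₜ c) = (sL.pow l).sigma x ⊗ₜ c) ∧
          (∀ (x : L) (c : C), sT.delta (x ⊗ₜ c) = sL.delta x ⊗ₜ c + x ⊗ₜ dC c) ∧
          IsSDHom sQ sT φ := by
  have : CharZero L := charZero_of_injective_algebraMap (algebraMap k L).injective
  have : Algebra.IsAlgebraic sL.const C := IsAlgClosure.isAlgebraic
  have hfin := h.finiteDimensional_algConst hk
  have hPV := isPicardVessiot_pvTensor h hC hk
  refine ⟨⟨hPV, isTotalFractionRing_pvTensorToField h, pvTensorToField_isSDHom h hC⟩, hfin,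
    exists_pvTensor_decomposition h hC hk rfl, fun l hl e he i => ⟨?_, ?_⟩⟩
  · refine he.isPicardVessiot (fun a => ?_) toPvTensor_mem_compositum
      ((Matrix.isUnit_iff_isUnit_det _).1 A.isUnit) hPV
      (fun I hI => pvTensor_eq_bot_or_eq_top h hC hk I hI) i
    refine congrArg (pvInl k sL X C) (Subtype.ext ?_)
    exact h.isSDHom.sigma a
  · have hfix := sL.exists_generator_algConst.1
    rw [← hl] at hfix
    obtain ⟨sT, π, hσ, hδ, hπ, -, -, hden⟩ := exists_projection h hC hfix
    have hQ : IsField (L ⊗[sL.algConst] C) := isField_tensorProduct_algConst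
    obtain ⟨sQ, φ, h1, h2⟩ := he.exists_ringEquiv_fractionRing (Q := L ⊗[sL.algConst] C) hQ
      (fun I hI => pvTensor_eq_bot_or_eq_top h hC hk I hI) hπ
      hden i
    exact ⟨sQ, sT, φ, h1, hσ, hδ, h2⟩

end
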